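/- For real $X$ write $[X]:=\{n\in\mathbb{N}: 1\le n\le X\}$. For positive integers $N,q$ set $M:=(N/q)^{1/2}$ and, for finitely supported $f_0,f_1,f_2:\mathbb{Z}\to\mathbb{C}$, $$\Lambda_q(f_0,f_1,f_2):=\sum_{x\in\mathbb{Z}}\ \sum_{y\in[M]} f_0(x)\,f_1(x+y)\,f_2(x+qy^2).$$ **Theorem 7.1 ($U^1$-control).** There is an absolute constant $C>0$ such that the following holds. Let $N$ and $q$ be positive integers, let $f_0,f_1,f_2:\mathbb{Z}\to\mathbb{C}$ be $1$-bounded functions (that is, $|f_i(x)|\le 1$ for all $x\in\mathbb{Z}$) supported in $[N]$, and let $\delta>0$. Suppose that $N\ge C q\delta^{-72}$ and $$|\Lambda_q(f_0,f_1,f_2)|\ge \delta N M .$$ Then there exist positive integers $q'$ and $N'$ with $$q'\le C\,\delta^{-2^{151}},\qquad C^{-1}\delta^{2^{153}}\frac{M}{q}\le N'\le M,$$ such that $$\sum_{x\in\mathbb{Z}}\Big|\sum_{y\in[N']} f_1(x+qq'y)\Big|\ \ge\ C^{-1}\delta^{2^{155}} N N' .$$ -/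

import Mathlib

namespace NonlinearRoth

/-- For real `X`, the initial segment `[X] = [1, X] ∩ ℕ` of the positive integers. -/
noncomputable def seg (X : ℝ) : Finset ℕ := Finset.Icc 1 ⌊X⌋₊

/-- `f : ℤ → ℂ` is `1`-bounded: `‖f‖_∞ ≤ 1`. -/
def OneBounded (f : ℤ → ℂ) : Prop := ∀ x : ℤ, ‖f x‖ ≤ 1

/-- `f : ℤ → ℂ` is supported in the interval `[N] = {1, …, N}`. -/
def SupportedIn (N : ℕ) (f : ℤ → ℂ) : Prop := ∀ x : ℤ, x ∉ Set.Icc (1 : ℤ) N → f x = 0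

/-- The scale `M = (N / q) ^ (1 / 2)`, a real number. -/
noncomputable def scale (N q : ℕ) : ℝ := √((N : ℝ) / q)

/-- The counting operator
`Λ_q(f₀, f₁, f₂) = ∑_x ∑_{y ∈ [(N / q) ^ (1 / 2)]} f₀(x) f₁(x + y) f₂(x + q y²)`.
The sum over `x ∈ ℤ` has finitely many nonzero terms as soon as `f₀` is finitely supported. -/
noncomputable def countOp (N q : ℕ) (f₀ f₁ f₂ : ℤ → ℂ) : ℂ :=
  ∑' x : ℤ, ∑ y ∈ seg (scale N q), f₀ x * f₁ (x + y) * f₂ (x + q * (y : ℤ) ^ 2)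

/-- `∑_x |∑_{y ∈ [K]} f(x + d y)|`, the sum of the absolute values of the sums of `f` over all
translates of the progression `d · [K]`; it has finitely many nonzero terms when `f` is finitely
supported. -/
noncomputable def localSum (d K : ℕ) (f : ℤ → ℂ) : ℝ :=
  ∑' x : ℤ, ‖∑ y ∈ seg K, f (x + d * (y : ℤ))‖

end NonlinearRoth

namespace NonlinearRoth

open Finset ComplexConjugate

/-! ### Cauchy–Schwarz inequalities -/

/-! Let m = ⌊M⌋ and place the functions on `ZMod (q * P)` with P comparable to m², large enough that
nothing wraps around. The multiples of q form the kernel of `fib`, and its cosets, the fibres, have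
P elements. Cauchy–Schwarz (`count_dual_ge`) replaces f₂ by the conjugate of the dual function F,
the average over j of f₀(x - q j²) f₁(x + j - q j²).

PET differencing (`pet_linearise`, `energy_of_count`) shows that F keeps a large fibre energy after
three multiplicative derivatives, in directions 2qkt, 2qhu, 2qh'u'. These directions are products of
short variables. Most pairs of integers have a small gcd, so differences of such products hit each
multiple of q with bounded multiplicity (`sum_bilinear_le`), and short averages are controlled by
averages over a full fibre.

Degree lowering then removes the derivatives. `exists_char_of_energy` trades one derivative for a
character on each fibre. Because F is a dual function, expanding it turns a correlation with
characters into bilinear sums with phase e(θ j²), and Weyl's inequality makes these negligible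
unless θ lies on a major arc (`norm_sum_quadratic_phase_le`). Hence mixed differences of the
frequencies often lie in a small set of residues. Pigeonholing splits the frequencies into pieces
depending on fewer parameters, and Cauchy–Schwarz discards the pieces. The rounds
`energy_of_char_box` and `energy_of_char_line` lead to `exists_char_dual`: F itself correlates with
one character on each fibre.

Expanding F once more, only major arc frequencies matter, so f₁ correlates with e(θ j²) for θ close
to a rational of small denominator d. Such a phase is almost constant on progressions of step qd and
length a small multiple of m/q, which leaves averages of f₁ alone (`exists_local_of_char`). If m/q
is too small for this, N' = 1 suffices. Every loss is a power of δ, with total exponent 2 ·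
29054267286336 · 742 < 2 ^ 56. -/

theorem norm_sum_mul_sq_le {ι : Type*} (s : Finset ι) (A W : ι → ℂ) (hA : ∀ i ∈ s, ‖A i‖ ≤ 1) :
    ‖∑ i ∈ s, A i * W i‖ ^ 2 ≤ s.card * ∑ i ∈ s, ‖W i‖ ^ 2 := by
  have h1 : ‖∑ i ∈ s, A i * W i‖ ≤ ∑ i ∈ s, ‖W i‖ := by
    refine (norm_sum_le _ _).trans (sum_le_sum fun i hi => ?_)
    rw [norm_mul]
    exact mul_le_of_le_one_left (norm_nonneg _) (hA i hi)
  calc ‖∑ i ∈ s, A i * W i‖ ^ 2 ≤ (∑ i ∈ s, ‖W i‖) ^ 2 := by gcongr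
    _ ≤ _ := sq_sum_le_card_mul_sum_sq

theorem ofReal_norm_sum_sq {ι : Type*} (s : Finset ι) (g : ι → ℂ) :
    ((‖∑ y ∈ s, g y‖ ^ 2 : ℝ) : ℂ) = ∑ y ∈ s, ∑ y' ∈ s, g y * conj (g y') := by
  rw [← sum_mul_sum, ← map_sum, Complex.mul_conj, Complex.normSq_eq_norm_sq]

theorem sum_norm_sum_sq {κ ι : Type*} (t : Finset κ) (s : Finset ι) (g : κ → ι → ℂ) :
    ∑ x ∈ t, ‖∑ y ∈ s, g x y‖ ^ 2 = ‖∑ y ∈ s, ∑ y' ∈ s, ∑ x ∈ t, g x y * conj (g x y')‖ := by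
  have h : ((∑ x ∈ t, ‖∑ y ∈ s, g x y‖ ^ 2 : ℝ) : ℂ) =
      ∑ y ∈ s, ∑ y' ∈ s, ∑ x ∈ t, g x y * conj (g x y') := by
    rw [Complex.ofReal_sum, sum_congr rfl fun x _ => ofReal_norm_sum_sq s (g x), sum_comm]
    exact sum_congr rfl fun y _ => sum_comm
  rw [← h, Complex.norm_real, Real.norm_of_nonneg (sum_nonneg fun x _ => sq_nonneg _)]

/-- Cauchy–Schwarz, discarding a bounded function that does not depend on `p`. -/
theorem norm_sum_sq_le_doubled {ι α : Type*} (S : Finset ι) (T : Finset α) (A : ι → ℂ)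
    (W : ι → α → ℂ) (hA : ∀ i ∈ S, ‖A i‖ ≤ 1) :
    ‖∑ s ∈ S, A s * ∑ p ∈ T, W s p‖ ^ 2 ≤
      S.card * ‖∑ p ∈ T, ∑ p' ∈ T, ∑ s ∈ S, W s p * conj (W s p')‖ := by
  rw [← sum_norm_sum_sq]
  exact norm_sum_mul_sq_le S A _ hA

/-- The Gowers–Cauchy–Schwarz inequality for the two-dimensional box norm. -/
theorem norm_sum_pow_four_le_box {ι α β : Type*} (S : Finset ι) (T : Finset α) (T' : Finset β)
    (A : ι → α → ℂ) (B : ι → β → ℂ) (W : ι → α → β → ℂ)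
    (hA : ∀ s ∈ S, ∀ p ∈ T, ‖A s p‖ ≤ 1) (hB : ∀ s ∈ S, ∀ p ∈ T', ‖B s p‖ ≤ 1) :
    ‖∑ s ∈ S, ∑ p ∈ T, ∑ p' ∈ T', A s p * B s p' * W s p p'‖ ^ 4 ≤
      (S.card : ℝ) ^ 3 * T.card ^ 2 * T'.card ^ 2 *
        ∑ s ∈ S, ∑ p₁ ∈ T, ∑ p₂ ∈ T, ‖∑ p' ∈ T', W s p₁ p' * conj (W s p₂ p')‖ ^ 2 := by
  -- The first Cauchy–Schwarz is over `(s, p')` and removes `B`; the second, `h3`, is over `(s, p₁,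
  -- p₂)` and removes `A`.
  have h1 : ‖∑ s ∈ S, ∑ p ∈ T, ∑ p' ∈ T', A s p * B s p' * W s p p'‖ ^ 2 ≤
      (S.card * T'.card : ℝ) *
        ‖∑ p ∈ T, ∑ p' ∈ T, ∑ x ∈ S ×ˢ T',
          A x.1 p * W x.1 p x.2 * conj (A x.1 p' * W x.1 p' x.2)‖ := by
    have := norm_sum_sq_le_doubled (S ×ˢ T') T (fun x => B x.1 x.2)
      (fun x p => A x.1 p * W x.1 p x.2) (fun x hx => hB _ (mem_product.1 hx).1 _
        (mem_product.1 hx).2)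
    rw [card_product, Nat.cast_mul] at this
    convert this using 3
    rw [sum_product]
    refine sum_congr rfl fun s _ => ?_
    rw [sum_comm]
    refine sum_congr rfl fun p _ => ?_
    rw [mul_sum]
    exact sum_congr rfl fun _ _ => by ring
  have h2 : (∑ p ∈ T, ∑ p' ∈ T, ∑ x ∈ S ×ˢ T',
          A x.1 p * W x.1 p x.2 * conj (A x.1 p' * W x.1 p' x.2)) =
      ∑ x ∈ S ×ˢ (T ×ˢ T), (A x.1 x.2.1 * conj (A x.1 x.2.2)) *
        ∑ p' ∈ T', W x.1 x.2.1 p' * conj (W x.1 x.2.2 p') := by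
    simp_rw [sum_product]
    rw [sum_congr rfl fun p _ => sum_comm, sum_comm]
    refine sum_congr rfl fun s _ => sum_congr rfl fun p _ => sum_congr rfl fun p' _ => ?_
    rw [mul_sum]
    refine sum_congr rfl fun _ _ => ?_
    rw [map_mul]; ring
  have h3 := norm_sum_mul_sq_le (S ×ˢ (T ×ˢ T)) (fun x => A x.1 x.2.1 * conj (A x.1 x.2.2))
    (fun x => ∑ p' ∈ T', W x.1 x.2.1 p' * conj (W x.1 x.2.2 p')) (by
      intro x hx
      simp only [mem_product] at hx
      rw [norm_mul, RCLike.norm_conj]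
      exact mul_le_one₀ (hA _ hx.1 _ hx.2.1) (norm_nonneg _) (hA _ hx.1 _ hx.2.2))
  rw [h2] at h1
  simp_rw [sum_product, card_product] at h3
  simp_rw [sum_product] at h1
  calc _ = (‖∑ s ∈ S, ∑ p ∈ T, ∑ p' ∈ T', A s p * B s p' * W s p p'‖ ^ 2) ^ 2 := by ring
    _ ≤ _ := pow_le_pow_left₀ (by positivity) h1 2
    _ = (S.card * T'.card : ℝ) ^ 2 * _ ^ 2 := mul_pow _ _ _
    _ ≤ (S.card * T'.card : ℝ) ^ 2 * _ := mul_le_mul_of_nonneg_left h3 (by positivity)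
    _ = _ := by push_cast; ring

/-! ### Differencing over an interval of integers -/

/-- The indicator function of a finite set of integers. -/
def ind (J : Finset ℤ) (y : ℤ) : ℂ := if y ∈ J then 1 else 0

theorem norm_ind_le (J : Finset ℤ) (y : ℤ) : ‖ind J y‖ ≤ 1 := by
  unfold ind; split_ifs <;> simp

theorem conj_ind (J : Finset ℤ) (y : ℤ) : conj (ind J y) = ind J y := by
  unfold ind; split_ifs <;> simp

/-- Substitution y' = y + k. The constraint on y + k is carried by `ind`, so the ranges of k and y
are independent and the indicator can later be absorbed into a 1-bounded weight. -/
theorem sum_sum_eq_sum_diff (m : ℕ) (g : ℤ → ℤ → ℂ) :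
    ∑ y ∈ Icc 1 (m : ℤ), ∑ y' ∈ Icc 1 (m : ℤ), g y y' =
      ∑ k ∈ Icc (-m : ℤ) m, ∑ y ∈ Icc 1 (m : ℤ), ind (Icc 1 (m : ℤ)) (y + k) * g y (y + k) := by
  rw [sum_comm (s := Icc (-m : ℤ) m)]
  refine sum_congr rfl fun y hy => ?_
  simp only [ind, ite_mul, one_mul, zero_mul]
  rw [← sum_filter]
  refine sum_bij' (fun y' _ => y' - y) (fun k _ => y + k) ?_ ?_ ?_ ?_ ?_
  · intro a ha; simp only [mem_filter, mem_Icc] at *; omega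
  · intro a ha; simp only [mem_filter, mem_Icc] at *; omega
  · intro a ha; ring
  · intro a ha; ring
  · intro a ha; congr 1; ring

theorem card_Icc_one (m : ℕ) : (Icc 1 (m : ℤ)).card = m := by simp

theorem card_Icc_neg (m : ℕ) : (Icc (-m : ℤ) m).card = 2 * m + 1 := by
  rw [Int.card_Icc]; omega

/-! ### Distance to the nearest integer -/

/-- The distance from a real number to the nearest integer. -/
noncomputable def distInt (x : ℝ) : ℝ := |x - round x|

theorem distInt_nonneg (x : ℝ) : 0 ≤ distInt x := abs_nonneg _

theorem distInt_le (x : ℝ) (z : ℤ) : distInt x ≤ |x - z| := round_le x z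

theorem distInt_sub_le (x y : ℝ) : distInt (x - y) ≤ distInt x + distInt y := by
  refine (distInt_le _ (round x - round y)).trans ?_
  have : x - y - ((round x - round y : ℤ) : ℝ) = (x - round x) - (y - round y) := by
    push_cast; ring
  rw [this]
  exact abs_sub _ _

theorem distInt_neg (x : ℝ) : distInt (-x) = distInt x := by
  have h : ∀ y, distInt (-y) ≤ distInt y := fun y => by
    refine (distInt_le _ (-round y)).trans (le_of_eq ?_)
    rw [distInt, ← abs_neg]; push_cast; ring_nf
  exact le_antisymm (h x) (by simpa using h (-x))

theorem distInt_int_add (n : ℤ) (x : ℝ) : distInt (n + x) = distInt x := by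
  unfold distInt
  rw [round_intCast_add]
  push_cast
  ring_nf

theorem distInt_eq_abs {x : ℝ} (hx : |x| < 1 / 2) : distInt x = |x| := by
  have : round x = 0 := by
    rw [round_eq, Int.floor_eq_zero_iff]
    rw [abs_lt] at hx
    constructor <;> linarith [hx.1, hx.2]
  simp [distInt, this]

/-- Dividing the distance to the least element by `d` embeds the set into the integers of `[0, X]`.
-/
theorem card_le_of_pairwise_close {H : Finset ℤ} {d : ℕ} (hd : 0 < d) {X : ℝ} (hX : 0 ≤ X)
    (hmod : ∀ a ∈ H, ∀ b ∈ H, a % d = b % d) (hclose : ∀ a ∈ H, ∀ b ∈ H, (a - b : ℝ) ≤ d * X) :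
    (H.card : ℝ) ≤ X + 1 := by
  rcases H.eq_empty_or_nonempty with rfl | hne
  · simp; positivity
  set a := H.min' hne
  have ha : a ∈ H := H.min'_mem hne
  have hd' : (0 : ℤ) < d := by exact_mod_cast hd
  have hcard : H.card ≤ (Icc (0 : ℤ) ⌊X⌋).card := by
    refine card_le_card_of_injOn (fun h => (h - a) / d) ?_ ?_
    · intro h hh
      simp only [coe_Icc, Set.mem_Icc]
      have h1 : a ≤ h := H.min'_le h hh
      refine ⟨Int.ediv_nonneg (by linarith) hd'.le, ?_⟩
      rw [Int.le_floor]
      have h2 := hclose h hh a ha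
      have h3 : ((h - a) / d : ℤ) * d ≤ h - a := Int.ediv_mul_le _ hd'.ne'
      have h4 : (((h - a) / d : ℤ) : ℝ) * d ≤ h - a := by exact_mod_cast h3
      have hd'' : (0 : ℝ) < d := by exact_mod_cast hd
      nlinarith
    · intro h hh k hk hhk
      have e1 := Int.emod_add_mul_ediv (h - a) d
      have e2 := Int.emod_add_mul_ediv (k - a) d
      have m1 : (h - a) % d = 0 := Int.emod_eq_emod_iff_emod_sub_eq_zero.1 (hmod h hh a ha)
      have m2 : (k - a) % d = 0 := Int.emod_eq_emod_iff_emod_sub_eq_zero.1 (hmod k hk a ha)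
      simp only at hhk
      rw [m1, hhk] at e1
      rw [m2] at e2
      linarith
  rw [Int.card_Icc] at hcard
  have h5 : (0 : ℤ) ≤ ⌊X⌋ := Int.floor_nonneg.2 hX
  have h6 : (H.card : ℤ) ≤ ⌊X⌋ + 1 := by
    have : ((⌊X⌋ + 1 - 0).toNat : ℤ) = ⌊X⌋ + 1 := by rw [Int.toNat_of_nonneg] <;> omega
    omega
  have h7 : (H.card : ℝ) ≤ ⌊X⌋ + 1 := by exact_mod_cast h6
  linarith [Int.floor_le X]

/-- Counts the blocks of length `w` that meet `[-m, m]`, for use as pigeonholes. -/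
theorem card_Icc_ediv_le (m : ℕ) {w : ℕ} (hw : 0 < w) :
    ((Icc ((-m : ℤ) / w) ((m : ℤ) / w)).card : ℝ) ≤ 2 * m / w + 2 := by
  have hw' : (0 : ℤ) < w := by exact_mod_cast hw
  have hwr : (0 : ℝ) < w := by exact_mod_cast hw
  have h0 : (-m : ℤ) / w ≤ (m : ℤ) / w := Int.ediv_le_ediv hw' (by omega)
  rw [Int.card_Icc]
  have h1 : (((m : ℤ) / w + 1 - (-m : ℤ) / w).toNat : ℤ) = (m : ℤ) / w + 1 - (-m : ℤ) / w := by
    rw [Int.toNat_of_nonneg]; omega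
  have h2 : (((m : ℤ) / w : ℤ) : ℝ) * w ≤ m := by
    exact_mod_cast Int.ediv_mul_le (m : ℤ) hw'.ne'
  have h3 : (-m : ℝ) < ((((-m : ℤ) / w : ℤ) : ℝ) + 1) * w := by
    exact_mod_cast Int.lt_ediv_add_one_mul_self (-m : ℤ) hw'
  have h4 : (((((m : ℤ) / w + 1 - (-m : ℤ) / w).toNat : ℕ)) : ℝ) =
      (((m : ℤ) / w : ℤ) : ℝ) + 1 - (((-m : ℤ) / w : ℤ) : ℝ) := by exact_mod_cast h1
  rw [h4]
  have h5 : (((m : ℤ) / w : ℤ) : ℝ) ≤ m / w := by rwa [le_div_iff₀ hwr]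
  have h6 : -(m / w : ℝ) ≤ (((-m : ℤ) / w : ℤ) : ℝ) + 1 := by
    rw [← neg_div, div_le_iff₀ hwr]; exact h3.le
  have h7 : (2 * m / w : ℝ) = m / w + m / w := by ring
  rw [h7]; linarith

/-- If `h β` is close to an integer for many `|h| ≤ m`, then `β` is very close to a rational
number with small denominator. -/
theorem exists_denominator_of_many {m : ℕ} {η ε β : ℝ} (hη : 0 < η) (hη1 : η ≤ 1 / 128)
    (hm : 128 ≤ η * m) (H : Finset ℤ) (hH : H ⊆ Icc (-m : ℤ) m) (hcard : η * m ≤ H.card)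
    (hε : 128 * ε ≤ η) (hβ : ∀ h ∈ H, distInt (h * β) ≤ ε) :
    ∃ d : ℕ, 0 < d ∧ d * η ^ 2 ≤ 1 ∧ distInt (d * β) * (η ^ 3 * m) ≤ ε := by
  have hm0 : (0 : ℝ) < m := by
    by_contra hcon
    nlinarith
  obtain ⟨h0, hh0⟩ : H.Nonempty := by
    rw [← card_pos]; have : (0 : ℝ) < H.card := by linarith
    exact_mod_cast this
  have hε0 : 0 ≤ ε := (distInt_nonneg _).trans (hβ h0 hh0)
  -- Blocks of length about 4/η are fewer than the elements of `H`, so two elements share a block;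
  -- `d` is the absolute value of their difference.
  obtain ⟨d, hd0, hd5, hdβ⟩ : ∃ d : ℕ, 0 < d ∧ d * η ≤ 5 ∧ distInt (d * β) ≤ 2 * ε := by
    set w := ⌈4 / η⌉₊ with hw
    have hw4 : 4 / η ≤ w := Nat.le_ceil _
    have hw0 : 0 < w := Nat.ceil_pos.2 (by positivity)
    have hwr : (0 : ℝ) < w := by exact_mod_cast hw0
    have hw5 : (w : ℝ) < 4 / η + 1 := Nat.ceil_lt_add_one (by positivity)
    have hlt : (Icc ((-m : ℤ) / w) ((m : ℤ) / w)).card < H.card := by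
      have h1 := card_Icc_ediv_le m hw0
      have h2 : (2 * m / w : ℝ) ≤ η * m / 2 := by
        rw [div_le_iff₀ hwr]
        rw [div_le_iff₀ hη] at hw4
        nlinarith
      have : ((Icc ((-m : ℤ) / w) ((m : ℤ) / w)).card : ℝ) < H.card := by linarith
      exact_mod_cast this
    have hw' : (0 : ℤ) < w := by exact_mod_cast hw0
    obtain ⟨a, ha, b, hb, hab, heq⟩ := exists_ne_map_eq_of_card_lt_of_maps_to
      (s := H) (t := Icc ((-m : ℤ) / w) ((m : ℤ) / w)) (f := fun h => h / (w : ℤ)) hlt (by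
        intro h hh
        have := mem_Icc.1 (hH hh)
        simp only [coe_Icc, Set.mem_Icc]
        exact ⟨Int.ediv_le_ediv hw' this.1, Int.ediv_le_ediv hw' this.2⟩)
    have e1 := Int.emod_add_mul_ediv a w
    have e2 := Int.emod_add_mul_ediv b w
    have l1 := Int.emod_lt_of_pos a hw'
    have l2 := Int.emod_lt_of_pos b hw'
    have p1 := Int.emod_nonneg a hw'.ne'
    have p2 := Int.emod_nonneg b hw'.ne'
    have hlt' : (a - b).natAbs < w := by rw [heq] at e1; omega
    refine ⟨(a - b).natAbs, by omega, ?_, ?_⟩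
    · have : ((a - b).natAbs : ℝ) ≤ w := by exact_mod_cast hlt'.le
      have h3 : (4 / η + 1) * η = 4 + η := by field_simp
      nlinarith
    · have key : distInt ((a - b : ℤ) * β) ≤ 2 * ε := by
        have := distInt_sub_le (a * β) (b * β)
        rw [← sub_mul] at this
        push_cast
        linarith [hβ a ha, hβ b hb]
      rcases Int.natAbs_eq (a - b) with h | h
      · have h' : (((a - b).natAbs : ℕ) : ℝ) = ((a - b : ℤ) : ℝ) := by
          rw [← Int.cast_natCast (R := ℝ), ← h]
        rw [h']; exact key
      · have h' : (((a - b).natAbs : ℕ) : ℝ) = -((a - b : ℤ) : ℝ) := by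
          rw [← Int.cast_natCast (R := ℝ), ← Int.cast_neg]
          congr 1
          omega
        rw [h', neg_mul, distInt_neg]; exact key
  refine ⟨d, hd0, by nlinarith, ?_⟩
  have hdr : (0 : ℝ) < d := by exact_mod_cast hd0
  set θ := d * β - round (d * β) with hθ
  have hθd : distInt (d * β) = |θ| := rfl
  rw [hθd] at hdβ ⊢
  rcases (abs_nonneg θ).eq_or_lt with h0 | hθ0
  · rw [← h0]; simpa using hε0
  -- For |i| < B the multiple iθ has size below 1/2, so its distance to the nearest integer is
  -- exactly |i||θ|.
  set B := ⌊1 / (4 * |θ|)⌋₊ with hB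
  have hθ8 : |θ| ≤ 1 / 8 := by linarith
  have hB1 : (B : ℝ) * (4 * |θ|) ≤ 1 := by
    rw [← le_div_iff₀ (by positivity)]; exact Nat.floor_le (by positivity)
  have hB2 : 1 ≤ (B : ℝ) * (8 * |θ|) := by
    have := Nat.lt_floor_add_one (1 / (4 * |θ|))
    rw [div_lt_iff₀ (by positivity)] at this
    rw [← hB] at this
    nlinarith
  have hB0 : 0 < B := by
    rcases Nat.eq_zero_or_pos B with h | h
    · rw [h] at hB2; norm_num at hB2
    · exact h
  have hBr : (0 : ℝ) < B := by exact_mod_cast hB0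
  have hdB : 0 < d * B := Nat.mul_pos hd0 hB0
  have hdB' : (0 : ℤ) < (d * B : ℕ) := by exact_mod_cast hdB
  have hd' : (0 : ℤ) < d := by exact_mod_cast hd0
  -- Two elements of `H` with the same residue modulo d and the same block of length dB differ by
  -- d·i with |i| < B. Closeness to integers then forces |i||θ| ≤ 2ε, so each class has few
  -- elements, and there are few classes.
  set key : ℤ → ℤ × ℤ := fun h => (h % d, h / (d * B : ℕ)) with hkey
  have himg : ((H.image key).card : ℝ) ≤ d * (2 * m / (d * B : ℕ) + 2) := by
    have hsub : H.image key ⊆ Ico (0 : ℤ) d ×ˢ Icc ((-m : ℤ) / (d * B : ℕ)) ((m : ℤ) / (d * B : ℕ)) := by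
      intro x hx
      obtain ⟨h, hh, rfl⟩ := mem_image.1 hx
      have := mem_Icc.1 (hH hh)
      simp only [hkey, mem_product, mem_Ico, mem_Icc]
      exact ⟨⟨Int.emod_nonneg _ hd'.ne', Int.emod_lt_of_pos _ hd'⟩,
        Int.ediv_le_ediv hdB' this.1, Int.ediv_le_ediv hdB' this.2⟩
    have h1 := card_le_card hsub
    rw [card_product, Int.card_Ico] at h1
    have h2 : ((H.image key).card : ℝ) ≤
        d * (Icc ((-m : ℤ) / (d * B : ℕ)) ((m : ℤ) / (d * B : ℕ))).card := by
      simp only [sub_zero, Int.toNat_natCast] at h1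
      exact_mod_cast h1
    refine h2.trans (mul_le_mul_of_nonneg_left (card_Icc_ediv_le m hdB) hdr.le)
  have hfib : ∀ x ∈ H.image key, (({h ∈ H | key h = x}.card : ℕ) : ℝ) ≤ 2 * ε / |θ| + 1 := by
    intro x _
    refine card_le_of_pairwise_close hd0 (by positivity) ?_ ?_
    · intro a ha b hb
      have ha := (mem_filter.1 ha).2
      have hb := (mem_filter.1 hb).2
      exact (Prod.ext_iff.1 (ha.trans hb.symm)).1
    · intro a ha b hb
      obtain ⟨haH, ha⟩ := mem_filter.1 ha
      obtain ⟨hbH, hb⟩ := mem_filter.1 hb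
      obtain ⟨k1, k2⟩ := Prod.ext_iff.1 (ha.trans hb.symm)
      simp only [hkey] at k1 k2
      obtain ⟨i, hi⟩ : (d : ℤ) ∣ a - b :=
        Int.dvd_of_emod_eq_zero (Int.emod_eq_emod_iff_emod_sub_eq_zero.1 k1)
      have e1 := Int.emod_add_mul_ediv a (d * B : ℕ)
      have e2 := Int.emod_add_mul_ediv b (d * B : ℕ)
      have l1 := Int.emod_lt_of_pos a hdB'
      have l2 := Int.emod_lt_of_pos b hdB'
      have p1 := Int.emod_nonneg a hdB'.ne'
      have p2 := Int.emod_nonneg b hdB'.ne'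
      have hlt : |a - b| < (d * B : ℕ) := by rw [k2] at e1; rw [abs_lt]; constructor <;> omega
      have hiB : |i| < B := by
        rw [hi, abs_mul, Nat.abs_cast] at hlt
        push_cast at hlt
        exact lt_of_mul_lt_mul_left hlt hd'.le
      have hiBr : |(i : ℝ)| ≤ B := by exact_mod_cast hiB.le
      have hab : ((a - b : ℝ)) = d * i := by exact_mod_cast hi
      have hdist : distInt ((a - b) * β) ≤ 2 * ε := by
        have := distInt_sub_le (a * β) (b * β)
        rw [← sub_mul] at this
        linarith [hβ a haH, hβ b hbH]
      have hval : (a - b) * β = ((i * round (d * β) : ℤ) : ℝ) + i * θ := by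
        rw [hab, hθ]; push_cast; ring
      have hsmall : |i * θ| < 1 / 2 := by
        rw [abs_mul]
        nlinarith
      rw [hval, distInt_int_add, distInt_eq_abs hsmall, abs_mul] at hdist
      rw [hab]
      refine mul_le_mul_of_nonneg_left ((le_abs_self _).trans ?_) hdr.le
      rwa [le_div_iff₀ hθ0]
  have htot : (H.card : ℝ) ≤ (2 * ε / |θ| + 1) * (d * (2 * m / (d * B : ℕ) + 2)) := by
    have h1 : (H.card : ℝ) = ∑ x ∈ H.image key, (({h ∈ H | key h = x}.card : ℕ) : ℝ) := by
      exact_mod_cast card_eq_sum_card_image key H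
    rw [h1]
    calc _ ≤ ∑ x ∈ H.image key, (2 * ε / |θ| + 1) := sum_le_sum hfib
      _ = (2 * ε / |θ| + 1) * (H.image key).card := by rw [sum_const, nsmul_eq_mul, mul_comm]
      _ ≤ _ := mul_le_mul_of_nonneg_left himg (by positivity)
  have h1 : 2 * ε / |θ| + 1 ≤ 4 * ε / |θ| := by
    have : 1 ≤ 2 * ε / |θ| := by rwa [le_div_iff₀ hθ0, one_mul]
    calc _ ≤ 2 * ε / |θ| + 2 * ε / |θ| := by linarith
      _ = _ := by ring
  have h2 : (d * (2 * m / (d * B : ℕ) + 2) : ℝ) ≤ 16 * m * |θ| + 2 * d := by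
    have : (d * (2 * m / (d * B : ℕ) + 2) : ℝ) = 2 * m / B + 2 * d := by
      push_cast; field_simp
    rw [this]
    have : (2 * m / B : ℝ) ≤ 16 * m * |θ| := by
      rw [div_le_iff₀ hBr]; nlinarith
    linarith
  have h3 : (H.card : ℝ) ≤ 4 * ε / |θ| * (16 * m * |θ| + 2 * d) :=
    htot.trans (mul_le_mul h1 h2 (by positivity) (by positivity))
  have h4 : 4 * ε / |θ| * (16 * m * |θ| + 2 * d) = 64 * ε * m + 8 * ε * d / |θ| := by
    field_simp; ring
  -- The term 64εm is at most half of ηm because 128ε ≤ η, so the other term must carry the count;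
  -- this bounds |θ|.
  have h5 : η * m / 2 ≤ 8 * ε * d / |θ| := by
    rw [h4] at h3
    nlinarith
  rw [le_div_iff₀ hθ0] at h5
  have h6 : η * (η * m / 2 * |θ|) ≤ 8 * ε * 5 := by
    calc _ ≤ η * (8 * ε * d) := mul_le_mul_of_nonneg_left h5 hη.le
      _ = 8 * ε * (d * η) := by ring
      _ ≤ _ := mul_le_mul_of_nonneg_left hd5 (by positivity)
  have h7 : |θ| * (η ^ 3 * m) = 2 * η * (η * (η * m / 2 * |θ|)) := by ring
  rw [h7]
  calc _ ≤ 2 * η * (8 * ε * 5) := mul_le_mul_of_nonneg_left h6 (by positivity)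
    _ = 80 * η * ε := by ring
    _ ≤ 1 * ε := mul_le_mul_of_nonneg_right (by linarith) hε0
    _ = ε := one_mul _

/-! ### Exponential sums -/

/-- `e(t) = exp(2 π i t)`. -/
noncomputable def e (t : ℝ) : ℂ := Complex.exp ((2 * Real.pi * t : ℝ) * Complex.I)

theorem norm_e (t : ℝ) : ‖e t‖ = 1 := Complex.norm_exp_ofReal_mul_I _

theorem e_add (s t : ℝ) : e (s + t) = e s * e t := by
  rw [e, e, e, ← Complex.exp_add]; push_cast; ring_nf

theorem e_int (n : ℤ) : e n = 1 := by
  rw [e, Complex.exp_eq_one_iff]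
  exact ⟨n, by push_cast; ring⟩

theorem conj_e (t : ℝ) : conj (e t) = e (-t) := by
  rw [e, e, ← Complex.exp_conj, map_mul, Complex.conj_ofReal, Complex.conj_I]
  push_cast
  ring_nf

theorem norm_e_sub_one (t : ℝ) : ‖e t - 1‖ = 2 * |Real.sin (Real.pi * t)| := by
  have h := Complex.norm_exp_I_mul_ofReal_sub_one (2 * Real.pi * t)
  rw [e, mul_comm, h, Real.norm_eq_abs, abs_mul, abs_two]
  ring_nf

theorem norm_e_sub_one_le (t : ℝ) : ‖e t - 1‖ ≤ 7 * |t| := by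
  rw [norm_e_sub_one]
  have h1 : |Real.sin (Real.pi * t)| ≤ Real.pi * |t| := by
    refine Real.abs_sin_le_abs.trans ?_
    rw [abs_mul, abs_of_pos Real.pi_pos]
  have := Real.pi_lt_d2
  nlinarith [abs_nonneg t]

theorem le_norm_e_sub_one (t : ℝ) : 4 * distInt t ≤ ‖e t - 1‖ := by
  have h1 : e t = e (t - round t) := by
    conv_lhs => rw [← sub_add_cancel t (round t), e_add, e_int, mul_one]
  rw [h1, norm_e_sub_one]
  have h2 : |Real.pi * (t - round t)| ≤ Real.pi / 2 := by
    rw [abs_mul, abs_of_pos Real.pi_pos]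
    have := abs_sub_round t
    nlinarith [Real.pi_pos]
  have h3 := Real.mul_abs_le_abs_sin h2
  rw [abs_mul, abs_of_pos Real.pi_pos, ← mul_assoc, div_mul_cancel₀ _ Real.pi_pos.ne'] at h3
  unfold distInt
  linarith

theorem sum_Icc_sub_succ (f : ℤ → ℂ) (a : ℤ) (n : ℕ) :
    ∑ j ∈ Ico a (a + n), (f (j + 1) - f j) = f (a + n) - f a := by
  induction n with
  | zero => simp
  | succ n ih =>
    have : Ico a (a + (n + 1 : ℕ)) = insert (a + n : ℤ) (Ico a (a + n)) := by
      ext x; simp only [mem_Ico, mem_insert]; omega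
    rw [this, sum_insert (by simp), ih]
    push_cast
    ring_nf

theorem norm_sum_Icc_sub_succ_le (f : ℤ → ℂ) (hf : ∀ j, ‖f j‖ ≤ 1) (a b : ℤ) :
    ‖∑ j ∈ Icc a b, (f (j + 1) - f j)‖ ≤ 2 := by
  rcases le_or_gt a b with h | h
  · obtain ⟨n, hn⟩ := Int.eq_ofNat_of_zero_le (show 0 ≤ b + 1 - a by omega)
    have : Icc a b = Ico a (a + n) := by ext x; simp only [mem_Icc, mem_Ico]; omega
    rw [this, sum_Icc_sub_succ]
    refine (norm_sub_le _ _).trans ?_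
    linarith [hf (a + n), hf a]
  · rw [Icc_eq_empty (by omega)]; simp

theorem norm_sum_Icc_shift_sub_le (f : ℤ → ℂ) (hf : ∀ j, ‖f j‖ ≤ 1) (a b : ℤ) (s : ℕ) :
    ‖∑ j ∈ Icc a b, f (j + s) - ∑ j ∈ Icc a b, f j‖ ≤ 2 * s := by
  induction s with
  | zero => simp
  | succ s ih =>
    have h := norm_sum_Icc_sub_succ_le (fun j => f (j + s)) (fun j => hf _) a b
    rw [sum_sub_distrib] at h
    have e1 : ∑ j ∈ Icc a b, f (j + (s + 1 : ℕ)) = ∑ j ∈ Icc a b, f (j + 1 + s) :=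
      sum_congr rfl fun j _ => by congr 1; push_cast; ring
    rw [e1]
    calc _ = ‖(∑ j ∈ Icc a b, f (j + 1 + s) - ∑ j ∈ Icc a b, f (j + s)) +
          (∑ j ∈ Icc a b, f (j + s) - ∑ j ∈ Icc a b, f j)‖ := by congr 1; ring
      _ ≤ _ := norm_add_le _ _
      _ ≤ 2 + 2 * s := add_le_add h ih
      _ = _ := by push_cast; ring

/-- Multiplying the geometric series by e(β) - 1 telescopes it. The division-free form also covers
integral β. -/
theorem norm_sum_e_mul_distInt_le (β : ℝ) (a b : ℤ) :
    ‖∑ j ∈ Icc a b, e (j * β)‖ * distInt β ≤ 1 := by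
  have h := norm_sum_Icc_sub_succ_le (fun j => e (j * β)) (fun j => (norm_e _).le) a b
  have h1 : ∑ j ∈ Icc a b, (e (((j + 1 : ℤ) : ℝ) * β) - e (j * β)) =
      (∑ j ∈ Icc a b, e (j * β)) * (e β - 1) := by
    rw [sum_mul]
    refine sum_congr rfl fun j _ => ?_
    rw [mul_sub, ← e_add, mul_one]
    push_cast
    ring_nf
  rw [h1, norm_mul] at h
  nlinarith [le_norm_e_sub_one β, norm_nonneg (∑ j ∈ Icc a b, e (j * β)), distInt_nonneg β]

theorem sum_le_card_filter_mul {ι : Type*} (s : Finset ι) (c : ι → ℝ) {B τ : ℝ}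
    (hB : ∀ i ∈ s, c i ≤ B) (hτ : 0 ≤ τ) :
    ∑ i ∈ s, c i ≤ ({i ∈ s | τ ≤ c i}.card : ℝ) * B + s.card * τ := by
  classical
  rw [← sum_filter_add_sum_filter_not s (fun i => τ ≤ c i)]
  refine add_le_add ?_ ?_
  · rw [← nsmul_eq_mul]
    exact sum_le_card_nsmul _ _ _ fun i hi => hB i (mem_filter.1 hi).1
  · calc _ ≤ ({i ∈ s | ¬ τ ≤ c i}.card : ℝ) * τ := by
          rw [← nsmul_eq_mul]
          exact sum_le_card_nsmul _ _ _ fun i hi => (not_le.1 (mem_filter.1 hi).2).le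
      _ ≤ _ := by
          refine mul_le_mul_of_nonneg_right ?_ hτ
          exact_mod_cast card_filter_le _ _

/-- The set of `|k| ≤ m` at which a function bounded by `m` with large mean is large. -/
theorem popular_card_ge {m : ℕ} {η : ℝ} (hη : 0 < η) (hm : 1 ≤ m) (c : ℤ → ℝ)
    (hc : ∀ k, c k ≤ m) (hsum : η * m * m ≤ ∑ k ∈ Icc (-m : ℤ) m, c k) :
    η / 2 * m ≤ ({k ∈ Icc (-m : ℤ) m | η / 8 * m ≤ c k}.card : ℝ) := by
  have h := sum_le_card_filter_mul (Icc (-m : ℤ) m) c (B := m) (τ := η / 8 * m)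
    (fun k _ => hc k) (by positivity)
  rw [card_Icc_neg] at h
  have hm' : (1 : ℝ) ≤ m := by exact_mod_cast hm
  set N := ({k ∈ Icc (-m : ℤ) m | η / 8 * m ≤ c k}.card : ℝ)
  push_cast at h
  have h1 : η * m * m ≤ N * m + (2 * m + 1) * (η / 8 * m) := hsum.trans h
  have h2 : (2 * m + 1) * (η / 8 * m) ≤ η / 2 * m * m := by nlinarith [mul_pos hη (by linarith : (0:ℝ) < m)]
  have h3 : η / 2 * m * m ≤ N * m := by linarith
  exact le_of_mul_le_mul_right h3 (by linarith)

/-- A large quadratic Weyl sum forces its leading coefficient onto a major arc. -/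
theorem weyl_leading_coefficient {m : ℕ} {η α β : ℝ} (hη : 0 < η) (hη1 : η ≤ 1 / 1024)
    (hm : 1 ≤ η ^ 30 * m) {a b : ℤ} (ha : 1 ≤ a) (hb : b ≤ m)
    (hsum : η * m ≤ ‖∑ j ∈ Icc a b, e (α * j ^ 2 + β * j)‖) :
    ∃ d : ℕ, 0 < d ∧ d * η ^ 7 ≤ 1 ∧ distInt (d * α) * (η ^ 12 * m ^ 2) ≤ 1 := by
  have hm0 : (0 : ℝ) < m := by
    by_contra hcon
    have : (m : ℝ) = 0 := le_antisymm (not_lt.1 hcon) (Nat.cast_nonneg _)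
    rw [this] at hm; norm_num at hm
  have hmN : 1 ≤ m := by exact_mod_cast hm0
  have hpow : ∀ k : ℕ, η ^ (k + 1) ≤ η ^ k / 1024 := fun k => by
    rw [pow_succ]; nlinarith [pow_pos hη k]
  have hle1 : η ≤ 1 := by linarith
  set g : ℤ → ℂ := fun j => ind (Icc a b) j * e (α * j ^ 2 + β * j) with hg
  have hgsum : ∑ j ∈ Icc 1 (m : ℤ), g j = ∑ j ∈ Icc a b, e (α * j ^ 2 + β * j) := by
    simp only [hg, ind, ite_mul, one_mul, zero_mul]
    rw [← sum_filter]
    refine sum_congr ?_ fun _ _ => rfl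
    ext x; simp only [mem_filter, mem_Icc]; omega
  -- Differencing leaves a phase linear in j with slope a multiple of 2hα, on the overlap of the
  -- interval with its translate; the rest of the phase depends on h alone and has modulus one.
  set c : ℤ → ℝ := fun h => ‖∑ j ∈ Icc (max a (a - h)) (min b (b - h)), e (j * (2 * (h * α)))‖
  have hc : ∀ h, c h ≤ m := by
    intro h
    refine (norm_sum_le _ _).trans ?_
    simp only [norm_e, sum_const, nsmul_eq_mul, mul_one, Int.card_Icc]
    have : (min b (b - h) + 1 - max a (a - h)).toNat ≤ m := by omega
    exact_mod_cast this
  have hsq : η ^ 2 * m * m ≤ ∑ h ∈ Icc (-m : ℤ) m, c h := by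
    have h1 := ofReal_norm_sum_sq (Icc 1 (m : ℤ)) g
    rw [sum_sum_eq_sum_diff m (fun y y' => g y * conj (g y')), hgsum] at h1
    have h2 : ‖∑ j ∈ Icc a b, e (α * j ^ 2 + β * j)‖ ^ 2 ≤ ∑ h ∈ Icc (-m : ℤ) m, c h := by
      have h3 : ‖∑ j ∈ Icc a b, e (α * j ^ 2 + β * j)‖ ^ 2 =
          ‖((‖∑ j ∈ Icc a b, e (α * j ^ 2 + β * j)‖ ^ 2 : ℝ) : ℂ)‖ := by
        rw [Complex.norm_real, Real.norm_of_nonneg (sq_nonneg _)]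
      rw [h3, h1]
      refine (norm_sum_le _ _).trans (sum_le_sum fun h _ => le_of_eq ?_)
      have h4 : ∑ y ∈ Icc 1 (m : ℤ), ind (Icc 1 (m : ℤ)) (y + h) * (g y * conj (g (y + h))) =
          conj (∑ j ∈ Icc (max a (a - h)) (min b (b - h)), e (j * (2 * (h * α)))) *
            e (-(α * h ^ 2 + β * h)) := by
        rw [map_sum, sum_mul]
        have : Icc (max a (a - h)) (min b (b - h)) =
            (Icc 1 (m : ℤ)).filter (fun j => j + h ∈ Icc 1 (m : ℤ) ∧ j ∈ Icc a b ∧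
              j + h ∈ Icc a b) := by
          ext x; simp only [mem_filter, mem_Icc]; omega
        rw [this, sum_filter]
        refine sum_congr rfl fun j _ => ?_
        simp only [hg, ind]
        by_cases c1 : j + h ∈ Icc 1 (m : ℤ) <;> by_cases c2 : j ∈ Icc a b <;>
          by_cases c3 : j + h ∈ Icc a b <;> simp only [c1, c2, c3, if_true, if_false, one_mul,
            zero_mul, mul_zero, and_true, and_false, map_zero]
        rw [conj_e, conj_e, ← e_add, ← e_add]
        congr 1
        push_cast
        ring
      rw [h4, norm_mul, norm_e, mul_one, RCLike.norm_conj]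
    refine le_trans ?_ h2
    calc η ^ 2 * m * m = (η * m) ^ 2 := by ring
      _ ≤ _ := pow_le_pow_left₀ (by positivity) hsum 2
  have hpop := popular_card_ge (by positivity) hmN c hc hsq
  have p30 : η ^ 30 ≤ η ^ 6 / 1024 := by
    calc η ^ 30 ≤ η ^ 7 := pow_le_pow_of_le_one hη.le hle1 (by norm_num)
      _ ≤ _ := hpow 6
  have hm6 : 1024 ≤ η ^ 6 * m := by nlinarith
  have h3 := hpow 2
  have h63 : η ^ 6 ≤ η ^ 3 := pow_le_pow_of_le_one hη.le hle1 (by norm_num)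
  -- For the popular h the geometric series is long, so h · 2α is close to an integer. This applies
  -- to 2α, which is why the final denominator is `d * 2`.
  obtain ⟨d, hd0, hd, hdd⟩ := exists_denominator_of_many (m := m) (η := η ^ 3)
    (ε := 1 / (η ^ 3 * m)) (β := 2 * α) (by positivity)
    ((hpow 2).trans (by nlinarith [pow_le_one₀ (n := 2) hη.le hle1])) (by nlinarith)
    {k ∈ Icc (-m : ℤ) m | η ^ 2 / 8 * m ≤ c k} (filter_subset _ _) (by nlinarith)
    (by rw [mul_one_div, div_le_iff₀ (by positivity)]
        calc (128 : ℝ) ≤ η ^ 6 * m := by linarith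
          _ = _ := by ring) (by
      intro h hh
      obtain ⟨-, hh⟩ := mem_filter.1 hh
      have hgeo := norm_sum_e_mul_distInt_le (2 * (h * α)) (max a (a - h)) (min b (b - h))
      rw [le_div_iff₀ (by positivity)]
      have e1 : (h : ℝ) * (2 * α) = 2 * (h * α) := by ring
      rw [e1]
      have : η ^ 3 * m ≤ c h := by
        refine le_trans ?_ hh
        nlinarith
      nlinarith [distInt_nonneg (2 * (h * α))])
  refine ⟨d * 2, by omega, ?_, ?_⟩
  · push_cast
    have := hpow 6
    have hd' : (0 : ℝ) < d := by exact_mod_cast hd0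
    have : d * (η ^ 3) ^ 2 = d * η ^ 6 := by ring
    nlinarith
  · rw [le_div_iff₀ (by positivity)] at hdd
    have e1 : ((d * 2 : ℕ) : ℝ) * α = d * (2 * α) := by push_cast; ring
    rw [e1]
    calc _ = distInt (d * (2 * α)) * ((η ^ 3) ^ 3 * m) * (η ^ 3 * m) := by ring
      _ ≤ 1 := hdd

/-- A large quadratic Weyl sum forces its linear coefficient onto a major arc. -/
theorem weyl_linear_coefficient {m : ℕ} {η α β : ℝ} (hη : 0 < η) (hη1 : η ≤ 1 / 1024)
    (hm : 1 ≤ η ^ 30 * m) {a b : ℤ} (ha : 1 ≤ a) (hb : b ≤ m)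
    (hsum : η * m ≤ ‖∑ j ∈ Icc a b, e (α * j ^ 2 + β * j)‖) :
    ∃ d : ℕ, 0 < d ∧ d * η ^ 7 ≤ 1 ∧ distInt (d * β) * (η ^ 17 * m) ≤ 1 := by
  have hm0 : (0 : ℝ) < m := by
    by_contra hcon
    have : (m : ℝ) = 0 := le_antisymm (not_lt.1 hcon) (Nat.cast_nonneg _)
    rw [this] at hm; norm_num at hm
  have hmN : 1 ≤ m := by exact_mod_cast hm0
  have hpow : ∀ k : ℕ, η ^ (k + 1) ≤ η ^ k / 1024 := fun k => by
    rw [pow_succ]; nlinarith [pow_pos hη k]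
  have hle1 : η ≤ 1 := by linarith
  obtain ⟨d, hd0, hd7, hdα⟩ := weyl_leading_coefficient hη hη1 hm ha hb hsum
  refine ⟨d, hd0, hd7, ?_⟩
  have hdr : (0 : ℝ) < d := by exact_mod_cast hd0
  set θ := d * α - round (d * α) with hθ
  have hθm : |θ| * (η ^ 12 * m ^ 2) ≤ 1 := hdα
  -- Averaging over shifts by d·i with i ≤ L: dα is nearly an integer, so along such a progression
  -- the quadratic part barely moves and only the linear phase i · dβ remains. The exponent 15 keeps
  -- the phase error of order η ^ 3 and the boundary cost dL at most η ^ 8 m.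
  set L := ⌊η ^ 15 * m⌋₊ with hL
  have hL1 : (L : ℝ) ≤ η ^ 15 * m := Nat.floor_le (by positivity)
  have hL2 : η ^ 15 * m < L + 1 := Nat.lt_floor_add_one _
  have h1524 : η ^ 30 ≤ η ^ 16 := pow_le_pow_of_le_one hη.le hle1 (by norm_num)
  have h16 := hpow 15
  have hLbig : 2 ≤ η ^ 15 * m := by nlinarith
  have hL3 : η ^ 15 * m / 2 ≤ L := by linarith
  have hL0 : (0 : ℝ) < L := by linarith
  set F : ℤ → ℂ := fun j => e (α * j ^ 2 + β * j) with hF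
  have hshift : ‖(∑ i ∈ Icc 1 (L : ℤ), ∑ j ∈ Icc a b, F (j + d * i)) -
      L * ∑ j ∈ Icc a b, F j‖ ≤ L * (2 * (d * L)) := by
    have e1 : (L : ℂ) * ∑ j ∈ Icc a b, F j = ∑ i ∈ Icc 1 (L : ℤ), ∑ j ∈ Icc a b, F j := by
      simp
    rw [e1, ← sum_sub_distrib]
    refine (norm_sum_le _ _).trans ?_
    have : ∀ i ∈ Icc 1 (L : ℤ), ‖∑ j ∈ Icc a b, F (j + d * i) - ∑ j ∈ Icc a b, F j‖ ≤
        2 * (d * L) := by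
      intro i hi
      obtain ⟨hi1, hi2⟩ := mem_Icc.1 hi
      obtain ⟨n, rfl⟩ := Int.eq_ofNat_of_zero_le (show 0 ≤ i by omega)
      have := norm_sum_Icc_shift_sub_le F (fun j => (norm_e _).le) a b (d * n)
      push_cast at this
      refine this.trans ?_
      have hn : (n : ℝ) ≤ L := by exact_mod_cast hi2
      nlinarith
    refine (sum_le_card_nsmul _ _ _ this).trans ?_
    simp
  have hinner : ∀ j ∈ Icc a b, ‖∑ i ∈ Icc 1 (L : ℤ), F (j + d * i)‖ ≤
      ‖∑ i ∈ Icc 1 (L : ℤ), e (i * (d * β))‖ + L * (21 * η ^ 3) := by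
    intro j hj
    have e1 : ∀ i : ℤ, F (j + d * i) =
        F j * (e (i * (d * β)) + e (i * (d * β)) * (e (2 * j * i * θ + d * i ^ 2 * θ) - 1)) := by
      intro i
      have : e (2 * j * i * θ + d * i ^ 2 * θ) = e (2 * j * i * (d * α) + d * i ^ 2 * (d * α)) := by
        have e2 : (2 * j * i * (d * α) + d * i ^ 2 * (d * α) : ℝ) =
            (2 * j * i * θ + d * i ^ 2 * θ) +
              (((2 * j * i + d * i ^ 2) * round (d * α) : ℤ) : ℝ) := by
          rw [hθ]; push_cast; ring
        rw [e2, e_add _ (Int.cast _), e_int, mul_one]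
      rw [this]
      have e3 : F j * (e (i * (d * β)) + e (i * (d * β)) *
          (e (2 * j * i * (d * α) + d * i ^ 2 * (d * α)) - 1)) =
          F j * (e (i * (d * β)) * e (2 * j * i * (d * α) + d * i ^ 2 * (d * α))) := by ring
      rw [e3, hF]
      simp only
      rw [← e_add, ← e_add]
      congr 1
      push_cast
      ring
    simp_rw [e1]
    rw [← mul_sum, norm_mul, hF]
    simp only [norm_e, one_mul]
    rw [sum_add_distrib]
    refine (norm_add_le _ _).trans (add_le_add le_rfl ?_)
    refine (norm_sum_le _ _).trans ?_
    have hb2 : ∀ i ∈ Icc 1 (L : ℤ), ‖e (i * (d * β)) *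
        (e (2 * j * i * θ + d * i ^ 2 * θ) - 1)‖ ≤ 21 * η ^ 3 := by
      intro i hi
      rw [norm_mul, norm_e, one_mul]
      refine (norm_e_sub_one_le _).trans ?_
      obtain ⟨hi1, hi2⟩ := mem_Icc.1 hi
      obtain ⟨hj1, hj2⟩ := mem_Icc.1 hj
      have ir : (i : ℝ) ≤ L := by exact_mod_cast hi2
      have ir0 : (0 : ℝ) ≤ i := by exact_mod_cast (by omega : (0 : ℤ) ≤ i)
      have jr : (j : ℝ) ≤ m := by exact_mod_cast hj2.trans hb
      have jr0 : (0 : ℝ) ≤ j := by exact_mod_cast (by omega : (0 : ℤ) ≤ j)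
      have iL : (i : ℝ) ≤ η ^ 15 * m := ir.trans hL1
      have t1 : |2 * j * i * θ + d * i ^ 2 * θ| = (2 * j * i + d * i ^ 2) * |θ| := by
        rw [← add_mul, abs_mul, abs_of_nonneg (by positivity : (0:ℝ) ≤ 2 * j * i + d * i ^ 2)]
      have t2 : (2 * j * i + d * i ^ 2 : ℝ) ≤ 3 * (η ^ 3 * (η ^ 12 * m ^ 2)) := by
        have u1 : (2 * j * i : ℝ) ≤ 2 * m * (η ^ 15 * m) := by gcongr
        have u2 : (d * i ^ 2 : ℝ) ≤ d * (η ^ 15 * m) ^ 2 := by gcongr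
        have u3 : (d * (η ^ 15 * m) ^ 2 : ℝ) = (d * η ^ 7) * (η ^ 23 * m ^ 2) := by ring
        have u4 : (d * η ^ 7) * (η ^ 23 * m ^ 2) ≤ 1 * (η ^ 15 * m ^ 2) := by
          gcongr ?_ * (?_ * _)
          exact pow_le_pow_of_le_one hη.le hle1 (by norm_num)
        nlinarith
      rw [t1]
      calc 7 * ((2 * j * i + d * i ^ 2) * |θ|) ≤ 7 * (3 * (η ^ 3 * (η ^ 12 * m ^ 2)) * |θ|) := by
            gcongr
        _ = 21 * η ^ 3 * (|θ| * (η ^ 12 * m ^ 2)) := by ring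
        _ ≤ 21 * η ^ 3 * 1 := by gcongr
        _ = _ := mul_one _
    refine (sum_le_card_nsmul _ _ _ hb2).trans ?_
    simp
  set E := ‖∑ i ∈ Icc 1 (L : ℤ), e (i * (d * β))‖ with hE
  have hE0 : 0 ≤ E := norm_nonneg _
  have htotal : L * (η * m) ≤ m * (E + L * (21 * η ^ 3)) + L * (2 * (d * L)) := by
    have h1 : ‖∑ i ∈ Icc 1 (L : ℤ), ∑ j ∈ Icc a b, F (j + d * i)‖ ≤ m * (E + L * (21 * η ^ 3)) := by
      rw [sum_comm]
      refine (norm_sum_le _ _).trans ((sum_le_card_nsmul _ _ _ hinner).trans ?_)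
      rw [nsmul_eq_mul, Int.card_Icc]
      have : (b + 1 - a).toNat ≤ m := by omega
      have : (((b + 1 - a).toNat : ℕ) : ℝ) ≤ m := by exact_mod_cast this
      gcongr
    have h2 : (L : ℝ) * (η * m) ≤ ‖(L : ℂ) * ∑ j ∈ Icc a b, F j‖ := by
      rw [norm_mul, Complex.norm_natCast]
      gcongr
    have h3 := norm_sub_norm_le ((L : ℂ) * ∑ j ∈ Icc a b, F j)
      (∑ i ∈ Icc 1 (L : ℤ), ∑ j ∈ Icc a b, F (j + d * i))
    rw [norm_sub_rev] at h3
    linarith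
  have hdL : (d * L : ℝ) ≤ η ^ 8 * m := by
    calc (d * L : ℝ) ≤ d * (η ^ 15 * m) := by gcongr
      _ = (d * η ^ 7) * (η ^ 8 * m) := by ring
      _ ≤ 1 * (η ^ 8 * m) := by gcongr
      _ = _ := one_mul _
  -- Both error terms are at most a small fraction of Lη, so the geometric sum in dβ carries at
  -- least half of it.
  have hElow : L * η / 2 ≤ E := by
    have p1 : η ^ 8 ≤ η ^ 2 := pow_le_pow_of_le_one hη.le hle1 (by norm_num)
    have p2 : η ^ 3 ≤ η ^ 2 := pow_le_pow_of_le_one hη.le hle1 (by norm_num)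
    have p3 : η ^ 2 ≤ η / 1024 := by simpa using hpow 1
    have h1 : L * (2 * (d * L)) ≤ L * (2 * (η / 1024 * m)) := by
      refine mul_le_mul_of_nonneg_left (mul_le_mul_of_nonneg_left (hdL.trans ?_) zero_le_two) hL0.le
      gcongr
      linarith
    have h2 : L * (21 * η ^ 3) ≤ L * (21 * (η / 1024)) := by
      gcongr
      linarith
    have h3 : L * η / 2 * m ≤ E * m := by
      have : L * η * m > 0 := by positivity
      nlinarith
    exact le_of_mul_le_mul_right h3 hm0
  have hgeo : E * distInt (d * β) ≤ 1 := norm_sum_e_mul_distInt_le (d * β) 1 L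
  have h17 : η ^ 17 * m ≤ E := by
    refine le_trans ?_ hElow
    have h1 : η ^ 17 * m ≤ η ^ 16 / 1024 * m := mul_le_mul_of_nonneg_right (hpow 16) hm0.le
    have h2 : η * (η ^ 15 * m / 2) ≤ η * L := mul_le_mul_of_nonneg_left hL3 hη.le
    have h3 : η * (η ^ 15 * m / 2) = η ^ 16 * m / 2 := by ring
    have h4 : 0 < η ^ 16 * m := by positivity
    linarith
  calc distInt (d * β) * (η ^ 17 * m) ≤ distInt (d * β) * E :=
        mul_le_mul_of_nonneg_left h17 (distInt_nonneg _)
    _ ≤ 1 := by rwa [mul_comm]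

/-! ### Bilinear sums against quadratic phases. -/

theorem sum_shift {R : Type*} [AddGroup R] [Fintype R] {E : Type*} [AddCommMonoid E] (c : R)
    (f : R → E) : ∑ x, f (x + c) = ∑ x, f x :=
  Fintype.sum_equiv (Equiv.addRight c) _ _ fun _ => rfl

/-- `θ` lies on a major arc: it is within `Q / m ^ 2`, after multiplication by some `d ≤ Q`, of an
integer. -/
def Maj (Q : ℝ) (m : ℕ) (θ : ℝ) : Prop :=
  ∃ d : ℕ, 0 < d ∧ (d : ℝ) ≤ Q ∧ distInt (d * θ) ≤ Q / m ^ 2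

/-- Cauchy–Schwarz after substituting w = x + j discards f₁. Recentring at the remaining copy of f₀
gives a quadratic polynomial in j with leading coefficient θ(x + k) - θ(x), about which nothing is
known, and linear coefficient -2kθ(x). The second is the useful one: it involves θ at a single point
x, and x can be chosen in the support of f₀. -/
theorem exists_many_large_weyl_sums {R : Type*} [CommRing R] [Fintype R] {m : ℕ} {η : ℝ}
    (hη : 0 < η) (hm : 1 ≤ m) (f₀ f₁ : R → ℂ) (h₀ : ∀ x, ‖f₀ x‖ ≤ 1) (h₁ : ∀ x, ‖f₁ x‖ ≤ 1)
    (θ : R → ℝ) (hsum : η * Fintype.card R * m <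
      ‖∑ x, ∑ j ∈ Icc 1 (m : ℤ), f₀ x * f₁ (x + (j : R)) * e (θ x * j ^ 2)‖) :
    ∃ x, f₀ x ≠ 0 ∧ η ^ 2 / 2 * m ≤ ({k ∈ Icc (-m : ℤ) m | η ^ 2 / 8 * m ≤
      ‖∑ j ∈ Icc (max 1 (1 - k)) (min (m : ℤ) (m - k)),
        e ((θ (x + (k : R)) - θ x) * j ^ 2 + (-(2 * (k * θ x))) * j)‖}.card : ℝ) := by
  classical
  set J := Icc 1 (m : ℤ)
  set c : R → ℤ → ℝ := fun x k => ‖∑ j ∈ Icc (max 1 (1 - k)) (min (m : ℤ) (m - k)),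
        e ((θ (x + (k : R)) - θ x) * j ^ 2 + (-(2 * (k * θ x))) * j)‖ with hc
  have hmr : (0 : ℝ) < m := by exact_mod_cast hm
  have hR : (0 : ℝ) < Fintype.card R := by exact_mod_cast Fintype.card_pos
  have h1 : ∑ x, ∑ j ∈ J, f₀ x * f₁ (x + (j : R)) * e (θ x * j ^ 2) =
      ∑ w, f₁ w * ∑ j ∈ J, f₀ (w - j) * e (θ (w - j) * j ^ 2) := by
    simp_rw [mul_sum]
    rw [sum_comm, sum_comm (s := univ)]
    refine sum_congr rfl fun j _ => ?_
    refine Eq.trans ?_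
      (sum_shift (j : R) (fun w => f₁ w * (f₀ (w - j) * e (θ (w - j) * j ^ 2))))
    refine sum_congr rfl fun x _ => ?_
    rw [add_sub_cancel_right]
    ring
  have h2 := norm_sum_sq_le_doubled univ J f₁
    (fun w j => f₀ (w - j) * e (θ (w - j) * j ^ 2)) (fun w _ => h₁ w)
  rw [← h1, sum_sum_eq_sum_diff m (fun y y' => ∑ s, f₀ (s - (y : R)) * e (θ (s - y) * y ^ 2) *
    conj (f₀ (s - (y' : R)) * e (θ (s - y') * y' ^ 2)))] at h2
  have h3 : ∀ k : ℤ, ∑ y ∈ J, ind J (y + k) * ∑ s, f₀ (s - (y : R)) * e (θ (s - y) * y ^ 2) *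
      conj (f₀ (s - ((y + k : ℤ) : R)) * e (θ (s - ((y + k : ℤ) : R)) * ((y + k : ℤ) : ℝ) ^ 2)) =
      ∑ x : R, f₀ (x + k) * conj (f₀ x) * (e (-(θ x * k ^ 2)) *
        ∑ j ∈ Icc (max 1 (1 - k)) (min (m : ℤ) (m - k)),
          e ((θ (x + (k : R)) - θ x) * j ^ 2 + (-(2 * (k * θ x))) * j)) := by
    intro k
    have : Icc (max 1 (1 - k)) (min (m : ℤ) (m - k)) = J.filter (fun j => j + k ∈ J) := by
      ext x; simp only [J, mem_filter, mem_Icc]; omega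
    simp_rw [this, mul_sum]
    rw [sum_comm (s := univ)]
    simp_rw [sum_filter]
    refine sum_congr rfl fun j _ => ?_
    unfold ind
    split_ifs
    · rw [← sum_shift ((j + k : ℤ) : R)]
      refine sum_congr rfl fun x _ => ?_
      have e1 : x + ((j + k : ℤ) : R) - j = x + k := by push_cast; ring
      rw [e1, add_sub_cancel_right, map_mul, conj_e, one_mul]
      have e2 : e (θ (x + (k : R)) * j ^ 2) * e (-(θ x * ((j + k : ℤ) : ℝ) ^ 2)) =
          e (-(θ x * k ^ 2)) *
            e ((θ (x + (k : R)) - θ x) * j ^ 2 + (-(2 * (k * θ x))) * j) := by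
        rw [← e_add, ← e_add]; push_cast; congr 1; ring
      rw [← e2]; ring
    · simp
  rw [sum_congr rfl fun k _ => h3 k] at h2
  set c' : R → ℤ → ℝ := fun x k => if f₀ x ≠ 0 then c x k else 0 with hc'
  have h4 : ‖∑ k ∈ Icc (-m : ℤ) m, ∑ x : R, f₀ (x + k) * conj (f₀ x) * (e (-(θ x * k ^ 2)) *
        ∑ j ∈ Icc (max 1 (1 - k)) (min (m : ℤ) (m - k)),
          e ((θ (x + (k : R)) - θ x) * j ^ 2 + (-(2 * (k * θ x))) * j))‖ ≤
      ∑ x : R, ∑ k ∈ Icc (-m : ℤ) m, c' x k := by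
    rw [sum_comm (s := univ)]
    refine (norm_sum_le _ _).trans (sum_le_sum fun k _ => (norm_sum_le _ _).trans
      (sum_le_sum fun x _ => ?_))
    simp only [hc', hc]
    split_ifs with h
    · rw [norm_mul, norm_mul, norm_mul, norm_e, one_mul, RCLike.norm_conj]
      exact mul_le_of_le_one_left (norm_nonneg _)
        (mul_le_one₀ (h₀ _) (norm_nonneg _) (h₀ _))
    · rw [not_not] at h; simp [h]
  have h5 : Fintype.card R * (η ^ 2 * m * m) ≤ ∑ x : R, ∑ k ∈ Icc (-m : ℤ) m, c' x k := by
    refine le_trans ?_ h4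
    refine le_of_mul_le_mul_left (le_trans ?_ h2) hR
    rw [card_univ]
    calc _ = (η * Fintype.card R * m) ^ 2 := by ring
      _ ≤ _ := pow_le_pow_left₀ (by positivity) hsum.le 2
  obtain ⟨x, -, hx⟩ : ∃ x ∈ (univ : Finset R), η ^ 2 * m * m ≤ ∑ k ∈ Icc (-m : ℤ) m, c' x k := by
    refine exists_le_of_sum_le ⟨0, mem_univ _⟩ ?_
    rwa [sum_const, nsmul_eq_mul, card_univ]
  have hx0 : f₀ x ≠ 0 := by
    intro h
    simp only [hc', h, ne_eq, not_true_eq_false, if_false, sum_const_zero] at hx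
    have : 0 < η ^ 2 * m * m := by positivity
    linarith
  refine ⟨x, hx0, popular_card_ge (by positivity) hm (c x) ?_ ?_⟩
  · intro k
    refine (norm_sum_le _ _).trans ?_
    simp only [norm_e, sum_const, nsmul_eq_mul, mul_one, Int.card_Icc]
    have : (min (m : ℤ) (m - k) + 1 - max 1 (1 - k)).toNat ≤ m := by omega
    exact_mod_cast this
  · simpa [hc', hx0] using hx

/-- A bilinear sum against quadratic phases is small if the phases avoid the major arcs. -/
theorem norm_sum_quadratic_phase_le {R : Type*} [CommRing R] [Fintype R] {m : ℕ} {η : ℝ}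
    (hη : 0 < η) (hη1 : η ≤ 1 / 1024) (hm : 1 ≤ η ^ 100 * m) (f₀ f₁ : R → ℂ)
    (h₀ : ∀ x, ‖f₀ x‖ ≤ 1) (h₁ : ∀ x, ‖f₁ x‖ ≤ 1) (θ : R → ℝ)
    (hθ : ∀ x, f₀ x ≠ 0 → ¬ Maj (η ^ 123)⁻¹ m (θ x)) :
    ‖∑ x, ∑ j ∈ Icc 1 (m : ℤ), f₀ x * f₁ (x + (j : R)) * e (θ x * j ^ 2)‖ ≤
      η * Fintype.card R * m := by
  classical
  by_contra hcon
  rw [not_le] at hcon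
  have hm0 : (0 : ℝ) < m := by
    by_contra hcon
    have : (m : ℝ) = 0 := le_antisymm (not_lt.1 hcon) (Nat.cast_nonneg _)
    rw [this] at hm; norm_num at hm
  have hmN : 1 ≤ m := by exact_mod_cast hm0
  have hle1 : η ≤ 1 := by linarith
  have hpow : ∀ k : ℕ, η ^ (k + 1) ≤ η ^ k / 1024 := fun k => by
    rw [pow_succ]; nlinarith [pow_pos hη k]
  have hmk : ∀ k, k ≤ 99 → 1024 ≤ η ^ k * m := fun k hk => by
    have h1 : η ^ 100 ≤ η ^ (k + 1) := pow_le_pow_of_le_one hη.le hle1 (by omega)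
    nlinarith [hpow k]
  obtain ⟨x, hx0, hcard⟩ := exists_many_large_weyl_sums hη hmN f₀ f₁ h₀ h₁ θ hcon
  set H := {k ∈ Icc (-m : ℤ) m | η ^ 2 / 8 * m ≤
      ‖∑ j ∈ Icc (max 1 (1 - k)) (min (m : ℤ) (m - k)),
        e ((θ (x + (k : R)) - θ x) * j ^ 2 + (-(2 * (k * θ x))) * j)‖} with hH
  -- The linear Weyl estimate puts kθ(x) on a major arc, with a denominator depending on k.
  have hweyl : ∀ k ∈ H, ∃ d : ℕ, 0 < d ∧ d * η ^ 21 ≤ 1 ∧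
      distInt (k * (2 * d * θ x)) ≤ 1 / (η ^ 51 * m) := by
    intro k hk
    obtain ⟨-, hk⟩ := mem_filter.1 hk
    obtain ⟨d, hd0, hd1, hd2⟩ := weyl_linear_coefficient (m := m) (η := η ^ 3)
      (α := θ (x + (k : R)) - θ x) (β := -(2 * (k * θ x))) (by positivity)
      ((hpow 2).trans (by nlinarith [pow_le_one₀ (n := 2) hη.le hle1]))
      (by rw [← pow_mul]; linarith [hmk (3 * 30) (by norm_num)]) (le_max_left _ _) (min_le_left _ _)
      (le_trans (by nlinarith [hpow 2, pow_pos hη 2]) hk)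
    refine ⟨d, hd0, by rwa [← pow_mul] at hd1, ?_⟩
    rw [le_div_iff₀ (by positivity)]
    have e1 : (d : ℝ) * -(2 * (k * θ x)) = -(k * (2 * d * θ x)) := by ring
    rw [e1, distInt_neg, ← pow_mul] at hd2
    exact hd2
  choose! D hD0 hD1 hD2 using hweyl
  have h21 : (0 : ℝ) < η ^ 21 := by positivity
  have hT : (1 : ℝ) ≤ 1 / η ^ 21 := by
    rw [le_div_iff₀ h21, one_mul]; exact pow_le_one₀ hη.le hle1
  -- Pigeonholing makes the denominator common to many k; `exists_denominator_of_many` can then be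
  -- applied to 2dθ(x).
  obtain ⟨d, hdT, hd⟩ := exists_le_card_fiber_of_nsmul_le_card_of_maps_to
    (s := H) (t := Icc 1 ⌊1 / η ^ 21⌋₊) (f := D) (b := η ^ 24 * m)
    (fun k hk => mem_Icc.2 ⟨hD0 k hk, Nat.le_floor (by rw [le_div_iff₀ h21]; exact hD1 k hk)⟩)
    ⟨1, mem_Icc.2 ⟨le_rfl, Nat.le_floor (by simpa using hT)⟩⟩ (by
      rw [nsmul_eq_mul, Nat.card_Icc, Nat.add_sub_cancel]
      calc _ ≤ 1 / η ^ 21 * (η ^ 24 * m) := by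
            gcongr; exact Nat.floor_le (by positivity)
        _ = η ^ 3 * m := by field_simp
        _ ≤ η ^ 2 / 2 * m := by
            gcongr; nlinarith [hpow 2, pow_pos hη 2]
        _ ≤ _ := hcard)
  obtain ⟨hd1, hdT⟩ := mem_Icc.1 hdT
  have hdr : (d : ℝ) * η ^ 21 ≤ 1 := by
    rw [← le_div_iff₀ h21]
    exact (Nat.cast_le.2 hdT).trans (Nat.floor_le (by positivity))
  have h24 : η ^ 24 ≤ 1 / 128 := (hpow 23).trans (by
    nlinarith [pow_le_one₀ (n := 23) hη.le hle1])
  obtain ⟨d', hd'0, hd'1, hd'2⟩ := exists_denominator_of_many (m := m) (η := η ^ 24)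
    (ε := 1 / (η ^ 51 * m)) (β := 2 * d * θ x) (by positivity) h24
    (by linarith [hmk 24 (by norm_num)]) {k ∈ H | D k = d}
    ((filter_subset _ _).trans (filter_subset _ _)) hd
    (by rw [mul_one_div, div_le_iff₀ (by positivity)]
        calc (128 : ℝ) ≤ η ^ 75 * m := by linarith [hmk 75 (by norm_num)]
          _ = _ := by ring)
    (by
      intro k hk
      obtain ⟨hk, hkd⟩ := mem_filter.1 hk
      have := hD2 k hk
      rwa [hkd] at this)
  -- The exponent 123 of the major arcs is 72 + 51, from the factors (η ^ 24) ^ 3 and η ^ 51.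
  refine hθ x hx0 ⟨2 * d * d', by positivity, ?_, ?_⟩
  · rw [← one_div, le_div_iff₀ (by positivity)]
    have hA : (d : ℝ) * η ^ 21 * (d' * (η ^ 24) ^ 2) ≤ 1 :=
      mul_le_one₀ hdr (by positivity) hd'1
    have hB : η ^ 123 ≤ η ^ 70 := pow_le_pow_of_le_one hη.le hle1 (by norm_num)
    have hC := hpow 69
    push_cast
    calc (2 * d * d' * η ^ 123 : ℝ) ≤ 2 * d * d' * (η ^ 69 / 1024) := by
          gcongr; exact hB.trans hC
      _ = (d : ℝ) * η ^ 21 * (d' * (η ^ 24) ^ 2) * (2 / 1024) := by ring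
      _ ≤ 1 * (2 / 1024) := by gcongr
      _ ≤ 1 := by norm_num
  · rw [le_div_iff₀ (by positivity)] at hd'2
    rw [← one_div, div_div, le_div_iff₀ (by positivity)]
    have e1 : ((2 * d * d' : ℕ) : ℝ) * θ x = d' * (2 * d * θ x) := by push_cast; ring
    rw [e1]
    calc _ = distInt (d' * (2 * d * θ x)) * ((η ^ 24) ^ 3 * m) * (η ^ 51 * m) := by ring
      _ ≤ 1 := hd'2

/-! ### Multiplicities of bilinear differences -/

/-- Reduction of residues modulo `q * P` to residues modulo `q`. -/
def fib (q P : ℕ) : ZMod (q * P) →+* ZMod q := ZMod.castHom (dvd_mul_right q P) _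

/-- Reduction of residues modulo `q * P` to residues modulo `P`. -/
def cofib (q P : ℕ) : ZMod (q * P) →+* ZMod P := ZMod.castHom (dvd_mul_left P q) _

theorem fib_q (q P : ℕ) : fib q P q = 0 := by
  rw [map_natCast, ZMod.natCast_self]

theorem exists_eq_mul_of_fib_eq_zero {q P : ℕ} [NeZero (q * P)] {x : ZMod (q * P)}
    (h : fib q P x = 0) : ∃ y : ZMod (q * P), x = q * y := by
  rw [← ZMod.natCast_zmod_val x, map_natCast, ZMod.natCast_eq_zero_iff] at h
  obtain ⟨k, hk⟩ := h
  exact ⟨k, by rw [← ZMod.natCast_zmod_val x, hk]; push_cast; rfl⟩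

theorem exists_eq_mul_of_cofib_eq_zero {q P : ℕ} [NeZero (q * P)] {x : ZMod (q * P)}
    (h : cofib q P x = 0) : ∃ y : ZMod (q * P), x = P * y := by
  rw [← ZMod.natCast_zmod_val x, map_natCast, ZMod.natCast_eq_zero_iff] at h
  obtain ⟨k, hk⟩ := h
  exact ⟨k, by rw [← ZMod.natCast_zmod_val x, hk]; push_cast; rfl⟩

/-- A multiple of P times a multiple of q vanishes. Hence on a fibre, up to a constant of modulus
one, a character depends only on its frequency modulo P. -/
theorem mul_eq_zero_of_cofib_of_fib {q P : ℕ} [NeZero (q * P)] {c l : ZMod (q * P)}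
    (hc : cofib q P c = 0) (hl : fib q P l = 0) : c * l = 0 := by
  obtain ⟨y, rfl⟩ := exists_eq_mul_of_cofib_eq_zero hc
  obtain ⟨z, rfl⟩ := exists_eq_mul_of_fib_eq_zero hl
  have : (P * y * (q * z) : ZMod (q * P)) = ((q * P : ℕ) : ZMod (q * P)) * (y * z) := by
    push_cast; ring
  rw [this, ZMod.natCast_self, zero_mul]

/-- The pair `a, a'` has small greatest common divisor and `a'` is not too small. -/
def GoodPair (ε : ℝ) (m : ℕ) (a a' : ℤ) : Prop := ε * m ≤ |(a' : ℝ)| ∧ ε * (Int.gcd a a') ≤ 1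

/-- Two solutions differ by a solution of a homogeneous congruence modulo P, whose sides have size
at most 16m² < P, so it holds in the integers. With g the gcd, the first coordinates then agree
modulo |a'|/g and determine the second ones; a good pair has |a'|/g ≥ ε²m. -/
theorem card_fiber_le {q P m : ℕ} (hq : 0 < q) (hP : 16 * m ^ 2 < P) {ε : ℝ} (hε : 0 < ε)
    (hε1 : ε ≤ 1) (hm : 1 ≤ m) {a a' : ℤ} (ha : |a| ≤ 2 * m) (ha' : |a'| ≤ 2 * m)
    (hgood : GoodPair ε m a a') (n : ZMod (q * P)) :
    (({x ∈ Icc (-m : ℤ) m ×ˢ Icc (-m : ℤ) m |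
      ((2 * q * (a * x.1 - a' * x.2) : ℤ) : ZMod (q * P)) = n}.card : ℕ) : ℝ) ≤ 3 / ε ^ 2 := by
  obtain ⟨h1, h2⟩ := hgood
  have hmr : (0 : ℝ) < m := by exact_mod_cast hm
  have ha0 : a' ≠ 0 := by
    rintro rfl
    simp at h1
    nlinarith
  set F := {x ∈ Icc (-m : ℤ) m ×ˢ Icc (-m : ℤ) m |
      ((2 * q * (a * x.1 - a' * x.2) : ℤ) : ZMod (q * P)) = n} with hF
  have key : ∀ x ∈ F, ∀ y ∈ F, a * (x.1 - y.1) = a' * (x.2 - y.2) := by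
    intro x hx y hy
    obtain ⟨hxK, hx⟩ := mem_filter.1 hx
    obtain ⟨hyK, hy⟩ := mem_filter.1 hy
    simp only [mem_product, mem_Icc] at hxK hyK
    have hd := (ZMod.intCast_eq_intCast_iff_dvd_sub _ _ _).1 (hy.trans hx.symm)
    have e1 : (2 * q * (a * x.1 - a' * x.2) - 2 * q * (a * y.1 - a' * y.2) : ℤ) =
        q * (2 * (a * (x.1 - y.1) - a' * (x.2 - y.2))) := by ring
    rw [e1] at hd
    push_cast at hd
    have hd2 := Int.dvd_of_mul_dvd_mul_left (by exact_mod_cast hq.ne') hd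
    have b1 : |a * (x.1 - y.1)| ≤ 2 * m * (2 * m) := by
      rw [abs_mul]
      exact mul_le_mul ha (abs_le.2 ⟨by omega, by omega⟩) (abs_nonneg _) (by positivity)
    have b2 : |a' * (x.2 - y.2)| ≤ 2 * m * (2 * m) := by
      rw [abs_mul]
      exact mul_le_mul ha' (abs_le.2 ⟨by omega, by omega⟩) (abs_nonneg _) (by positivity)
    have b3 : |2 * (a * (x.1 - y.1) - a' * (x.2 - y.2))| < P := by
      have hP' : (16 * m ^ 2 : ℤ) < P := by exact_mod_cast hP
      rw [abs_mul, abs_two]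
      have := abs_sub (a * (x.1 - y.1)) (a' * (x.2 - y.2))
      nlinarith
    have := Int.eq_zero_of_abs_lt_dvd hd2 b3
    omega
  set g := Int.gcd a a' with hg
  have hg0 : 0 < g := Int.gcd_pos_of_ne_zero_right _ ha0
  set d := a'.natAbs / g with hd
  have hgd : g ∣ a'.natAbs := Int.natCast_dvd_natCast.1 (by
    rw [Int.dvd_natAbs]; exact Int.gcd_dvd_right _ _)
  have hdg : d * g = a'.natAbs := Nat.div_mul_cancel hgd
  have hd0 : 0 < d := Nat.pos_of_ne_zero fun h => by
    rw [h] at hdg; omega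
  have hinj : Set.InjOn Prod.fst (F : Set (ℤ × ℤ)) := by
    intro x hx y hy hxy
    have := key x hx y hy
    rw [hxy, sub_self, mul_zero] at this
    rcases mul_eq_zero.1 this.symm with h | h
    · exact absurd h ha0
    · exact Prod.ext hxy (by omega)
  rw [← card_image_of_injOn hinj]
  have hdr : (0 : ℝ) < d := by exact_mod_cast hd0
  have hgr : (0 : ℝ) < g := by exact_mod_cast hg0
  have hcl := card_le_of_pairwise_close (H := F.image Prod.fst) (d := d) hd0 (X := 2 * m / d)
    (by positivity) (by
      intro s hs t ht
      obtain ⟨x, hx, rfl⟩ := mem_image.1 hs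
      obtain ⟨y, hy, rfl⟩ := mem_image.1 ht
      have hk := key x hx y hy
      rw [Int.emod_eq_emod_iff_emod_sub_eq_zero]
      apply Int.emod_eq_zero_of_dvd
      obtain ⟨a₁, ha₁⟩ : (g : ℤ) ∣ a := Int.gcd_dvd_left _ _
      obtain ⟨a₂, ha₂⟩ : (g : ℤ) ∣ a' := Int.gcd_dvd_right _ _
      have hgz : (g : ℤ) ≠ 0 := by exact_mod_cast hg0.ne'
      have hcop : IsCoprime a₁ a₂ := by
        rw [Int.isCoprime_iff_gcd_eq_one]
        have := Int.gcd_mul_left g a₁ a₂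
        rw [← ha₁, ← ha₂, ← hg, Int.natAbs_natCast] at this
        exact Nat.eq_of_mul_eq_mul_left hg0 (by rw [← this, mul_one])
      have hda : (d : ℤ) = a₂.natAbs := by
        have : d * g = a₂.natAbs * g := by
          rw [hdg, ha₂, Int.natAbs_mul, Int.natAbs_natCast, mul_comm]
        exact_mod_cast Nat.eq_of_mul_eq_mul_right hg0 this
      rw [hda, Int.natAbs_dvd]
      have hk2 : a₁ * (x.1 - y.1) = a₂ * (x.2 - y.2) := by
        apply mul_left_cancel₀ hgz
        rw [← mul_assoc, ← mul_assoc, ← ha₁, ← ha₂]; exact hk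
      exact hcop.symm.dvd_of_dvd_mul_left ⟨_, hk2⟩) (by
      intro s hs t ht
      obtain ⟨x, hx, rfl⟩ := mem_image.1 hs
      obtain ⟨y, hy, rfl⟩ := mem_image.1 ht
      have hx := (mem_filter.1 hx).1
      have hy := (mem_filter.1 hy).1
      simp only [mem_product, mem_Icc] at hx hy
      rw [mul_div_cancel₀ _ hdr.ne']
      have : x.1 - y.1 ≤ 2 * m := by omega
      exact_mod_cast this)
  refine hcl.trans ?_
  have hda : (d : ℝ) * g = |(a' : ℝ)| := by
    rw [← Int.cast_abs, Int.abs_eq_natAbs, Int.cast_natCast]; exact_mod_cast hdg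
  have e1 : ε ^ 2 * m ≤ d := by
    rw [← hda] at h1
    nlinarith
  have e2 : 2 * m / d ≤ 2 / ε ^ 2 := by
    rw [div_le_div_iff₀ hdr (by positivity)]
    nlinarith
  have e3 : 1 ≤ 1 / ε ^ 2 := by
    rw [le_div_iff₀ (by positivity), one_mul]; exact pow_le_one₀ hε.le hε1
  calc _ ≤ 2 / ε ^ 2 + 1 / ε ^ 2 := add_le_add e2 e3
    _ = _ := by ring

/-- The arguments of `T` lie in the kernel of `fib`, each attained boundedly often. This is how an
average over short bilinear differences becomes one over a whole fibre. -/
theorem sum_bilinear_le {q P m : ℕ} [NeZero (q * P)] (hq : 0 < q) (hP : 16 * m ^ 2 < P) {ε : ℝ}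
    (hε : 0 < ε) (hε1 : ε ≤ 1) (hm : 1 ≤ m) {a a' : ℤ} (ha : |a| ≤ 2 * m) (ha' : |a'| ≤ 2 * m)
    (hgood : GoodPair ε m a a') (T : ZMod (q * P) → ℝ) (hT : ∀ n, 0 ≤ T n) :
    ∑ s ∈ Icc (-m : ℤ) m, ∑ s' ∈ Icc (-m : ℤ) m, T ((2 * q * (a * s - a' * s') : ℤ) : ZMod (q * P))
      ≤ 3 / ε ^ 2 * ∑ n with fib q P n = 0, T n := by
  rw [← sum_product', ← sum_fiberwise_of_maps_to (s := Icc (-m : ℤ) m ×ˢ Icc (-m : ℤ) m)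
    (t := {n | fib q P n = 0})
    (g := fun x => ((2 * q * (a * x.1 - a' * x.2) : ℤ) : ZMod (q * P)))]
  · rw [mul_sum]
    refine sum_le_sum fun n _ => ?_
    rw [sum_congr rfl (g := fun _ => T n) fun x hx => by rw [(mem_filter.1 hx).2], sum_const,
      nsmul_eq_mul]
    exact mul_le_mul_of_nonneg_right (card_fiber_le hq hP hε hε1 hm ha ha' hgood n) (hT n)
  · intro x _
    simp only [mem_filter, mem_univ, true_and]
    push_cast
    rw [map_mul, map_mul, fib_q, mul_zero, zero_mul]

theorem card_multiples_le {m g : ℕ} (hg : 0 < g) :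
    (({a ∈ Icc (-(2 * m) : ℤ) (2 * m) | (g : ℤ) ∣ a}.card : ℕ) : ℝ) ≤ 4 * m / g + 1 := by
  have hgr : (0 : ℝ) < g := by exact_mod_cast hg
  refine card_le_of_pairwise_close hg (by positivity) ?_ ?_
  · intro a ha b hb
    rw [Int.emod_eq_zero_of_dvd (mem_filter.1 ha).2, Int.emod_eq_zero_of_dvd (mem_filter.1 hb).2]
  · intro a ha b hb
    have ha := mem_Icc.1 (mem_filter.1 ha).1
    have hb := mem_Icc.1 (mem_filter.1 hb).1
    rw [mul_div_cancel₀ _ hgr.ne']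
    have : a - b ≤ 4 * m := by omega
    exact_mod_cast this

theorem card_small_le {m : ℕ} {ε : ℝ} (hm : 1 ≤ ε * m) :
    (({a ∈ Icc (-(2 * m) : ℤ) (2 * m) | |((a : ℤ) : ℝ)| < ε * m}.card : ℕ) : ℝ) ≤ 3 * (ε * m) := by
  have h : (({a ∈ Icc (-(2 * m) : ℤ) (2 * m) | |((a : ℤ) : ℝ)| < ε * m}.card : ℕ) : ℝ) ≤
      2 * (ε * m) + 1 := by
    refine card_le_of_pairwise_close one_pos (by positivity) (by intros; simp) ?_
    intro a ha b hb
    have ha := abs_lt.1 (mem_filter.1 ha).2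
    have hb := abs_lt.1 (mem_filter.1 hb).2
    push_cast
    linarith [ha.2, hb.1]
  linarith

open Classical in
/-- Few pairs have a large greatest common divisor or a small second entry. -/
theorem card_not_goodPair_le {m : ℕ} {ε : ℝ} (hε : 0 < ε) (hε1 : ε ≤ 1) (hm : 1 ≤ ε * m) :
    (({x ∈ Icc (-(2 * m) : ℤ) (2 * m) ×ˢ Icc (-(2 * m) : ℤ) (2 * m) |
      ¬ GoodPair ε m x.1 x.2}.card : ℕ) : ℝ) ≤ 100 * ε * m ^ 2 := by
  set I := Icc (-(2 * m) : ℤ) (2 * m) with hI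
  have hm1 : (1 : ℝ) ≤ m := by nlinarith [Nat.cast_nonneg (α := ℝ) m]
  set A := I ×ˢ {a ∈ I | |((a : ℤ) : ℝ)| < ε * m} with hA
  set G := fun g : ℕ => {a ∈ I | (g : ℤ) ∣ a} ×ˢ {a ∈ I | (g : ℤ) ∣ a} with hG
  -- A bad pair has a small second entry, or both entries are multiples of some g > 1/ε. In the
  -- second case there are O(m²/g²) pairs for each g, and the tail of ∑ 1/g² is O(ε).
  have hsub : {x ∈ I ×ˢ I | ¬ GoodPair ε m x.1 x.2} ⊆
      A ∪ (Ioo ⌊1 / ε⌋₊ (2 * m + 1)).biUnion G := by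
    intro x hx
    obtain ⟨hxI, hx⟩ := mem_filter.1 hx
    obtain ⟨hx1, hx2⟩ := mem_product.1 hxI
    rw [GoodPair, not_and_or, not_le, not_le] at hx
    rw [mem_union]
    by_cases h : |(x.2 : ℝ)| < ε * m
    · left; exact mem_product.2 ⟨hx1, mem_filter.2 ⟨hx2, h⟩⟩
    · right
      have hx := hx.resolve_left h
      have hx20 : x.2 ≠ 0 := by
        intro h0; rw [h0] at h; simp at h; nlinarith
      refine mem_biUnion.2 ⟨Int.gcd x.1 x.2, mem_Ioo.2 ⟨?_, ?_⟩, mem_product.2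
        ⟨mem_filter.2 ⟨hx1, Int.gcd_dvd_left _ _⟩, mem_filter.2 ⟨hx2, Int.gcd_dvd_right _ _⟩⟩⟩
      · have : 1 / ε < (Int.gcd x.1 x.2 : ℝ) := by rw [div_lt_iff₀ hε]; linarith
        exact_mod_cast (Nat.floor_le (by positivity)).trans_lt this
      · have h1 := Int.le_of_dvd (by positivity) ((Int.dvd_natAbs).2 (Int.gcd_dvd_right x.1 x.2))
        rw [hI, mem_Icc] at hx2
        omega
  have hIc : (I.card : ℝ) ≤ 5 * m := by
    rw [hI, Int.card_Icc]
    have : (2 * (m : ℤ) + 1 - -(2 * m)).toNat = 4 * m + 1 := by omega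
    rw [this]; push_cast; linarith
  have hAc : (A.card : ℝ) ≤ 15 * ε * m ^ 2 := by
    rw [hA, card_product]; push_cast
    calc _ ≤ (5 * m : ℝ) * (3 * (ε * m)) :=
          mul_le_mul hIc (card_small_le hm) (by positivity) (by positivity)
      _ = _ := by ring
  have hGc : ∀ g ∈ Ioo ⌊1 / ε⌋₊ (2 * m + 1), ((G g).card : ℝ) ≤ 36 * m ^ 2 * ((g : ℝ) ^ 2)⁻¹ := by
    intro g hg
    obtain ⟨hg1, hg2⟩ := mem_Ioo.1 hg
    have hg0 : 0 < g := by omega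
    have hgr : (0 : ℝ) < g := by exact_mod_cast hg0
    have hg3 : (g : ℝ) ≤ 2 * m := by exact_mod_cast (by omega : g ≤ 2 * m)
    have h1 : (({a ∈ I | (g : ℤ) ∣ a}.card : ℕ) : ℝ) ≤ 6 * m / g := by
      refine (card_multiples_le hg0).trans ?_
      have : 1 ≤ 2 * m / (g : ℝ) := by rwa [le_div_iff₀ hgr, one_mul]
      calc _ ≤ 4 * m / (g : ℝ) + 2 * m / g := by linarith
        _ = _ := by ring
    simp only [hG]
    rw [card_product]; push_cast
    calc _ ≤ (6 * m / g : ℝ) * (6 * m / g) := by gcongr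
      _ = _ := by field_simp; ring
  have hsum : ∑ g ∈ Ioo ⌊1 / ε⌋₊ (2 * m + 1), ((g : ℝ) ^ 2)⁻¹ ≤ 2 * ε := by
    refine (sum_Ioo_inv_sq_le _ _).trans ?_
    have := (Nat.lt_floor_add_one (1 / ε)).le
    rw [div_le_iff₀ (by positivity)]
    rw [div_le_iff₀ hε] at this
    linarith
  calc _ ≤ (((A ∪ (Ioo ⌊1 / ε⌋₊ (2 * m + 1)).biUnion G).card : ℕ) : ℝ) := by
        exact_mod_cast card_le_card hsub
    _ ≤ A.card + ∑ g ∈ Ioo ⌊1 / ε⌋₊ (2 * m + 1), ((G g).card : ℝ) := by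
        exact_mod_cast (card_union_le _ _).trans (add_le_add le_rfl card_biUnion_le)
    _ ≤ 15 * ε * m ^ 2 + ∑ g ∈ Ioo ⌊1 / ε⌋₊ (2 * m + 1), 36 * m ^ 2 * ((g : ℝ) ^ 2)⁻¹ :=
        add_le_add hAc (sum_le_sum hGc)
    _ = 15 * ε * m ^ 2 + 36 * m ^ 2 * ∑ g ∈ Ioo ⌊1 / ε⌋₊ (2 * m + 1), ((g : ℝ) ^ 2)⁻¹ := by
        rw [mul_sum]
    _ ≤ 15 * ε * m ^ 2 + 36 * m ^ 2 * (2 * ε) := by gcongr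
    _ ≤ 100 * ε * m ^ 2 := by nlinarith [mul_pos hε (pow_pos (by linarith : (0:ℝ) < m) 2)]

/-! ### PET induction -/

/-- One step of van der Corput differencing, discarding the function `A`. -/
theorem vdc_step {R τ : Type*} [Fintype R] (T : Finset τ) (m : ℕ) (A : τ → R → ℂ)
    (g : τ → ℤ → R → ℂ) (hA : ∀ t ∈ T, ∀ z, ‖A t z‖ ≤ 1) :
    ‖∑ t ∈ T, ∑ z, A t z * ∑ y ∈ Icc 1 (m : ℤ), g t y z‖ ^ 2 ≤
      T.card * Fintype.card R * ‖∑ t ∈ T, ∑ k ∈ Icc (-m : ℤ) m, ∑ y ∈ Icc 1 (m : ℤ), ∑ z,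
        ind (Icc 1 (m : ℤ)) (y + k) * (g t y z * conj (g t (y + k) z))‖ := by
  have h := norm_sum_sq_le_doubled (T ×ˢ (univ : Finset R)) (Icc 1 (m : ℤ))
    (fun x => A x.1 x.2) (fun x y => g x.1 y x.2) (fun x hx => hA _ (mem_product.1 hx).1 _)
  rw [card_product, card_univ, sum_sum_eq_sum_diff m (fun y y' => ∑ s ∈ T ×ˢ (univ : Finset R),
    g s.1 y s.2 * conj (g s.1 y' s.2))] at h
  simp_rw [sum_product, mul_sum] at h
  simp_rw [mul_sum]
  push_cast at h
  refine h.trans (le_of_eq ?_)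
  congr 2
  rw [sum_comm (s := T)]
  refine sum_congr rfl fun k _ => ?_
  rw [sum_comm]

theorem norm_mul_le_one {a b : ℂ} (ha : ‖a‖ ≤ 1) (hb : ‖b‖ ≤ 1) : ‖a * b‖ ≤ 1 := by
  rw [norm_mul]; exact mul_le_one₀ ha (norm_nonneg _) hb

theorem norm_conj_le_one {a : ℂ} (ha : ‖a‖ ≤ 1) : ‖conj a‖ ≤ 1 := by
  rwa [RCLike.norm_conj]

/-- The function `F(v - q k²) conj F(v - q k² - 2 q k t)`. -/
def petB {R : Type*} [CommRing R] (q : R) (F : R → ℂ) (k t : ℤ) (v : R) : ℂ :=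
  F (v - q * k ^ 2) * conj (F (v - q * k ^ 2 - 2 * q * k * t))

/-- Four applications of Cauchy–Schwarz linearise the quadratic configuration. -/
theorem pet_linearise {R : Type*} [CommRing R] [Fintype R] (q : R) (m : ℕ) (f₀ f₁ f₂ : R → ℂ)
    (h₀ : ∀ x, ‖f₀ x‖ ≤ 1) (h₁ : ∀ x, ‖f₁ x‖ ≤ 1) (h₂ : ∀ x, ‖f₂ x‖ ≤ 1) :
    ∃ (w : ℤ → ℤ → ℤ → ℤ → ℤ → ℂ) (A : ℤ → ℤ → ℤ → ℤ → R → ℂ),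
      (∀ k h t s y, ‖w k h t s y‖ ≤ 1) ∧ (∀ k h t s v, ‖A k h t s v‖ ≤ 1) ∧
      ‖∑ z, ∑ y ∈ Icc 1 (m : ℤ), f₀ z * f₁ (z + y) * f₂ (z + q * y ^ 2)‖ ^ 16 ≤
        (Fintype.card R : ℝ) ^ 15 * (2 * m + 1) ^ 11 *
        ‖∑ k ∈ Icc (-m : ℤ) m, ∑ h ∈ Icc (-m : ℤ) m, ∑ t ∈ Icc (-m : ℤ) m, ∑ s ∈ Icc (-m : ℤ) m,
          ∑ y ∈ Icc 1 (m : ℤ), ∑ z, w k h t s y * (petB q f₂ k t z *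
            conj (petB q f₂ k t (z - 2 * q * (h + k) * s)) * A k h t s (z + 2 * q * h * y))‖ := by
  set J := Icc 1 (m : ℤ) with hJ
  set K := Icc (-m : ℤ) m with hK
  have hKc : (K.card : ℝ) = 2 * m + 1 := by rw [hK, card_Icc_neg]; push_cast; ring
  set N : ℝ := ((Fintype.card R : ℕ) : ℝ) with hN
  have hN0 : 0 ≤ N := Nat.cast_nonneg _
  -- first differencing
  have s1 := vdc_step (univ : Finset Unit) m (fun _ => f₀)
    (fun _ y z => f₁ (z + y) * f₂ (z + q * y ^ 2)) (fun _ _ => h₀)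
  set g1 : ℤ → ℤ → R → ℂ := fun k y z =>
    ind J (y + k) * (f₂ (z - y + q * y ^ 2) * conj (f₂ (z - y + q * (y + k) ^ 2))) with hg1
  have e1 : ∑ k ∈ K, ∑ y ∈ J, ∑ z : R, ind J (y + k) * (f₁ (z + y) * f₂ (z + q * y ^ 2) *
      conj (f₁ (z + (y + k : ℤ)) * f₂ (z + q * (y + k : ℤ) ^ 2))) =
      ∑ k ∈ K, ∑ z : R, f₁ z * conj (f₁ (z + k)) * ∑ y ∈ J, g1 k y z := by
    refine sum_congr rfl fun k _ => ?_
    simp_rw [mul_sum]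
    rw [sum_comm (s := univ)]
    refine sum_congr rfl fun y _ => ?_
    -- Makes both copies of f₁ independent of y, so that the next step discards them.
    rw [← sum_shift (-(y : R))]
    refine sum_congr rfl fun z _ => ?_
    have a1 : z + -(y : R) + y = z := by ring
    have a2 : z + -(y : R) + q * y ^ 2 = z - y + q * y ^ 2 := by ring
    have a3 : z + -(y : R) + (y + k : ℤ) = z + k := by push_cast; ring
    have a4 : z + -(y : R) + q * (y + k : ℤ) ^ 2 = z - y + q * (y + k) ^ 2 := by push_cast; ring
    rw [a1, a2, a3, a4, map_mul]
    simp only [hg1]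
    ring
  -- second differencing
  have s2 := vdc_step K m (fun k z => f₁ z * conj (f₁ (z + k))) g1
    (fun k _ z => norm_mul_le_one (h₁ _) (norm_conj_le_one (h₁ _)))
  set F3 : ℤ → ℤ → R → ℂ := fun k h v => conj (f₂ (v - h + q * h ^ 2 - q * k ^ 2)) with hF3
  set F4 : ℤ → ℤ → R → ℂ := fun k h v => f₂ (v - h + q * h ^ 2 + 2 * q * h * k) with hF4
  have bF3 : ∀ k h v, ‖F3 k h v‖ ≤ 1 := fun k h v => norm_conj_le_one (h₂ _)
  have bF4 : ∀ k h v, ‖F4 k h v‖ ≤ 1 := fun k h v => h₂ _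
  set w2 : ℤ → ℤ → ℤ → ℂ := fun k h y => ind J (y + h) * (ind J (y + k) * ind J (y + h + k))
    with hw2
  have bw2 : ∀ k h y, ‖w2 k h y‖ ≤ 1 := fun k h y =>
    norm_mul_le_one (norm_ind_le _ _) (norm_mul_le_one (norm_ind_le _ _) (norm_ind_le _ _))
  set g2 : ℤ × ℤ → ℤ → R → ℂ := fun x y z => w2 x.1 x.2 y * (f₂ (z - 2 * q * x.1 * y - q * x.1 ^ 2) *
    F3 x.1 x.2 (z + 2 * q * (x.2 - x.1) * y) * F4 x.1 x.2 (z + 2 * q * x.2 * y)) with hg2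
  have e2 : ∑ k ∈ K, ∑ h ∈ K, ∑ y ∈ J, ∑ z : R, ind J (y + h) *
      (g1 k y z * conj (g1 k (y + h) z)) =
      ∑ x ∈ K ×ˢ K, ∑ z : R, conj (f₂ z) * ∑ y ∈ J, g2 x y z := by
    rw [sum_product]
    refine sum_congr rfl fun k _ => sum_congr rfl fun h _ => ?_
    simp_rw [mul_sum]
    rw [sum_comm (s := univ)]
    refine sum_congr rfl fun y _ => ?_
    -- This recentres at one of the four copies of f₂, which becomes free of y. The other three
    -- arguments differ from it by terms linear in y: the square has disappeared.
    rw [← sum_shift ((y : R) - q * y ^ 2 - 2 * q * k * y - q * k ^ 2)]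
    refine sum_congr rfl fun z _ => ?_
    simp only [hg1, hg2, hF3, hF4, hw2]
    have a1 : z + ((y : R) - q * y ^ 2 - 2 * q * k * y - q * k ^ 2) - y + q * y ^ 2 =
      z - 2 * q * k * y - q * k ^ 2 := by ring
    have a2 : z + ((y : R) - q * y ^ 2 - 2 * q * k * y - q * k ^ 2) - y + q * (y + k) ^ 2 =
      z := by ring
    have a3 : z + ((y : R) - q * y ^ 2 - 2 * q * k * y - q * k ^ 2) - (y + h : ℤ) +
      q * (y + h : ℤ) ^ 2 = z + 2 * q * (h - k) * y - h + q * h ^ 2 - q * k ^ 2 := by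
      push_cast; ring
    have a4 : z + ((y : R) - q * y ^ 2 - 2 * q * k * y - q * k ^ 2) - (y + h : ℤ) +
      q * ((y + h : ℤ) + k) ^ 2 = z + 2 * q * h * y - h + q * h ^ 2 + 2 * q * h * k := by
      push_cast; ring
    rw [a1, a2, a3, a4]
    simp only [map_mul, Complex.conj_conj, conj_ind]
    ring
  -- third differencing
  have s3 := vdc_step (K ×ˢ K) m (fun _ z => conj (f₂ z)) g2
    (fun x _ z => norm_conj_le_one (h₂ _))
  set A3 : ℤ → ℤ → ℤ → R → ℂ := fun k h t v =>
    F3 k h v * conj (F3 k h (v + 2 * q * (h - k) * t)) with hA3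
  have bA3 : ∀ k h t v, ‖A3 k h t v‖ ≤ 1 := fun k h t v =>
    norm_mul_le_one (bF3 _ _ _) (norm_conj_le_one (bF3 _ _ _))
  set w3 : ℤ → ℤ → ℤ → ℤ → ℂ := fun k h t y => ind J (y + t) * (w2 k h y * conj (w2 k h (y + t)))
    with hw3
  have bw3 : ∀ k h t y, ‖w3 k h t y‖ ≤ 1 := fun k h t y =>
    norm_mul_le_one (norm_ind_le _ _) (norm_mul_le_one (bw2 _ _ _) (norm_conj_le_one (bw2 _ _ _)))
  set g3 : (ℤ × ℤ) × ℤ → ℤ → R → ℂ := fun x y z => w3 x.1.1 x.1.2 x.2 y *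
    (petB q f₂ x.1.1 x.2 (z - 2 * q * (x.1.2 + x.1.1) * y) *
      A3 x.1.1 x.1.2 x.2 (z - 2 * q * x.1.1 * y)) with hg3
  have e3 : ∑ x ∈ K ×ˢ K, ∑ t ∈ K, ∑ y ∈ J, ∑ z : R, ind J (y + t) *
      (g2 x y z * conj (g2 x (y + t) z)) =
      ∑ x ∈ (K ×ˢ K) ×ˢ K, ∑ z : R, F4 x.1.1 x.1.2 z *
        conj (F4 x.1.1 x.1.2 (z + 2 * q * x.1.2 * x.2)) * ∑ y ∈ J, g3 x y z := by
    rw [sum_product (s := K ×ˢ K)]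
    refine sum_congr rfl fun x _ => sum_congr rfl fun t _ => ?_
    obtain ⟨k, h⟩ := x
    simp_rw [mul_sum]
    rw [sum_comm (s := univ)]
    refine sum_congr rfl fun y _ => ?_
    -- Chosen so that the two copies of `F4` no longer involve y and can be discarded next.
    rw [← sum_shift (-(2 * q * h * y))]
    refine sum_congr rfl fun z _ => ?_
    simp only [hg2, hg3, hA3, hw3, petB]
    have a1 : z + -(2 * q * h * y) - 2 * q * k * y - q * k ^ 2 =
      z - 2 * q * (h + k) * y - q * k ^ 2 := by ring
    have a2 : z + -(2 * q * h * y) + 2 * q * (h - k) * y = z - 2 * q * k * y := by ring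
    have a3 : z + -(2 * q * h * y) + 2 * q * h * y = z := by ring
    have a4 : z + -(2 * q * h * y) - 2 * q * k * (y + t : ℤ) - q * k ^ 2 =
      z - 2 * q * (h + k) * y - q * k ^ 2 - 2 * q * k * t := by push_cast; ring
    have a5 : z + -(2 * q * h * y) + 2 * q * (h - k) * (y + t : ℤ) =
      z - 2 * q * k * y + 2 * q * (h - k) * t := by push_cast; ring
    have a6 : z + -(2 * q * h * y) + 2 * q * h * (y + t : ℤ) = z + 2 * q * h * t := by
      push_cast; ring
    rw [a1, a2, a3, a4, a5, a6]
    simp only [map_mul]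
    ring
  -- fourth differencing
  have s4 := vdc_step ((K ×ˢ K) ×ˢ K) m (fun x z => F4 x.1.1 x.1.2 z *
        conj (F4 x.1.1 x.1.2 (z + 2 * q * x.1.2 * x.2))) g3
    (fun x _ z => norm_mul_le_one (bF4 _ _ _) (norm_conj_le_one (bF4 _ _ _)))
  refine ⟨fun k h t s y => ind J (y + s) * (w3 k h t y * conj (w3 k h t (y + s))),
    fun k h t s v => A3 k h t v * conj (A3 k h t (v - 2 * q * k * s)),
    fun k h t s y => norm_mul_le_one (norm_ind_le _ _) (norm_mul_le_one (bw3 _ _ _ _)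
      (norm_conj_le_one (bw3 _ _ _ _))),
    fun k h t s v => norm_mul_le_one (bA3 _ _ _ _) (norm_conj_le_one (bA3 _ _ _ _)), ?_⟩
  have e4 : ∑ x ∈ (K ×ˢ K) ×ˢ K, ∑ s ∈ K, ∑ y ∈ J, ∑ z : R, ind J (y + s) *
      (g3 x y z * conj (g3 x (y + s) z)) =
      ∑ k ∈ K, ∑ h ∈ K, ∑ t ∈ K, ∑ s ∈ K, ∑ y ∈ J, ∑ z : R,
        ind J (y + s) * (w3 k h t y * conj (w3 k h t (y + s))) * (petB q f₂ k t z *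
          conj (petB q f₂ k t (z - 2 * q * (h + k) * s)) *
          (A3 k h t (z + 2 * q * h * y) * conj (A3 k h t (z + 2 * q * h * y - 2 * q * k * s)))) := by
    rw [sum_product, sum_product]
    refine sum_congr rfl fun k _ => sum_congr rfl fun h _ => sum_congr rfl fun t _ =>
      sum_congr rfl fun s _ => sum_congr rfl fun y _ => ?_
    rw [← sum_shift (2 * q * (h + k) * y)]
    refine sum_congr rfl fun z _ => ?_
    simp only [hg3]
    have a1 : z + 2 * q * (h + k) * y - 2 * q * (h + k) * y = z := by ring
    have a2 : z + 2 * q * (h + k) * y - 2 * q * k * y = z + 2 * q * h * y := by ring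
    have a3 : z + 2 * q * (h + k) * y - 2 * q * (h + k) * (y + s : ℤ) =
      z - 2 * q * (h + k) * s := by push_cast; ring
    have a4 : z + 2 * q * (h + k) * y - 2 * q * k * (y + s : ℤ) =
      z + 2 * q * h * y - 2 * q * k * s := by push_cast; ring
    rw [a1, a2, a3, a4]
    simp only [map_mul]
    ring
  rw [e4] at s4
  rw [e3] at s3
  rw [e2] at s2
  simp only [univ_unique, sum_singleton, card_singleton, Nat.cast_one, one_mul] at s1
  rw [e1] at s1
  have e0 : ∑ z : R, f₀ z * ∑ y ∈ J, f₁ (z + y) * f₂ (z + q * y ^ 2) =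
      ∑ z, ∑ y ∈ J, f₀ z * f₁ (z + y) * f₂ (z + q * y ^ 2) := by
    simp_rw [mul_sum, mul_assoc]
  rw [e0] at s1
  simp only [card_product] at s2 s3 s4
  push_cast at s2 s3 s4
  rw [hKc] at s2 s3 s4
  rw [← hN] at s1 s2 s3 s4
  set M : ℝ := 2 * m + 1
  have hM0 : 0 ≤ M := by positivity
  generalize ‖∑ z : R, ∑ y ∈ J, f₀ z * f₁ (z + y) * f₂ (z + q * y ^ 2)‖ = x0 at s1 ⊢
  generalize ‖∑ k ∈ K, ∑ z : R, f₁ z * conj (f₁ (z + k)) * ∑ y ∈ J, g1 k y z‖ = x1 at s1 s2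
  generalize ‖∑ x ∈ K ×ˢ K, ∑ z : R, conj (f₂ z) * ∑ y ∈ J, g2 x y z‖ = x2 at s2 s3
  generalize ‖∑ x ∈ (K ×ˢ K) ×ˢ K, ∑ z : R, F4 x.1.1 x.1.2 z *
        conj (F4 x.1.1 x.1.2 (z + 2 * q * x.1.2 * x.2)) * ∑ y ∈ J, g3 x y z‖ = x3 at s3 s4
  calc x0 ^ 16 = (x0 ^ 2) ^ 8 := by ring
    _ ≤ (N * x1) ^ 8 := pow_le_pow_left₀ (sq_nonneg _) s1 8
    _ = N ^ 8 * (x1 ^ 2) ^ 4 := by ring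
    _ ≤ N ^ 8 * (M * N * x2) ^ 4 := by gcongr
    _ = N ^ 12 * M ^ 4 * (x2 ^ 2) ^ 2 := by ring
    _ ≤ N ^ 12 * M ^ 4 * (M * M * N * x3) ^ 2 := by gcongr
    _ = N ^ 14 * M ^ 8 * x3 ^ 2 := by ring
    _ ≤ N ^ 14 * M ^ 8 * (M * M * M * N * _) := by gcongr
    _ = _ := by ring

/-! ### Fibre energies and multiplicative derivatives -/

/-- The multiplicative derivative `F(x) conj F(x + n)`. -/
def dlt {R : Type*} [Add R] (n : R) (F : R → ℂ) (x : R) : ℂ := F x * conj (F (x + n))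

theorem norm_dlt_le {R : Type*} [Add R] {F : R → ℂ} (hF : ∀ x, ‖F x‖ ≤ 1) (n : R) (x : R) :
    ‖dlt n F x‖ ≤ 1 := norm_mul_le_one (hF _) (norm_conj_le_one (hF _))

/-- The sum of the squared moduli of the sums of `C` over the fibres of `ZMod (q * P) → ZMod q`. -/
noncomputable def energy (q P : ℕ) [NeZero q] [NeZero (q * P)] (C : ZMod (q * P) → ℂ) : ℝ :=
  ∑ ρ : ZMod q, ‖∑ x with fib q P x = ρ, C x‖ ^ 2

theorem sum_fibre_shift {q P : ℕ} [NeZero (q * P)] (C : ZMod (q * P) → ℂ) {c : ZMod (q * P)} (hc : fib q P c = 0)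
    (ρ : ZMod q) : ∑ x with fib q P x = ρ, C (x + c) = ∑ x with fib q P x = ρ, C x := by
  rw [sum_filter, sum_filter, ← sum_shift c (fun x => if fib q P x = ρ then C x else 0)]
  simp [hc]

section

variable {q P : ℕ} [NeZero q] [NeZero (q * P)]

theorem energy_nonneg (C : ZMod (q * P) → ℂ) : 0 ≤ energy q P C :=
  sum_nonneg fun _ _ => sq_nonneg _

theorem energy_shift (C : ZMod (q * P) → ℂ) {c : ZMod (q * P)} (hc : fib q P c = 0) :
    energy q P (fun x => C (x + c)) = energy q P C := by
  simp only [energy, sum_fibre_shift C hc]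

/-- Two points share a fibre exactly when they differ by an element n of the kernel of `fib`. -/
theorem energy_eq (C : ZMod (q * P) → ℂ) :
    (energy q P C : ℂ) = ∑ n with fib q P n = 0, ∑ v, conj (C v) * C (v + n) := by
  rw [energy, Complex.ofReal_sum]
  simp_rw [ofReal_norm_sum_sq]
  have h1 : ∀ n : ZMod (q * P), ∑ v, conj (C v) * C (v + n) =
      ∑ ρ : ZMod q, ∑ v with fib q P v = ρ, conj (C v) * C (v + n) := fun n =>
    (sum_fiberwise univ (fib q P) _).symm
  simp_rw [h1]
  rw [sum_comm]
  refine sum_congr rfl fun ρ _ => ?_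
  rw [sum_comm, sum_comm (s := {n | fib q P n = 0})]
  refine sum_congr rfl fun v hv => ?_
  have hv := (mem_filter.1 hv).2
  rw [sum_filter, sum_filter, ← sum_shift v]
  refine sum_congr rfl fun n _ => ?_
  simp only [map_add, hv, add_eq_right]
  rw [add_comm v n, mul_comm (C (n + v))]

end

theorem sum_sub_le (m : ℕ) (φ : ℤ → ℝ) (hφ : ∀ u, 0 ≤ φ u) :
    ∑ y ∈ Icc 1 (m : ℤ), ∑ y' ∈ Icc 1 (m : ℤ), φ (y - y') ≤ m * ∑ u ∈ Icc (-m : ℤ) m, φ u := by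
  have : ∀ y ∈ Icc 1 (m : ℤ), ∑ y' ∈ Icc 1 (m : ℤ), φ (y - y') ≤ ∑ u ∈ Icc (-m : ℤ) m, φ u := by
    intro y hy
    rw [← sum_image (f := φ) (s := Icc 1 (m : ℤ)) (g := fun y' => y - y')
      (fun a _ b _ h => by simpa using h)]
    refine sum_le_sum_of_subset_of_nonneg ?_ fun i _ _ => hφ i
    intro u hu
    obtain ⟨y', hy', rfl⟩ := mem_image.1 hu
    rw [mem_Icc] at *
    omega
  refine (sum_le_sum this).trans (le_of_eq ?_)
  rw [sum_const, nsmul_eq_mul, card_Icc_one]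

/-- The box correlation controlling a two-parameter average of `D`. -/
noncomputable def boxCorr {R : Type*} [CommRing R] [Fintype R] (m : ℕ) (α α' : R) (D : R → ℂ) : ℝ :=
  ∑ v, ∑ y₁ ∈ Icc 1 (m : ℤ), ∑ y₂ ∈ Icc 1 (m : ℤ), ‖∑ y' ∈ Icc 1 (m : ℤ),
    D (v - α * y₁ - α' * y') * conj (D (v - α * y₂ - α' * y'))‖ ^ 2

theorem boxCorr_nonneg {R : Type*} [CommRing R] [Fintype R] (m : ℕ) (α α' : R) (D : R → ℂ) :
    0 ≤ boxCorr m α α' D := by unfold boxCorr; positivity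

/-- In the variable v = z + αy + α'y', the factor `A` depends only on v and y', and `A'` only on v
and y, so both are removed by the box inequality. -/
theorem norm_pow_four_le_boxCorr {R : Type*} [CommRing R] [Fintype R] (m : ℕ) (α α' : R)
    (w w' : ℤ → ℂ) (A A' D : R → ℂ) (hw : ∀ y, ‖w y‖ ≤ 1) (hw' : ∀ y, ‖w' y‖ ≤ 1)
    (hA : ∀ y, ‖A y‖ ≤ 1) (hA' : ∀ y, ‖A' y‖ ≤ 1) :
    ‖∑ y ∈ Icc 1 (m : ℤ), ∑ y' ∈ Icc 1 (m : ℤ), ∑ z,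
      w y * w' y' * (D z * A (z + α * y) * A' (z + α' * y'))‖ ^ 4 ≤
      (Fintype.card R : ℝ) ^ 3 * m ^ 4 * boxCorr m α α' D := by
  have h := norm_sum_pow_four_le_box (univ : Finset R) (Icc 1 (m : ℤ)) (Icc 1 (m : ℤ))
    (fun v y => w y * A' (v - α * y)) (fun v y' => w' y' * A (v - α' * y'))
    (fun v y y' => D (v - α * y - α' * y'))
    (fun v _ y _ => norm_mul_le_one (hw _) (hA' _)) (fun v _ y _ => norm_mul_le_one (hw' _) (hA _))
  rw [card_univ, card_Icc_one] at h
  have e1 : ∑ y ∈ Icc 1 (m : ℤ), ∑ y' ∈ Icc 1 (m : ℤ), ∑ z,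
      w y * w' y' * (D z * A (z + α * y) * A' (z + α' * y')) =
      ∑ v, ∑ y ∈ Icc 1 (m : ℤ), ∑ y' ∈ Icc 1 (m : ℤ), w y * A' (v - α * y) *
        (w' y' * A (v - α' * y')) * D (v - α * y - α' * y') := by
    rw [sum_comm (s := univ)]
    refine sum_congr rfl fun y _ => ?_
    rw [sum_comm (s := univ)]
    refine sum_congr rfl fun y' _ => ?_
    rw [← sum_shift (-(α * y) - α' * y')]
    refine sum_congr rfl fun v _ => ?_
    have a1 : v + (-(α * y) - α' * y') = v - α * y - α' * y' := by ring
    have a2 : v - α * y - α' * y' + α * y = v - α' * y' := by ring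
    have a3 : v - α * y - α' * y' + α' * y' = v - α * y := by ring
    rw [a1, a2, a3]
    ring
  rw [e1]
  refine h.trans (le_of_eq ?_)
  rw [boxCorr]
  ring

/-- Once expanded, the sum over n is `energy_eq` for the second derivatives of `B` along α(y₁ - y₂)
and α'(y₁' - y₂'). The energy is unaffected by translation by α y₁ and α' y₁', which lie in the
kernel. -/
theorem sum_boxCorr_le {q P m : ℕ} [NeZero q] [NeZero (q * P)] {α α' : ZMod (q * P)}
    (hα : fib q P α = 0) (hα' : fib q P α' = 0) (B : ZMod (q * P) → ℂ) :
    ∑ n with fib q P n = 0, boxCorr m α α' (fun z => conj (B z) * B (z + n)) ≤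
      m ^ 2 * ∑ u ∈ Icc (-m : ℤ) m, ∑ u' ∈ Icc (-m : ℤ) m,
        energy q P (dlt (α' * u') (dlt (α * u) B)) := by
  have key : ∑ n with fib q P n = 0, boxCorr m α α' (fun z => conj (B z) * B (z + n)) =
      ∑ y₁ ∈ Icc 1 (m : ℤ), ∑ y₂ ∈ Icc 1 (m : ℤ), ∑ y₁' ∈ Icc 1 (m : ℤ), ∑ y₂' ∈ Icc 1 (m : ℤ),
        energy q P (dlt (α' * (y₁' - y₂' : ℤ)) (dlt (α * (y₁ - y₂ : ℤ)) B)) := by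
    rw [← Complex.ofReal_inj]
    simp only [boxCorr, Complex.ofReal_sum, ofReal_norm_sum_sq]
    simp_rw [sum_comm (s := (univ : Finset (ZMod (q * P))))]
    rw [sum_comm]
    refine sum_congr rfl fun y₁ _ => ?_
    rw [sum_comm]
    refine sum_congr rfl fun y₂ _ => ?_
    rw [sum_comm]
    refine sum_congr rfl fun y₁' _ => ?_
    rw [sum_comm]
    refine sum_congr rfl fun y₂' _ => ?_
    rw [← energy_shift _ (c := -(α * (y₁ : ZMod (q * P))) - α' * (y₁' : ZMod (q * P))) (by simp [hα, hα']), energy_eq]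
    refine sum_congr rfl fun n _ => sum_congr rfl fun v _ => ?_
    have a1 : v + (-(α * y₁) - α' * y₁') = v - α * y₁ - α' * y₁' := by ring
    have a2 : v + n + (-(α * y₁) - α' * y₁') = v - α * y₁ - α' * y₁' + n := by ring
    have a3 : ∀ w, v - α * y₁ - α' * y₁' + w + α * (y₁ - y₂ : ℤ) = v - α * y₂ - α' * y₁' + w := by
      intro w; push_cast; ring
    have a4 : ∀ w, v - α * y₁ - α' * y₁' + w + α' * (y₁' - y₂' : ℤ) =
      v - α * y₁ - α' * y₂' + w := by
      intro w; push_cast; ring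
    have a5 : ∀ w, v - α * y₁ - α' * y₂' + w + α * (y₁ - y₂ : ℤ) =
      v - α * y₂ - α' * y₂' + w := by
      intro w; push_cast; ring
    have b3 := a3 0
    have b4 := a4 0
    have b5 := a5 0
    simp only [add_zero] at b3 b4 b5
    simp only [dlt, a1, a2, a3, a4, a5, b3, b4, b5, map_mul, Complex.conj_conj]
    ring
  rw [key]
  calc _ ≤ ∑ y₁ ∈ Icc 1 (m : ℤ), ∑ y₂ ∈ Icc 1 (m : ℤ), m * ∑ u' ∈ Icc (-m : ℤ) m,
        energy q P (dlt (α' * u') (dlt (α * (y₁ - y₂ : ℤ)) B)) :=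
      sum_le_sum fun y₁ _ => sum_le_sum fun y₂ _ => sum_sub_le m
        (fun u' => energy q P (dlt (α' * u') (dlt (α * (y₁ - y₂ : ℤ)) B)))
        fun _ => energy_nonneg _
    _ ≤ m * ∑ u ∈ Icc (-m : ℤ) m, m * ∑ u' ∈ Icc (-m : ℤ) m,
        energy q P (dlt (α' * u') (dlt (α * u) B)) :=
      sum_sub_le m (fun u => m * ∑ u' ∈ Icc (-m : ℤ) m, energy q P (dlt (α' * u') (dlt (α * u) B)))
        fun _ => mul_nonneg (Nat.cast_nonneg _) (sum_nonneg fun _ _ => energy_nonneg _)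
    _ = _ := by rw [← mul_sum]; ring

/-- `petB` is the derivative of F in direction -2qkt translated by -qk², an element of the kernel of
`fib`. -/
theorem energy_petB {q P : ℕ} [NeZero q] [NeZero (q * P)] (F : ZMod (q * P) → ℂ) (k t : ℤ)
    (n n' : ZMod (q * P)) :
    energy q P (dlt n' (dlt n (petB (q : ZMod (q * P)) F k t))) =
      energy q P (dlt n' (dlt n (dlt (-(2 * q * k * t)) F))) := by
  rw [← energy_shift (dlt n' (dlt n (dlt (-(2 * q * k * t)) F)))
    (c := -((q : ZMod (q * P)) * (k : ZMod (q * P)) ^ 2)) (by rw [map_neg, map_mul, fib_q]; simp)]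
  congr 1
  funext v
  simp only [dlt, petB]
  have : ∀ a b : ZMod (q * P), v + a + b + -(q * (k : ZMod (q * P)) ^ 2) =
    v + -(q * (k : ZMod (q * P)) ^ 2) + a + b := by intros; ring
  ring_nf

/-- Cauchy–Schwarz over `k, t, z` removes one of the factors depending on the dual function. -/
theorem norm_sq_le_sum_pair {R : Type*} [CommRing R] [Fintype R] (q : R) (m : ℕ) (F : R → ℂ)
    (hF : ∀ x, ‖F x‖ ≤ 1) (w : ℤ → ℤ → ℤ → ℤ → ℤ → ℂ) (A : ℤ → ℤ → ℤ → ℤ → R → ℂ) :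
    ‖∑ k ∈ Icc (-m : ℤ) m, ∑ h ∈ Icc (-m : ℤ) m, ∑ t ∈ Icc (-m : ℤ) m, ∑ s ∈ Icc (-m : ℤ) m,
      ∑ y ∈ Icc 1 (m : ℤ), ∑ z, w k h t s y * (petB q F k t z *
        conj (petB q F k t (z - 2 * q * (h + k) * s)) * A k h t s (z + 2 * q * h * y))‖ ^ 2 ≤
    (2 * m + 1) ^ 2 * Fintype.card R *
      ∑ k ∈ Icc (-m : ℤ) m, ∑ t ∈ Icc (-m : ℤ) m, ∑ h ∈ Icc (-m : ℤ) m, ∑ h' ∈ Icc (-m : ℤ) m,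
      ∑ s ∈ Icc (-m : ℤ) m, ∑ s' ∈ Icc (-m : ℤ) m,
      ‖∑ y ∈ Icc 1 (m : ℤ), ∑ y' ∈ Icc 1 (m : ℤ), ∑ z, w k h t s y * conj (w k h' t s' y') *
        (conj (petB q F k t z) *
          petB q F k t (z + ((2 * q * ((h + k) * s - (h' + k) * s')) : R)) *
          A k h t s (z + 2 * q * (h + k) * s + 2 * q * h * y) *
          conj (A k h' t s' (z + 2 * q * (h + k) * s + 2 * q * h' * y')))‖ := by
  set J := Icc 1 (m : ℤ) with hJ
  set K := Icc (-m : ℤ) m with hK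
  have hB : ∀ k t z, ‖petB q F k t z‖ ≤ 1 := fun k t z =>
    norm_mul_le_one (hF _) (norm_conj_le_one (hF _))
  have hKc : (K.card : ℝ) = 2 * m + 1 := by rw [hK, card_Icc_neg]; push_cast; ring
  have e1 : ∑ k ∈ K, ∑ h ∈ K, ∑ t ∈ K, ∑ s ∈ K, ∑ y ∈ J, ∑ z, w k h t s y * (petB q F k t z *
        conj (petB q F k t (z - 2 * q * (h + k) * s)) * A k h t s (z + 2 * q * h * y)) =
      ∑ k ∈ K, ∑ t ∈ K, ∑ z, petB q F k t z * ∑ h ∈ K, ∑ s ∈ K, ∑ y ∈ J, w k h t s y *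
        (conj (petB q F k t (z - 2 * q * (h + k) * s)) * A k h t s (z + 2 * q * h * y)) := by
    refine sum_congr rfl fun k _ => ?_
    rw [sum_comm]
    refine sum_congr rfl fun t _ => ?_
    simp_rw [mul_sum]
    rw [sum_comm (s := univ)]
    refine sum_congr rfl fun h _ => ?_
    rw [sum_comm (s := univ)]
    refine sum_congr rfl fun s _ => ?_
    rw [sum_comm (s := univ)]
    exact sum_congr rfl fun y _ => sum_congr rfl fun z _ => by ring
  rw [e1, ← sum_product']
  have h0 := norm_sum_mul_sq_le (K ×ˢ K) (fun _ => 1) (fun x => ∑ z, petB q F x.1 x.2 z *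
    ∑ h ∈ K, ∑ s ∈ K, ∑ y ∈ J, w x.1 h x.2 s y *
      (conj (petB q F x.1 x.2 (z - 2 * q * (h + x.1) * s)) * A x.1 h x.2 s (z + 2 * q * h * y)))
    (fun _ _ => by simp)
  simp only [one_mul, card_product] at h0
  push_cast at h0
  rw [hKc, ← sq] at h0
  refine h0.trans ?_
  rw [mul_assoc]
  refine mul_le_mul_of_nonneg_left ?_ (by positivity)
  rw [sum_product, mul_sum]
  refine sum_le_sum fun k _ => ?_
  rw [mul_sum]
  refine sum_le_sum fun t _ => ?_
  have h := norm_sum_sq_le_doubled (univ : Finset R) (K ×ˢ K ×ˢ J)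
    (fun z => petB q F k t z) (fun z p => w k p.1 t p.2.1 p.2.2 *
      (conj (petB q F k t (z - 2 * q * (p.1 + k) * p.2.1)) *
        A k p.1 t p.2.1 (z + 2 * q * p.1 * p.2.2))) (fun x _ => hB _ _ _)
  simp only [sum_product, card_univ] at h
  refine h.trans (mul_le_mul_of_nonneg_left ?_ (by positivity))
  have e2 : ∀ h s h' s' : ℤ, (∑ y ∈ J, ∑ y' ∈ J, ∑ z, w k h t s y * conj (w k h' t s' y') *
        (conj (petB q F k t z) *
          petB q F k t (z + ((2 * q * ((h + k) * s - (h' + k) * s')) : R)) *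
          A k h t s (z + 2 * q * (h + k) * s + 2 * q * h * y) *
          conj (A k h' t s' (z + 2 * q * (h + k) * s + 2 * q * h' * y')))) =
      ∑ y ∈ J, ∑ y' ∈ J, ∑ z, w k h t s y *
        (conj (petB q F k t (z - 2 * q * (h + k) * s)) * A k h t s (z + 2 * q * h * y)) *
        conj (w k h' t s' y' * (conj (petB q F k t (z - 2 * q * (h' + k) * s')) *
          A k h' t s' (z + 2 * q * h' * y'))) := by
    intro h s h' s'
    refine sum_congr rfl fun y _ => sum_congr rfl fun y' _ => ?_
    -- Recentring puts the two surviving `petB` factors at distance 2q((h + k)s - (h' + k)s'), the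
    -- bilinear form treated by `sum_bilinear_le`.
    rw [← sum_shift (-(2 * q * (h + k) * s : R))]
    refine sum_congr rfl fun z _ => ?_
    have a1 : z + -(2 * q * (h + k) * s : R) = z - 2 * q * (h + k) * s := by ring
    have a2 : z - 2 * q * (h + k) * s + (2 * q * ((h + k) * s - (h' + k) * s')) =
      z - 2 * q * (h' + k) * s' := by ring
    rw [a1, a2, sub_add_cancel]
    simp only [map_mul, Complex.conj_conj]
    ring
  simp_rw [e2]
  refine (norm_sum_le _ _).trans (sum_le_sum fun h _ => ?_)
  rw [sum_congr rfl fun s _ => sum_comm, sum_comm]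
  refine (norm_sum_le _ _).trans (sum_le_sum fun h' _ => ?_)
  refine (norm_sum_le _ _).trans (sum_le_sum fun s _ => ?_)
  rw [sum_comm]
  exact (norm_sum_le _ _).trans (le_of_eq rfl)

/-- Few parameters lead to a bad pair. -/
theorem sum_bad_le {m : ℕ} {ε : ℝ} (hε : 0 < ε) (hε1 : ε ≤ 1) (hm : 1 ≤ ε * m) {k : ℤ}
    (hk : k ∈ Icc (-m : ℤ) m) (f : ℤ → ℤ → ℝ) {B : ℝ} (hB : 0 ≤ B) (hfB : ∀ h h', f h h' ≤ B)
    (hf : ∀ h h', GoodPair ε m (h + k) (h' + k) → f h h' ≤ 0) :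
    ∑ h ∈ Icc (-m : ℤ) m, ∑ h' ∈ Icc (-m : ℤ) m, f h h' ≤ 100 * ε * m ^ 2 * B := by
  classical
  refine le_trans ?_ (mul_le_mul_of_nonneg_right (card_not_goodPair_le hε hε1 hm) hB)
  rw [← nsmul_eq_mul, ← sum_const, ← sum_product']
  calc _ ≤ ∑ x ∈ Icc (-m : ℤ) m ×ˢ Icc (-m : ℤ) m with ¬ GoodPair ε m (x.1 + k) (x.2 + k), B := by
        rw [sum_filter]
        refine sum_le_sum fun x _ => ?_
        split_ifs with h
        · exact hf _ _ h
        · exact hfB _ _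
    -- Translation by k, with |k| ≤ m, is the reason for counting bad pairs in the box [-2m, 2m]².
    _ = ∑ x ∈ ({x ∈ Icc (-m : ℤ) m ×ˢ Icc (-m : ℤ) m |
          ¬ GoodPair ε m (x.1 + k) (x.2 + k)}).image (fun x => (x.1 + k, x.2 + k)), B := by
        rw [sum_image]
        intro a _ b _ hab
        simpa [Prod.ext_iff] using hab
    _ ≤ _ := by
        refine sum_le_sum_of_subset_of_nonneg ?_ fun _ _ _ => hB
        intro x hx
        obtain ⟨y, hy, rfl⟩ := mem_image.1 hx
        simp only [mem_filter, mem_product, mem_Icc] at hy hk ⊢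
        refine ⟨⟨⟨?_, ?_⟩, ⟨?_, ?_⟩⟩, hy.2⟩ <;> omega

theorem sum_pow_four_le {ι : Type*} (s : Finset ι) (f : ι → ℝ) (hf : ∀ i ∈ s, 0 ≤ f i) :
    (∑ i ∈ s, f i) ^ 4 ≤ (s.card : ℝ) ^ 3 * ∑ i ∈ s, f i ^ 4 :=
  pow_sum_le_card_mul_sum_pow hf 3

theorem norm_sum₃_le {α β γ : Type*} (s : Finset α) (t : Finset β) (u : Finset γ)
    (f : α → β → γ → ℂ) (hf : ∀ a b c, ‖f a b c‖ ≤ 1) :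
    ‖∑ a ∈ s, ∑ b ∈ t, ∑ c ∈ u, f a b c‖ ≤ s.card * t.card * u.card := by
  calc _ ≤ ∑ a ∈ s, ∑ b ∈ t, ∑ c ∈ u, ‖f a b c‖ :=
        (norm_sum_le _ _).trans (sum_le_sum fun a _ => (norm_sum_le _ _).trans
          (sum_le_sum fun b _ => norm_sum_le _ _))
    _ ≤ ∑ a ∈ s, ∑ b ∈ t, ∑ c ∈ u, (1 : ℝ) :=
        sum_le_sum fun a _ => sum_le_sum fun b _ => sum_le_sum fun c _ => hf a b c
    _ = _ := by simp [mul_assoc]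

theorem card_Icc_neg_le {m : ℕ} (hm : 1 ≤ m) : ((Icc (-m : ℤ) m).card : ℝ) ≤ 3 * m := by
  rw [card_Icc_neg]; push_cast
  have : (1 : ℝ) ≤ m := by exact_mod_cast hm
  linarith

open Classical in
/-- Discarding the bad pairs and applying Hölder's inequality to the good ones. -/
theorem sum_le_good_add_bad {m : ℕ} (hm : 1 ≤ m) {ε N B : ℝ} (hε : 0 < ε) (hε1 : ε ≤ 1)
    (hεm : 1 ≤ ε * m) (hN : 0 ≤ N) (hB : 0 ≤ B) (S E : ℤ → ℤ → ℤ → ℤ → ℝ)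
    (hS0 : ∀ k t h h', 0 ≤ S k t h h') (hS1 : ∀ k t h h', S k t h h' ≤ 9 * N * m ^ 4)
    (hE0 : ∀ k t h h', 0 ≤ E k t h h')
    (hSE : ∀ k ∈ Icc (-m : ℤ) m, ∀ t, ∀ h ∈ Icc (-m : ℤ) m, ∀ h' ∈ Icc (-m : ℤ) m,
      GoodPair ε m (h + k) (h' + k) → S k t h h' ^ 4 ≤ B * E k t h h') :
    ∃ G, 0 ≤ G ∧ ∑ k ∈ Icc (-m : ℤ) m, ∑ t ∈ Icc (-m : ℤ) m, ∑ h ∈ Icc (-m : ℤ) m,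
      ∑ h' ∈ Icc (-m : ℤ) m, S k t h h' ≤ G + 8100 * ε * N * m ^ 8 ∧
      G ^ 4 ≤ (81 * m ^ 4) ^ 3 * (B * ∑ k ∈ Icc (-m : ℤ) m, ∑ t ∈ Icc (-m : ℤ) m,
        ∑ h ∈ Icc (-m : ℤ) m, ∑ h' ∈ Icc (-m : ℤ) m, E k t h h') := by
  have hKc := card_Icc_neg_le hm
  set K := Icc (-m : ℤ) m with hK
  have hm0 : (0 : ℝ) < m := by exact_mod_cast hm
  have hbad : ∑ k ∈ K, ∑ t ∈ K, ∑ h ∈ K, ∑ h' ∈ K, (if GoodPair ε m (h + k) (h' + k) then 0 else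
      S k t h h') ≤ 8100 * ε * N * m ^ 8 := by
    calc _ ≤ ∑ k ∈ K, ∑ t ∈ K, 100 * ε * m ^ 2 * (9 * N * m ^ 4) := by
          refine sum_le_sum fun k hk => sum_le_sum fun t _ => ?_
          refine sum_bad_le hε hε1 hεm hk _ (by positivity) ?_ ?_
          · intro h h'
            split_ifs
            · positivity
            · exact hS1 _ _ _ _
          · intro h h' hg
            rw [if_pos hg]
      _ ≤ (3 * m : ℝ) * (3 * m * (100 * ε * m ^ 2 * (9 * N * m ^ 4))) := by
          simp only [sum_const, nsmul_eq_mul]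
          gcongr
      _ = _ := by ring
  refine ⟨∑ k ∈ K, ∑ t ∈ K, ∑ h ∈ K, ∑ h' ∈ K, (if GoodPair ε m (h + k) (h' + k) then
      S k t h h' else 0), ?_, ?_, ?_⟩
  · refine sum_nonneg fun k _ => sum_nonneg fun t _ => sum_nonneg fun h _ =>
      sum_nonneg fun h' _ => ?_
    split_ifs
    · exact hS0 _ _ _ _
    · exact le_rfl
  · refine le_trans (le_of_eq ?_) (add_le_add_right hbad _)
    simp_rw [← sum_add_distrib]
    refine sum_congr rfl fun k _ => sum_congr rfl fun t _ => sum_congr rfl fun h _ =>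
        sum_congr rfl fun h' _ => ?_
    split_ifs <;> simp
  · have := sum_pow_four_le (K ×ˢ K ×ˢ K ×ˢ K) (fun x =>
      if GoodPair ε m (x.2.2.1 + x.1) (x.2.2.2 + x.1) then S x.1 x.2.1 x.2.2.1 x.2.2.2 else 0)
      (fun x _ => by
        split_ifs
        · exact hS0 _ _ _ _
        · exact le_rfl)
    simp only [sum_product, card_product] at this
    push_cast at this
    refine this.trans (mul_le_mul ?_ ?_ ?_ (by positivity))
    · refine pow_le_pow_left₀ (by positivity) ?_ 3
      calc _ = (K.card : ℝ) ^ 4 := by ring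
        _ ≤ (3 * m : ℝ) ^ 4 := by gcongr
        _ = _ := by ring
    · simp_rw [mul_sum]
      refine sum_le_sum fun k hk => sum_le_sum fun t _ => sum_le_sum fun h hh =>
        sum_le_sum fun h' hh' => ?_
      split_ifs with hg
      · exact hSE k hk t h hh h' hh' hg
      · rw [zero_pow (by norm_num)]
        exact mul_nonneg hB (hE0 k t h h')
    · exact sum_nonneg fun _ _ => sum_nonneg fun _ _ => sum_nonneg fun _ _ =>
        sum_nonneg fun _ _ => by positivity

theorem pair_sum_pow_four_le {R : Type*} [CommRing R] [Fintype R] (m : ℕ) (e h h' c n : R)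
    (B A A' : R → ℂ) (w w' : ℤ → ℂ) (hw : ∀ y, ‖w y‖ ≤ 1) (hw' : ∀ y, ‖w' y‖ ≤ 1)
    (hA : ∀ y, ‖A y‖ ≤ 1) (hA' : ∀ y, ‖A' y‖ ≤ 1) :
    ‖∑ y ∈ Icc 1 (m : ℤ), ∑ y' ∈ Icc 1 (m : ℤ), ∑ z, w y * conj (w' y') *
        (conj (B z) * B (z + n) * A (z + c + e * h * y) * conj (A' (z + c + e * h' * y')))‖ ^ 4 ≤
      (Fintype.card R : ℝ) ^ 3 * m ^ 4 *
        boxCorr m (e * h) (e * h') (fun z => conj (B z) * B (z + n)) := by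
  refine le_trans (le_of_eq ?_) (norm_pow_four_le_boxCorr m (e * h) (e * h') w
      (fun y => conj (w' y)) (fun z => A (z + c)) (fun z => conj (A' (z + c)))
      (fun z => conj (B z) * B (z + n)) hw (fun _ => norm_conj_le_one (hw' _)) (fun _ => hA _)
      (fun _ => norm_conj_le_one (hA' _)))
  congr 2
  refine sum_congr rfl fun y _ => sum_congr rfl fun y' _ => sum_congr rfl fun z _ => ?_
  rw [add_right_comm z c, add_right_comm z c]

/-- After Hölder in (s, s'), the box correlation depends on these variables only through the
bilinear shift. Goodness of the pair replaces that shift by a free element of the kernel, and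
`sum_boxCorr_le` turns the result into energies. The constant 2187 is 9 ^ 3 · 3. -/
theorem sum_pair_pow_four_le {q P m : ℕ} [NeZero q] [NeZero (q * P)] (hm : 1 ≤ m)
    (hP : 16 * m ^ 2 < P) {ε N : ℝ} (hε : 0 < ε) (hε1 : ε ≤ 1) (hN : 0 ≤ N)
    {k h h' : ℤ} (hk : k ∈ Icc (-m : ℤ) m) (hh : h ∈ Icc (-m : ℤ) m) (hh' : h' ∈ Icc (-m : ℤ) m)
    (hg : GoodPair ε m (h + k) (h' + k)) (r : ℤ → ℤ → ℝ) (B : ZMod (q * P) → ℂ)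
    (hr0 : ∀ s s', 0 ≤ r s s')
    (hr : ∀ s s', r s s' ^ 4 ≤ N ^ 3 * m ^ 4 * boxCorr m (2 * q * h : ZMod (q * P)) (2 * q * h')
      (fun z => conj (B z) * B (z + ((2 * q * ((h + k) * s - (h' + k) * s') : ℤ) :
        ZMod (q * P))))) :
    (∑ s ∈ Icc (-m : ℤ) m, ∑ s' ∈ Icc (-m : ℤ) m, r s s') ^ 4 ≤
      2187 * m ^ 12 * N ^ 3 / ε ^ 2 * ∑ u ∈ Icc (-m : ℤ) m, ∑ u' ∈ Icc (-m : ℤ) m,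
        energy q P (dlt (2 * q * h' * u') (dlt (2 * q * h * u) B)) := by
  have hKc := card_Icc_neg_le hm
  set K := Icc (-m : ℤ) m with hK
  have hq : 0 < q := Nat.pos_of_ne_zero (NeZero.ne _)
  have r3 : ∑ s ∈ K, ∑ s' ∈ K, boxCorr m (2 * q * h : ZMod (q * P)) (2 * q * h')
      (fun z => conj (B z) * B (z + ((2 * q * ((h + k) * s - (h' + k) * s') : ℤ) :
        ZMod (q * P)))) ≤ 3 / ε ^ 2 * (m ^ 2 * ∑ u ∈ K, ∑ u' ∈ K,
        energy q P (dlt (2 * q * h' * u') (dlt (2 * q * h * u) B))) := by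
    rw [hK, mem_Icc] at hk hh hh'
    refine (sum_bilinear_le hq hP hε hε1 hm (abs_le.2 ⟨by omega, by omega⟩)
      (abs_le.2 ⟨by omega, by omega⟩) hg
      (fun n => boxCorr m (2 * q * h : ZMod (q * P)) (2 * q * h')
      (fun z => conj (B z) * B (z + n))) fun n => boxCorr_nonneg _ _ _ _).trans ?_
    refine mul_le_mul_of_nonneg_left ?_ (by positivity)
    exact sum_boxCorr_le (by simp) (by simp) _
  have := sum_pow_four_le (K ×ˢ K) (fun x => r x.1 x.2) (fun _ _ => hr0 _ _)
  rw [card_product, sum_product, sum_product] at this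
  push_cast at this
  refine this.trans ?_
  calc _ ≤ (9 * m ^ 2 : ℝ) ^ 3 * (N ^ 3 * m ^ 4 * (3 / ε ^ 2 * (m ^ 2 * ∑ u ∈ K, ∑ u' ∈ K,
        energy q P (dlt (2 * q * h' * u') (dlt (2 * q * h * u) B))))) := by
        refine mul_le_mul ?_ ?_ ?_ (by positivity)
        · exact pow_le_pow_left₀ (by positivity) (by nlinarith [Nat.cast_nonneg (α := ℝ) K.card]) 3
        · refine (sum_le_sum fun s _ => sum_le_sum fun s' _ => hr s s').trans ?_
          simp_rw [← mul_sum]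
          exact mul_le_mul_of_nonneg_left r3 (by positivity)
        · exact sum_nonneg fun _ _ => sum_nonneg fun _ _ => by positivity
    _ = _ := by ring

/-- Exponent count: the four differencings give η ^ 16, one more Cauchy–Schwarz gives η ^ 32, and
removing the bad pairs leaves at least η ^ 33. The fourth power gives 132, the factor ε ^ 2 with ε =
η ^ 34 adds 68, and one last η absorbs the numerical constants. -/
theorem energy_lower_bound {η N m P L₀ L S G E : ℝ} (hη : 0 < η) (hη1 : η ≤ 1 / 2 ^ 40)
    (hN : 0 < N) (hm : 1 ≤ m) (hPm : P ≤ 80 * m ^ 2) (hL0 : η * N * m ≤ L₀) (hL : 0 ≤ L)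
    (h1 : L₀ ^ 16 ≤ N ^ 15 * (2 * m + 1) ^ 11 * L) (h2 : L ^ 2 ≤ (2 * m + 1) ^ 2 * N * S)
    (h3 : S ≤ G + 8100 * η ^ 34 * N * m ^ 8)
    (h4 : G ^ 4 ≤ (81 * m ^ 4) ^ 3 * (2187 * m ^ 12 * N ^ 3 / (η ^ 34) ^ 2 * E)) :
    η ^ 201 * (N * P) * m ^ 6 ≤ E := by
  have hm0 : 0 < m := by linarith
  have hM : 2 * m + 1 ≤ 3 * m := by linarith
  have a1 : η ^ 16 * N * m ^ 5 / 3 ^ 11 ≤ L := by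
    have : (η * N * m) ^ 16 ≤ N ^ 15 * (3 * m) ^ 11 * L :=
      (pow_le_pow_left₀ (by positivity) hL0 16).trans (h1.trans (by gcongr))
    rw [div_le_iff₀ (by positivity)]
    have h : N ^ 15 * m ^ 11 * (η ^ 16 * N * m ^ 5) ≤ N ^ 15 * m ^ 11 * (L * 3 ^ 11) := by
      calc _ = (η * N * m) ^ 16 := by ring
        _ ≤ _ := this
        _ = _ := by ring
    exact le_of_mul_le_mul_left h (by positivity)
  have hS0 : 0 ≤ S := by
    have := (sq_nonneg L).trans h2
    by_contra hneg
    have : (2 * m + 1) ^ 2 * N * S < 0 := mul_neg_of_pos_of_neg (by positivity) (not_le.1 hneg)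
    linarith
  have a2 : η ^ 32 * N * m ^ 8 / 3 ^ 24 ≤ S := by
    have : (η ^ 16 * N * m ^ 5 / 3 ^ 11) ^ 2 ≤ (3 * m) ^ 2 * N * S :=
      (pow_le_pow_left₀ (by positivity) a1 2).trans (h2.trans (by gcongr))
    have h : N * m ^ 2 * 9 * (η ^ 32 * N * m ^ 8 / 3 ^ 24) ≤ N * m ^ 2 * 9 * S := by
      calc _ = (η ^ 16 * N * m ^ 5 / 3 ^ 11) ^ 2 := by ring
        _ ≤ _ := this
        _ = _ := by ring
    exact le_of_mul_le_mul_left h (by positivity)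
  have a3 : η ^ 33 * N * m ^ 8 ≤ G := by
    have hη2 : η ^ 2 ≤ η / 2 ^ 40 := by rw [sq]; nlinarith
    have b : η + 8100 * η ^ 2 ≤ 1 / 3 ^ 24 := by nlinarith
    have c : η ^ 32 * (N * m ^ 8) * (η + 8100 * η ^ 2) ≤ η ^ 32 * (N * m ^ 8) * (1 / 3 ^ 24) :=
      mul_le_mul_of_nonneg_left b (by positivity)
    linarith
  have a4 : (η ^ 33 * N * m ^ 8) ^ 4 ≤ _ := (pow_le_pow_left₀ (by positivity) a3 4).trans h4
  have a5 : η ^ 200 * N * m ^ 8 / 3 ^ 19 ≤ E := by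
    have h : 3 ^ 19 * m ^ 24 * N ^ 3 / η ^ 68 * (η ^ 200 * N * m ^ 8 / 3 ^ 19) ≤
        3 ^ 19 * m ^ 24 * N ^ 3 / η ^ 68 * E := by
      calc _ = (η ^ 33 * N * m ^ 8) ^ 4 := by field_simp
        _ ≤ _ := a4
        _ = _ := by field_simp; ring
    exact le_of_mul_le_mul_left h (by positivity)
  refine le_trans ?_ a5
  have b : η * 80 ≤ 1 / 3 ^ 19 := by linarith
  calc η ^ 201 * (N * P) * m ^ 6 ≤ η ^ 201 * (N * (80 * m ^ 2)) * m ^ 6 := by gcongr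
    _ = η ^ 200 * N * m ^ 8 * (η * 80) := by ring
    _ ≤ η ^ 200 * N * m ^ 8 * (1 / 3 ^ 19) := by gcongr
    _ = _ := by ring

/-- A large count of nonlinear configurations forces large averaged box norms of `f₂`. -/
theorem energy_of_count {q P m : ℕ} [NeZero q] [NeZero (q * P)] (hm : 1 ≤ m)
    (hP : 16 * m ^ 2 < P) (hP' : P ≤ 80 * m ^ 2) {η : ℝ} (hη : 0 < η) (hη1 : η ≤ 1 / 2 ^ 40)
    (hηm : 1 ≤ η ^ 34 * m) (f₀ f₁ f₂ : ZMod (q * P) → ℂ) (h₀ : ∀ x, ‖f₀ x‖ ≤ 1)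
    (h₁ : ∀ x, ‖f₁ x‖ ≤ 1) (h₂ : ∀ x, ‖f₂ x‖ ≤ 1)
    (h : η * (q * P) * m ≤ ‖∑ z : ZMod (q * P), ∑ y ∈ Icc 1 (m : ℤ),
      f₀ z * f₁ (z + y) * f₂ (z + q * y ^ 2)‖) :
    η ^ 201 * (q * P * P) * m ^ 6 ≤
      ∑ k ∈ Icc (-m : ℤ) m, ∑ t ∈ Icc (-m : ℤ) m, ∑ h ∈ Icc (-m : ℤ) m, ∑ h' ∈ Icc (-m : ℤ) m,
      ∑ u ∈ Icc (-m : ℤ) m, ∑ u' ∈ Icc (-m : ℤ) m,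
        energy q P (dlt (2 * q * h' * u') (dlt (2 * q * h * u) (dlt (-(2 * q * k * t)) f₂))) := by
  obtain ⟨w, A, hw, hA, hL⟩ := pet_linearise (q : ZMod (q * P)) m f₀ f₁ f₂ h₀ h₁ h₂
  have hL2 := norm_sq_le_sum_pair (q : ZMod (q * P)) m f₂ h₂ w A
  rw [ZMod.card] at hL hL2
  push_cast at hL hL2
  have hm1 : (1 : ℝ) ≤ m := by exact_mod_cast hm
  have hm0 : (0 : ℝ) < m := by linarith
  have hqP : 0 < q * P := Nat.pos_of_ne_zero (NeZero.ne _)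
  have hN0 : 0 < (q : ℝ) * P := by exact_mod_cast hqP
  have hB : ∀ k t z, ‖petB (q : ZMod (q * P)) f₂ k t z‖ ≤ 1 := fun k t z =>
    norm_mul_le_one (h₂ _) (norm_conj_le_one (h₂ _))
  have hKc := card_Icc_neg_le hm
  obtain ⟨G, -, hG1, hG2⟩ := sum_le_good_add_bad hm (ε := η ^ 34) (N := q * P)
    (B := 2187 * m ^ 12 * (q * P) ^ 3 / (η ^ 34) ^ 2) (by positivity)
    (pow_le_one₀ hη.le (hη1.trans (by norm_num))) hηm hN0.le (by positivity)
    (fun k t h h' => ∑ s ∈ Icc (-m : ℤ) m, ∑ s' ∈ Icc (-m : ℤ) m,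
      ‖∑ y ∈ Icc 1 (m : ℤ), ∑ y' ∈ Icc 1 (m : ℤ), ∑ z, w k h t s y * conj (w k h' t s' y') *
        (conj (petB (q : ZMod (q * P)) f₂ k t z) *
          petB (q : ZMod (q * P)) f₂ k t
            (z + ((2 * q * ((h + k) * s - (h' + k) * s')) : ZMod (q * P))) *
          A k h t s (z + 2 * q * (h + k) * s + 2 * q * h * y) *
          conj (A k h' t s' (z + 2 * q * (h + k) * s + 2 * q * h' * y')))‖)
    (fun k t h h' => ∑ u ∈ Icc (-m : ℤ) m, ∑ u' ∈ Icc (-m : ℤ) m,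
      energy q P (dlt (2 * q * h' * u') (dlt (2 * q * h * u) (dlt (-(2 * q * k * t)) f₂))))
    (fun _ _ _ _ => sum_nonneg fun _ _ => sum_nonneg fun _ _ => norm_nonneg _)
    (by
      intro k t h h'
      calc _ ≤ ∑ s ∈ Icc (-m : ℤ) m, ∑ s' ∈ Icc (-m : ℤ) m, (q * P : ℝ) * m ^ 2 := by
            refine sum_le_sum fun s _ => sum_le_sum fun s' _ => ?_
            refine (norm_sum₃_le _ _ _ _ fun y y' z => norm_mul_le_one (norm_mul_le_one
              (hw _ _ _ _ _) (norm_conj_le_one (hw _ _ _ _ _))) (norm_mul_le_one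
              (norm_mul_le_one (norm_mul_le_one (norm_conj_le_one (hB _ _ _)) (hB _ _ _))
              (hA _ _ _ _ _)) (norm_conj_le_one (hA _ _ _ _ _)))).trans (le_of_eq ?_)
            rw [card_Icc_one, card_univ, ZMod.card]; push_cast; ring
        _ ≤ (3 * m : ℝ) * (3 * m * ((q * P : ℝ) * m ^ 2)) := by
            simp only [sum_const, nsmul_eq_mul]
            gcongr
        _ = _ := by ring)
    (fun _ _ _ _ => sum_nonneg fun _ _ => sum_nonneg fun _ _ => energy_nonneg _)
    (by
      intro k hk t h hh h' hh' hg
      simp only [← energy_petB]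
      refine sum_pair_pow_four_le hm hP (by positivity)
        (pow_le_one₀ hη.le (hη1.trans (by norm_num))) hN0.le hk hh hh' hg _ _
        (fun _ _ => norm_nonneg _) fun s s' => ?_
      have := pair_sum_pow_four_le m (2 * q : ZMod (q * P)) h h' (2 * q * (h + k) * s)
        (2 * q * ((h + k) * s - (h' + k) * s')) (petB (q : ZMod (q * P)) f₂ k t)
        (A k h t s) (A k h' t s') (w k h t s) (w k h' t s') (hw _ _ _ _) (hw _ _ _ _)
        (hA _ _ _ _) (hA _ _ _ _)
      rw [ZMod.card] at this
      push_cast at this ⊢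
      exact this)
  have := energy_lower_bound (P := P) hη hη1 hN0 hm1 (by exact_mod_cast hP') h (norm_nonneg _) hL
    hL2 hG1 hG2
  exact this

/-! ### Characters of `ZMod n` -/

theorem norm_stdAddChar {n : ℕ} [NeZero n] (x : ZMod n) : ‖ZMod.stdAddChar x‖ = 1 :=
  AddChar.norm_apply _ _

theorem conj_stdAddChar {n : ℕ} [NeZero n] (x : ZMod n) :
    conj (ZMod.stdAddChar x) = ZMod.stdAddChar (-x) := (AddChar.map_neg_eq_conj _ _).symm

/-- Parseval's identity. -/
theorem sum_norm_sq_fourier {n : ℕ} [NeZero n] (f : ZMod n → ℂ) :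
    ∑ c, ‖∑ x, f x * ZMod.stdAddChar (c * x)‖ ^ 2 = n * ∑ x, ‖f x‖ ^ 2 := by
  rw [← Complex.ofReal_inj]
  push_cast
  have h1 : ∀ c : ZMod n, ((‖∑ x, f x * ZMod.stdAddChar (c * x)‖ : ℂ)) ^ 2 =
      ∑ x, ∑ y, f x * conj (f y) * ZMod.stdAddChar (c * (x - y)) := by
    intro c
    have := ofReal_norm_sum_sq univ (fun x => f x * ZMod.stdAddChar (c * x))
    push_cast at this
    rw [this]
    refine sum_congr rfl fun x _ => sum_congr rfl fun y _ => ?_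
    rw [map_mul (starRingEnd ℂ), conj_stdAddChar, mul_sub, sub_eq_add_neg, AddChar.map_add_eq_mul]
    ring
  simp_rw [h1]
  rw [sum_comm, mul_sum]
  refine sum_congr rfl fun x _ => ?_
  rw [sum_comm]
  simp_rw [← mul_sum, AddChar.sum_mulShift _ (ZMod.isPrimitive_stdAddChar n), ZMod.card, sub_eq_zero]
  simp only [Nat.cast_ite, Nat.cast_zero, mul_ite, mul_zero]
  rw [sum_ite_eq, if_pos (mem_univ _), Complex.mul_conj, Complex.normSq_eq_norm_sq]
  push_cast
  ring

/-- The Fourier transform of the autocorrelation is the squared modulus of that of `g`. Parseval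
gives the sum of its fourth powers; two of the four factors are bounded by `X`, and Parseval is
applied again. -/
theorem sum_norm_corr_sq_le {n : ℕ} [NeZero n] (g : ZMod n → ℂ) {X : ℝ}
    (hX : ∀ c, ‖∑ x, g x * ZMod.stdAddChar (c * x)‖ ≤ X) :
    ∑ l, ‖∑ x, dlt l g x‖ ^ 2 ≤ X ^ 2 * ∑ x, ‖g x‖ ^ 2 := by
  have hn : (0 : ℝ) < n := by exact_mod_cast Nat.pos_of_ne_zero (NeZero.ne n)
  have h1 : ∀ c, ∑ l, (∑ x, dlt l g x) * ZMod.stdAddChar (c * l) =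
      ((‖∑ x, g x * ZMod.stdAddChar (-c * x)‖ ^ 2 : ℝ) : ℂ) := by
    intro c
    rw [ofReal_norm_sum_sq]
    simp_rw [sum_mul]
    rw [sum_comm]
    refine sum_congr rfl fun x _ => ?_
    rw [← sum_shift (-x)]
    refine sum_congr rfl fun y _ => ?_
    have a1 : x + (y + -x) = y := by ring
    have a2 : c * (y + -x) = -c * x + - (-c * y) := by ring
    simp only [dlt]
    rw [a1, a2, AddChar.map_add_eq_mul, map_mul (starRingEnd ℂ), conj_stdAddChar]
    ring
  have h2 := sum_norm_sq_fourier (fun l => ∑ x, dlt l g x)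
  simp_rw [h1] at h2
  have h3 : n * ∑ l, ‖∑ x, dlt l g x‖ ^ 2 ≤ n * (X ^ 2 * ∑ x, ‖g x‖ ^ 2) := by
    rw [← h2]
    calc _ ≤ ∑ c, X ^ 2 * ‖∑ x, g x * ZMod.stdAddChar (-c * x)‖ ^ 2 := by
          refine sum_le_sum fun c _ => ?_
          rw [Complex.norm_real, Real.norm_of_nonneg (by positivity), sq (_ ^ 2)]
          exact mul_le_mul_of_nonneg_right
            (pow_le_pow_left₀ (norm_nonneg _) (hX _) 2) (by positivity)
      _ = X ^ 2 * ∑ c, ‖∑ x, g x * ZMod.stdAddChar (c * x)‖ ^ 2 := by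
          rw [← mul_sum]
          congr 1
          exact Equiv.sum_comp (Equiv.neg (ZMod n))
            (fun c => ‖∑ x, g x * ZMod.stdAddChar (c * x)‖ ^ 2)
      _ = _ := by rw [sum_norm_sq_fourier]; ring
  exact le_of_mul_le_mul_left h3 hn

/-! ### Autocorrelations of functions supported on one fibre. -/

theorem card_fibre {q P : ℕ} [NeZero q] [NeZero (q * P)] (ρ : ZMod q) :
    #{x : ZMod (q * P) | fib q P x = ρ} = P := by
  have h1 : ∀ ρ, #{x : ZMod (q * P) | fib q P x = ρ} = #{x : ZMod (q * P) | fib q P x = 0} := by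
    intro ρ
    obtain ⟨y, hy⟩ := ZMod.castHom_surjective (dvd_mul_right q P) ρ
    rw [← card_image_of_injective {x : ZMod (q * P) | fib q P x = 0} (add_left_injective y)]
    congr 1
    ext x
    simp only [mem_filter, mem_univ, true_and, mem_image]
    constructor
    · intro hx
      refine ⟨x - y, ?_, by ring⟩
      rw [map_sub, hx]; exact sub_eq_zero.2 hy.symm
    · rintro ⟨a, ha, rfl⟩
      rw [map_add, ha, zero_add]; exact hy
  have h2 := card_eq_sum_card_fiberwise (s := (univ : Finset (ZMod (q * P)))) (t := univ)
    (f := fib q P) (fun _ _ => mem_coe.2 (mem_univ _))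
  rw [card_univ, ZMod.card, sum_congr rfl fun ρ _ => h1 ρ, sum_const, card_univ, ZMod.card,
    smul_eq_mul] at h2
  rw [h1]
  exact (Nat.eq_of_mul_eq_mul_left (Nat.pos_of_ne_zero (NeZero.ne q)) h2).symm

theorem sum_supported_le {q P : ℕ} [NeZero q] [NeZero (q * P)] {g : ZMod (q * P) → ℂ}
    (hg : ∀ x, ‖g x‖ ≤ 1) {ρ : ZMod q} (hs : ∀ x, fib q P x ≠ ρ → g x = 0) (φ : ZMod (q * P) → ℝ)
    (h1 : ∀ x, φ x ≤ ‖g x‖) : ∑ x, φ x ≤ P := by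
  calc ∑ x, φ x ≤ ∑ x : ZMod (q * P), if fib q P x = ρ then (1 : ℝ) else 0 := by
        refine sum_le_sum fun x _ => ?_
        split_ifs with h
        · exact (h1 x).trans (hg x)
        · have := h1 x; rwa [hs x h, norm_zero] at this
    _ = P := by rw [← sum_filter, sum_const, card_fibre, nsmul_eq_mul, mul_one]

/-- Cauchy–Schwarz over the P elements of the kernel, then `sum_norm_corr_sq_le`. The support
condition makes the bound depend on P and not on qP. -/
theorem sum_corr_le {q P : ℕ} [NeZero q] [NeZero (q * P)] {g : ZMod (q * P) → ℂ}
    (hg : ∀ x, ‖g x‖ ≤ 1) {ρ : ZMod q} (hs : ∀ x, fib q P x ≠ ρ → g x = 0) {X : ℝ} (hX0 : 0 ≤ X)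
    (hX : ∀ c, ‖∑ x, g x * ZMod.stdAddChar (c * x)‖ ≤ X) :
    ∑ l with fib q P l = 0, ‖∑ x, dlt l g x‖ ≤ P * X := by
  refine le_of_sq_le_sq ?_ (by positivity)
  calc (∑ l with fib q P l = 0, ‖∑ x, dlt l g x‖) ^ 2
      ≤ #{l : ZMod (q * P) | fib q P l = 0} * ∑ l with fib q P l = 0, ‖∑ x, dlt l g x‖ ^ 2 :=
        sq_sum_le_card_mul_sum_sq
    _ ≤ P * ∑ l, ‖∑ x, dlt l g x‖ ^ 2 := by
        rw [card_fibre]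
        exact mul_le_mul_of_nonneg_left (sum_le_sum_of_subset_of_nonneg (filter_subset _ _)
          fun _ _ _ => by positivity) (by positivity)
    _ ≤ P * (X ^ 2 * P) := by
        refine mul_le_mul_of_nonneg_left ((sum_norm_corr_sq_le g hX).trans ?_) (by positivity)
        refine mul_le_mul_of_nonneg_left (sum_supported_le hg hs _ fun x => ?_) (by positivity)
        exact pow_le_of_le_one (norm_nonneg _) (hg x) two_ne_zero
    _ = _ := by ring

theorem norm_corr_le {q P : ℕ} [NeZero q] [NeZero (q * P)] {g : ZMod (q * P) → ℂ}
    (hg : ∀ x, ‖g x‖ ≤ 1) {ρ : ZMod q} (hs : ∀ x, fib q P x ≠ ρ → g x = 0) (l : ZMod (q * P)) :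
    ‖∑ x, dlt l g x‖ ≤ P := by
  refine (norm_sum_le _ _).trans (sum_supported_le hg hs _ fun x => ?_)
  rw [dlt, norm_mul]
  exact mul_le_of_le_one_right (norm_nonneg _) (norm_conj_le_one (hg _))

/-- Correlations along a family of shifts are controlled by correlations along its differences. -/
theorem sq_sum_corr_sq_le {q P : ℕ} [NeZero q] [NeZero (q * P)] {g : ZMod (q * P) → ℂ}
    (hg : ∀ x, ‖g x‖ ≤ 1) {ρ : ZMod q} (hs : ∀ x, fib q P x ≠ ρ → g x = 0) {α : Type*}
    (T : Finset α) (ν : α → ZMod (q * P)) :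
    (∑ p ∈ T, ‖∑ x, dlt (ν p) g x‖ ^ 2) ^ 2 ≤
      P ^ 3 * ∑ p ∈ T, ∑ p' ∈ T, ‖∑ x, dlt (ν p - ν p') g x‖ := by
  have h := norm_sum_sq_le_doubled ({x | fib q P x = ρ} : Finset (ZMod (q * P))) T g
    (fun x p => conj (∑ x, dlt (ν p) g x) * conj (g (x + ν p))) (fun x _ => hg x)
  rw [card_fibre, ← sum_norm_sum_sq] at h
  -- Writing a squared correlation as its conjugate times its definition isolates the factor g(x),
  -- free of p, which Cauchy–Schwarz discards.
  have e1 : ∑ x with fib q P x = ρ, g x * ∑ p ∈ T, conj (∑ x, dlt (ν p) g x) * conj (g (x + ν p)) =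
      ((∑ p ∈ T, ‖∑ x, dlt (ν p) g x‖ ^ 2 : ℝ) : ℂ) := by
    have : ∀ x, x ∈ (univ : Finset (ZMod (q * P))) →
        x ∉ ({x | fib q P x = ρ} : Finset (ZMod (q * P))) →
        g x * ∑ p ∈ T, conj (∑ x, dlt (ν p) g x) * conj (g (x + ν p)) = 0 := by
      intro x _ hx
      rw [hs x (by simpa using hx), zero_mul]
    rw [sum_subset (subset_univ _) this]
    simp_rw [mul_sum]
    rw [sum_comm, Complex.ofReal_sum]
    refine sum_congr rfl fun p _ => ?_
    rw [← Complex.normSq_eq_norm_sq, ← Complex.mul_conj, sum_mul]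
    refine sum_congr rfl fun x _ => ?_
    rw [dlt]
    ring
  rw [e1, Complex.norm_real, Real.norm_of_nonneg (sum_nonneg fun _ _ => by positivity)] at h
  refine h.trans ?_
  rw [pow_succ' (P : ℝ) 2, mul_assoc]
  refine mul_le_mul_of_nonneg_left ?_ (by positivity)
  calc _ ≤ ∑ x, ‖∑ p ∈ T, conj (∑ x, dlt (ν p) g x) * conj (g (x + ν p))‖ ^ 2 :=
        sum_le_sum_of_subset_of_nonneg (filter_subset _ _) fun _ _ _ => by positivity
    _ ≤ _ := by
        rw [sum_norm_sum_sq, mul_sum]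
        refine (norm_sum_le _ _).trans (sum_le_sum fun p _ => ?_)
        rw [mul_sum]
        refine (norm_sum_le _ _).trans (sum_le_sum fun p' _ => ?_)
        have e2 : ∑ x, conj (∑ x, dlt (ν p) g x) * conj (g (x + ν p)) *
            conj (conj (∑ x, dlt (ν p') g x) * conj (g (x + ν p'))) =
            (conj (∑ x, dlt (ν p) g x) * ∑ x, dlt (ν p') g x) * ∑ x, dlt (ν p - ν p') g x := by
          rw [mul_sum _ _ (_ * _), ← sum_shift (-ν p')]
          refine sum_congr rfl fun x _ => ?_
          have a1 : x + -ν p' + ν p = x + (ν p - ν p') := by ring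
          have a2 : x + -ν p' + ν p' = x := by ring
          rw [a1, a2, map_mul, Complex.conj_conj, Complex.conj_conj]
          simp only [dlt]
          ring
        rw [e2, norm_mul, norm_mul, RCLike.norm_conj]
        refine mul_le_mul_of_nonneg_right ?_ (norm_nonneg _)
        rw [sq]
        exact mul_le_mul (norm_corr_le hg hs _) (norm_corr_le hg hs _) (norm_nonneg _)
          (by positivity)

/-- Large averaged box norms along `c + 2 q h u` are controlled by the largest Fourier
coefficient. -/
theorem sq_sum_bilinear_corr_le {q P m : ℕ} [NeZero q] [NeZero (q * P)] (hm : 1 ≤ m)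
    (hP : 16 * m ^ 2 < P) {ε : ℝ} (hε : 0 < ε) (hε1 : ε ≤ 1) (hεm : 1 ≤ ε * m)
    {g : ZMod (q * P) → ℂ}
    (hg : ∀ x, ‖g x‖ ≤ 1) {ρ : ZMod q} (hs : ∀ x, fib q P x ≠ ρ → g x = 0) {X : ℝ} (hX0 : 0 ≤ X)
    (hX : ∀ c, ‖∑ x, g x * ZMod.stdAddChar (c * x)‖ ≤ X) (c : ZMod (q * P)) :
    (∑ h ∈ Icc (-m : ℤ) m, ∑ u ∈ Icc (-m : ℤ) m, ‖∑ x, dlt (c + 2 * q * h * u) g x‖ ^ 2) ^ 2 ≤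
      P ^ 4 * (2 * m + 1) ^ 2 * (3 / ε ^ 2 * X + 100 * ε * (2 * m + 1) ^ 2) := by
  have hKc : ((Icc (-m : ℤ) m).card : ℝ) = 2 * m + 1 := by rw [card_Icc_neg]; push_cast; ring
  have hq : 0 < q := Nat.pos_of_ne_zero (NeZero.ne _)
  set K := Icc (-m : ℤ) m with hK
  have h := sq_sum_corr_sq_le hg hs (K ×ˢ K) (fun p : ℤ × ℤ => c + 2 * q * p.1 * p.2)
  simp only [sum_product] at h
  refine h.trans ?_
  -- The constant `c` cancels in the differences, so later base points of the derivatives do no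
  -- harm.
  have e1 : ∀ h u h' u' : ℤ, (c + 2 * q * h * u - (c + 2 * q * h' * u') : ZMod (q * P)) =
      ((2 * q * (h * u - h' * u') : ℤ) : ZMod (q * P)) := by
    intros; push_cast; ring
  simp_rw [e1]
  set T : ZMod (q * P) → ℝ := fun n => ‖∑ x, dlt n g x‖ with hT
  have hT0 : ∀ n, 0 ≤ T n := fun _ => norm_nonneg _
  have hT1 : ∀ n, T n ≤ P := norm_corr_le hg hs
  have hT2 := sum_corr_le hg hs hX0 hX
  set U : ℤ → ℤ → ℝ := fun h h' => ∑ u ∈ K, ∑ u' ∈ K,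
    T ((2 * q * (h * u - h' * u') : ℤ) : ZMod (q * P)) with hU
  have hU0 : ∀ h h', 0 ≤ U h h' := fun _ _ => sum_nonneg fun _ _ => sum_nonneg fun _ _ => hT0 _
  have hU1 : ∀ h h', U h h' ≤ (2 * m + 1) ^ 2 * P := by
    intro h h'
    refine (sum_le_sum fun u _ => sum_le_sum fun u' _ => hT1 _).trans (le_of_eq ?_)
    simp only [sum_const, nsmul_eq_mul, hKc]
    ring
  have hU2 : ∀ h ∈ K, ∀ h' ∈ K, GoodPair ε m h h' → U h h' ≤ 3 / ε ^ 2 * (P * X) := by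
    intro h hh h' hh' hg
    rw [hK, mem_Icc] at hh hh'
    exact (sum_bilinear_le hq hP hε hε1 hm (abs_le.2 ⟨by omega, by omega⟩)
      (abs_le.2 ⟨by omega, by omega⟩) hg T hT0).trans
      (mul_le_mul_of_nonneg_left hT2 (by positivity))
  have e2 : ∑ h ∈ K, ∑ u ∈ K, ∑ h' ∈ K, ∑ u' ∈ K,
      T ((2 * q * (h * u - h' * u') : ℤ) : ZMod (q * P)) = ∑ h ∈ K, ∑ h' ∈ K, U h h' :=
    sum_congr rfl fun h _ => sum_comm
  rw [e2]
  classical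
  have hbad : ∑ h ∈ K, ∑ h' ∈ K, (if GoodPair ε m h h' then 0 else U h h') ≤
      100 * ε * m ^ 2 * ((2 * m + 1) ^ 2 * P) := by
    refine sum_bad_le (k := 0) hε hε1 hεm (by simp) _ (by positivity) ?_ ?_
    · intro h h'
      split_ifs
      · positivity
      · exact hU1 _ _
    · intro h h' hg
      rw [add_zero, add_zero] at hg
      rw [if_pos hg]
  have hsplit : ∑ h ∈ K, ∑ h' ∈ K, U h h' ≤ ∑ h ∈ K, ∑ h' ∈ K, 3 / ε ^ 2 * (P * X) +
      ∑ h ∈ K, ∑ h' ∈ K, (if GoodPair ε m h h' then 0 else U h h') := by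
    simp_rw [← sum_add_distrib]
    refine sum_le_sum fun h hh => sum_le_sum fun h' hh' => ?_
    split_ifs with hg
    · rw [add_zero]; exact hU2 h hh h' hh' hg
    · have : 0 ≤ 3 / ε ^ 2 * (P * X) := by positivity
      linarith
  simp only [sum_const, nsmul_eq_mul, hKc] at hsplit
  have hm2 : (m : ℝ) ^ 2 ≤ (2 * m + 1) ^ 2 :=
    pow_le_pow_left₀ (by positivity) (by linarith [Nat.cast_nonneg (α := ℝ) m]) 2
  calc _ ≤ (P : ℝ) ^ 3 * ((2 * m + 1) * ((2 * m + 1) * (3 / ε ^ 2 * (P * X))) +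
        100 * ε * (2 * m + 1) ^ 2 * ((2 * m + 1) ^ 2 * P)) := by
        refine mul_le_mul_of_nonneg_left (hsplit.trans (add_le_add_right (hbad.trans ?_) _))
          (by positivity)
        gcongr
    _ = _ := by ring

/-- The restriction of `G` to a fibre. -/
noncomputable def restr (q P : ℕ) (ρ : ZMod q) (G : ZMod (q * P) → ℂ) (x : ZMod (q * P)) : ℂ :=
  if fib q P x = ρ then G x else 0

theorem sum_restr_mul {q P : ℕ} [NeZero (q * P)] (ρ : ZMod q) (G φ : ZMod (q * P) → ℂ) :
    ∑ x, restr q P ρ G x * φ x = ∑ x with fib q P x = ρ, G x * φ x := by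
  simp only [restr, ite_mul, zero_mul, sum_filter]

theorem sum_dlt_restr {q P : ℕ} [NeZero (q * P)] (ρ : ZMod q) (G : ZMod (q * P) → ℂ)
    {n : ZMod (q * P)} (hn : fib q P n = 0) :
    ∑ x, dlt n (restr q P ρ G) x = ∑ x with fib q P x = ρ, dlt n G x := by
  rw [sum_filter]
  refine sum_congr rfl fun x _ => ?_
  simp only [dlt, restr, map_add, hn, add_zero]
  split_ifs <;> simp

/-- A lower bound for averaged energies gives characters correlating with the functions. -/
theorem exists_char_of_energy {q P m : ℕ} [NeZero q] [NeZero (q * P)] (hm : 1 ≤ m)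
    (hP : 16 * m ^ 2 < P) (hP' : P ≤ 80 * m ^ 2) {η : ℝ} (hη : 0 < η) (hη1 : η ≤ 1 / 2 ^ 40)
    (hηm : 1 ≤ η ^ 3 * m) {ι : Type*} (I : Finset ι) (G : ι → ZMod (q * P) → ℂ)
    (hG : ∀ i x, ‖G i x‖ ≤ 1) {c : ZMod (q * P)} (hc : fib q P c = 0)
    (h : η * (I.card * q * (2 * m + 1) ^ 2 * P ^ 2) ≤ ∑ i ∈ I, ∑ h ∈ Icc (-m : ℤ) m,
      ∑ u ∈ Icc (-m : ℤ) m, energy q P (dlt (c + 2 * q * h * u) (G i))) :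
    ∃ χ : ι → ZMod q → ZMod (q * P), η ^ 9 * (I.card * q * P) ≤
      ∑ i ∈ I, ∑ ρ, ‖∑ x with fib q P x = ρ, G i x * ZMod.stdAddChar (χ i ρ * x)‖ := by
  -- The characters produced are those of the largest Fourier coefficient of each restriction to a
  -- fibre.
  have hmax : ∀ i ρ, ∃ c : ZMod (q * P), ∀ c' : ZMod (q * P),
      ‖∑ x, restr q P ρ (G i) x * ZMod.stdAddChar (c' * x)‖ ≤
        ‖∑ x, restr q P ρ (G i) x * ZMod.stdAddChar (c * x)‖ := by
    intro i ρ
    obtain ⟨c, -, hc⟩ := exists_max_image univ (fun c : ZMod (q * P) =>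
      ‖∑ x, restr q P ρ (G i) x * ZMod.stdAddChar (c * x)‖) univ_nonempty
    exact ⟨c, fun c' => hc c' (mem_univ _)⟩
  choose χ hχ using hmax
  refine ⟨χ, ?_⟩
  rcases I.eq_empty_or_nonempty with rfl | hI
  · simp
  set K := Icc (-m : ℤ) m with hK
  set X : ι → ZMod q → ℝ := fun i ρ =>
    ‖∑ x with fib q P x = ρ, G i x * ZMod.stdAddChar (χ i ρ * x)‖ with hX
  set Y : ι → ZMod q → ℝ := fun i ρ => ∑ h ∈ K, ∑ u ∈ K,
    ‖∑ x with fib q P x = ρ, dlt (c + 2 * q * h * u) (G i) x‖ ^ 2 with hY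
  have hker : ∀ h u : ℤ, fib q P (c + 2 * q * h * u) = 0 := by
    intro h u; simp [hc]
  have hYX : ∀ i ρ, Y i ρ ^ 2 ≤ P ^ 4 * (2 * m + 1) ^ 2 *
      (3 / (η ^ 3) ^ 2 * X i ρ + 100 * η ^ 3 * (2 * m + 1) ^ 2) := by
    intro i ρ
    have := sq_sum_bilinear_corr_le hm hP (pow_pos hη 3) (pow_le_one₀ hη.le
      (hη1.trans (by norm_num))) hηm (g := restr q P ρ (G i)) (ρ := ρ)
      (fun x => by unfold restr; split_ifs <;> simp [hG]) (fun x hx => if_neg hx)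
      (norm_nonneg _) (hχ i ρ) c
    simp only [sum_restr_mul, sum_dlt_restr ρ (G i) (hker _ _)] at this
    exact this
  have hE : ∑ i ∈ I, ∑ h ∈ K, ∑ u ∈ K, energy q P (dlt (c + 2 * q * h * u) (G i)) =
      ∑ i ∈ I, ∑ ρ, Y i ρ := by
    refine sum_congr rfl fun i _ => ?_
    simp only [energy, hY]
    rw [sum_congr rfl fun h _ => sum_comm, sum_comm]
  rw [hE] at h
  have hCS : (∑ i ∈ I, ∑ ρ, Y i ρ) ^ 2 ≤ (I.card * q) * ∑ i ∈ I, ∑ ρ, Y i ρ ^ 2 := by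
    have := sq_sum_le_card_mul_sum_sq (s := I ×ˢ (univ : Finset (ZMod q)))
      (f := fun x => Y x.1 x.2)
    rw [sum_product, sum_product, card_product, card_univ, ZMod.card] at this
    push_cast at this
    exact this
  have hsum : ∑ i ∈ I, ∑ ρ, Y i ρ ^ 2 ≤ P ^ 4 * (2 * m + 1) ^ 2 *
      (3 / (η ^ 3) ^ 2 * (∑ i ∈ I, ∑ ρ, X i ρ) +
        I.card * q * (100 * η ^ 3 * (2 * m + 1) ^ 2)) := by
    refine (sum_le_sum fun i _ => sum_le_sum fun ρ _ => hYX i ρ).trans (le_of_eq ?_)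
    simp_rw [← mul_sum, sum_add_distrib, ← mul_sum]
    simp only [sum_const, card_univ, ZMod.card, nsmul_eq_mul]
    ring
  change _ ≤ ∑ i ∈ I, ∑ ρ, X i ρ
  generalize ∑ i ∈ I, ∑ ρ, X i ρ = S at *
  generalize ∑ i ∈ I, ∑ ρ, Y i ρ = Z at *
  generalize ∑ i ∈ I, ∑ ρ, Y i ρ ^ 2 = Z2 at *
  have hI0 : (0 : ℝ) < I.card := by exact_mod_cast hI.card_pos
  have hq0 : (0 : ℝ) < q := by exact_mod_cast Nat.pos_of_ne_zero (NeZero.ne q)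
  have hP0 : (0 : ℝ) < P := by exact_mod_cast (by omega : 0 < P)
  have hPm : (P : ℝ) ≤ 20 * (2 * m + 1) ^ 2 := by
    have : (P : ℝ) ≤ 80 * m ^ 2 := by exact_mod_cast hP'
    nlinarith [Nat.cast_nonneg (α := ℝ) m]
  set W : ℝ := (2 * m + 1) ^ 2 with hW
  have hW0 : 0 < W := by positivity
  clear_value W
  set Q : ℝ := I.card * q with hQ
  have hQ0 : 0 < Q := by positivity
  clear_value Q
  have h1 : (η * (Q * W * P ^ 2)) ^ 2 ≤
      Q * (P ^ 4 * W * (3 / (η ^ 3) ^ 2 * S + Q * (100 * η ^ 3 * W))) :=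
    (pow_le_pow_left₀ (by positivity) h 2).trans (hCS.trans (by gcongr))
  -- With ε = η ^ 3 the bad pairs contribute only a multiple of η ^ 3, absorbed by the left side.
  -- The factor ε ^ (-2) costs η ^ 6, and the ninth power of η covers the constants.
  have h2 : η ^ 2 * Q * W ≤ 3 / (η ^ 3) ^ 2 * S + Q * (100 * η ^ 3 * W) := by
    refine le_of_mul_le_mul_left (a := Q * W * P ^ 4) ?_ (by positivity)
    calc _ = (η * (Q * W * P ^ 2)) ^ 2 := by ring
      _ ≤ _ := h1
      _ = _ := by ring
  have h3 : η ^ 2 * Q * W / 2 ≤ 3 / (η ^ 3) ^ 2 * S := by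
    have : η ^ 2 * Q * W * (100 * η) ≤ η ^ 2 * Q * W * (1 / 2) :=
      mul_le_mul_of_nonneg_left (by linarith) (by positivity)
    linarith
  have h4 : η ^ 8 * Q * W / 6 ≤ S := by
    refine le_of_mul_le_mul_left (a := 3 / (η ^ 3) ^ 2) ?_ (by positivity)
    calc _ = η ^ 2 * Q * W / 2 := by field_simp; ring
      _ ≤ _ := h3
  refine le_trans ?_ h4
  calc η ^ 9 * (Q * P) ≤ η ^ 9 * (Q * (20 * W)) := by gcongr
    _ = η ^ 8 * Q * W * (20 * η) := by ring
    _ ≤ η ^ 8 * Q * W * (1 / 6) := by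
      refine mul_le_mul_of_nonneg_left (by linarith) (by positivity)
    _ = _ := by ring

/-! ### Degree lowering: the frequencies lie on major arcs -/

/-- The residue `μ` modulo `P`, divided by `P`, lies on a major arc. -/
def MajRes (Q : ℝ) (m : ℕ) {P : ℕ} (μ : ZMod P) : Prop := Maj Q m ((μ.val : ℝ) / P)

/-- On multiples of q a character modulo qP sees only its frequency modulo P; the phase becomes θ j²
with θ that residue divided by P. -/
theorem stdAddChar_mul_q {q P : ℕ} [NeZero q] [NeZero P] [NeZero (q * P)] (c : ZMod (q * P)) (j : ℤ) :
    ZMod.stdAddChar (c * ((q : ZMod (q * P)) * (j : ZMod (q * P)) ^ 2)) = e (((cofib q P c).val : ℝ) / P * j ^ 2) := by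
  have hq : (q : ℂ) ≠ 0 := Nat.cast_ne_zero.2 (NeZero.ne q)
  have hP : (P : ℂ) ≠ 0 := Nat.cast_ne_zero.2 (NeZero.ne P)
  have h1 : c * ((q : ZMod (q * P)) * (j : ZMod (q * P)) ^ 2) = ((c.val * (q * j ^ 2) : ℤ) : ZMod (q * P)) := by
    push_cast; rw [ZMod.natCast_zmod_val]
  have h2 : cofib q P c * (j : ZMod P) ^ 2 = ((c.val * j ^ 2 : ℤ) : ZMod P) := by
    push_cast
    congr 1
    conv_lhs => rw [← ZMod.natCast_zmod_val c, map_natCast]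
  have h3 : cofib q P c * (j : ZMod P) ^ 2 =
      (((cofib q P c).val * j ^ 2 : ℤ) : ZMod P) := by
    push_cast; rw [ZMod.natCast_zmod_val]
  have h4 : ZMod.stdAddChar (c * ((q : ZMod (q * P)) * (j : ZMod (q * P)) ^ 2)) =
      ZMod.stdAddChar (cofib q P c * (j : ZMod P) ^ 2) := by
    rw [h1, h2, ZMod.stdAddChar_coe, ZMod.stdAddChar_coe]
    congr 1
    push_cast
    field_simp
  rw [h4, h3, ZMod.stdAddChar_coe, e]
  congr 1
  push_cast
  field_simp

open Classical in
/-- The contribution of the phases away from the major arcs is negligible. -/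
theorem norm_sum_phase_le_sum {q P m : ℕ} [NeZero q] [NeZero P] [NeZero (q * P)] {η : ℝ} (hη : 0 < η)
    (hη1 : η ≤ 1 / 1024) (hm : 1 ≤ η ^ 100 * m) (u : ZMod q → ℂ) (hu : ∀ ρ, ‖u ρ‖ ≤ 1)
    (g₀ g₁ : ZMod (q * P) → ℂ) (h₀ : ∀ x, ‖g₀ x‖ ≤ 1) (h₁ : ∀ x, ‖g₁ x‖ ≤ 1)
    (χ : ZMod q → ZMod (q * P)) :
    ‖∑ j ∈ Icc 1 (m : ℤ), ∑ x, u (fib q P x) * g₀ (x - q * j ^ 2) * g₁ (x + j - q * j ^ 2) *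
      ZMod.stdAddChar (χ (fib q P x) * x)‖ ≤
      η * (q * P) * m +
        ∑ x, (if MajRes (η ^ 123)⁻¹ m (cofib q P (χ (fib q P x))) then ‖u (fib q P x)‖ *
          ‖∑ j ∈ Icc 1 (m : ℤ), g₁ (x + (j : ZMod (q * P))) *
            e (((cofib q P (χ (fib q P x))).val : ℝ) / P * j ^ 2)‖ else 0) := by
  set θ : ZMod (q * P) → ℝ := fun x => ((cofib q P (χ (fib q P x))).val : ℝ) / P with hθ
  set f : ZMod (q * P) → ℂ := fun x => u (fib q P x) * g₀ x *
    ZMod.stdAddChar (χ (fib q P x) * x) with hf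
  have hfu : ∀ x, ‖f x‖ ≤ ‖u (fib q P x)‖ := by
    intro x
    simp only [hf]
    rw [norm_mul, norm_stdAddChar, mul_one, norm_mul]
    exact mul_le_of_le_one_right (norm_nonneg _) (h₀ _)
  have hf1 : ∀ x, ‖f x‖ ≤ 1 := fun x => (hfu x).trans (hu _)
  have e1 : ∑ j ∈ Icc 1 (m : ℤ), ∑ x, u (fib q P x) * g₀ (x - q * j ^ 2) *
      g₁ (x + j - q * j ^ 2) * ZMod.stdAddChar (χ (fib q P x) * x) =
      ∑ x, ∑ j ∈ Icc 1 (m : ℤ), f x * g₁ (x + (j : ZMod (q * P))) * e (θ x * j ^ 2) := by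
    rw [sum_comm (s := univ)]
    refine sum_congr rfl fun j _ => ?_
    -- Adding q j² stays inside the fibre, so the weight and the frequency do not change and the
    -- character releases exactly the phase θ(x) j².
    rw [← sum_shift ((q : ZMod (q * P)) * (j : ZMod (q * P)) ^ 2)]
    refine sum_congr rfl fun x _ => ?_
    have a1 : fib q P (x + q * (j : ZMod (q * P)) ^ 2) = fib q P x := by simp
    have a2 : x + q * (j : ZMod (q * P)) ^ 2 + j - q * j ^ 2 = x + j := by ring
    rw [a1, a2, add_sub_cancel_right, mul_add, AddChar.map_add_eq_mul, stdAddChar_mul_q]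
    simp only [hf, hθ]
    ring
  rw [e1]
  set p : ZMod (q * P) → Prop := fun x => Maj (η ^ 123)⁻¹ m (θ x) with hp
  have hsplit : ∑ x, ∑ j ∈ Icc 1 (m : ℤ), f x * g₁ (x + (j : ZMod (q * P))) * e (θ x * j ^ 2) =
      ∑ x, ∑ j ∈ Icc 1 (m : ℤ), (if p x then 0 else f x) * g₁ (x + (j : ZMod (q * P))) *
        e (θ x * j ^ 2) +
      ∑ x, ∑ j ∈ Icc 1 (m : ℤ), (if p x then f x else 0) * g₁ (x + (j : ZMod (q * P))) *
        e (θ x * j ^ 2) := by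
    simp_rw [← sum_add_distrib]
    refine sum_congr rfl fun x _ => sum_congr rfl fun j _ => ?_
    split_ifs <;> ring
  rw [hsplit]
  refine (norm_add_le _ _).trans (add_le_add ?_ ?_)
  · have := norm_sum_quadratic_phase_le hη hη1 hm (fun x => if p x then 0 else f x) g₁
      (fun x => by
        split_ifs
        · simp
        · exact hf1 x) h₁ θ (fun x hx hM => hx (if_pos hM))
    refine this.trans (le_of_eq ?_)
    rw [ZMod.card]; push_cast; ring
  · refine (norm_sum_le _ _).trans (sum_le_sum fun x _ => ?_)
    simp_rw [mul_assoc]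
    rw [← mul_sum, norm_mul]
    by_cases hx : p x
    · have hx' : MajRes (η ^ 123)⁻¹ m (cofib q P (χ (fib q P x))) := hx
      rw [if_pos hx, if_pos hx']
      exact mul_le_mul_of_nonneg_right (hfu x) (norm_nonneg _)
    · have hx' : ¬ MajRes (η ^ 123)⁻¹ m (cofib q P (χ (fib q P x))) := hx
      rw [if_neg hx, if_neg hx', norm_zero, zero_mul]

open Classical in
-- On the major arcs the inner sum is bounded trivially by m, and each fibre contributes P points.
theorem norm_sum_phase_le {q P m : ℕ} [NeZero q] [NeZero P] [NeZero (q * P)] {η : ℝ} (hη : 0 < η)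
    (hη1 : η ≤ 1 / 1024) (hm : 1 ≤ η ^ 100 * m) (u : ZMod q → ℂ) (hu : ∀ ρ, ‖u ρ‖ ≤ 1)
    (g₀ g₁ : ZMod (q * P) → ℂ) (h₀ : ∀ x, ‖g₀ x‖ ≤ 1) (h₁ : ∀ x, ‖g₁ x‖ ≤ 1)
    (χ : ZMod q → ZMod (q * P)) :
    ‖∑ j ∈ Icc 1 (m : ℤ), ∑ x, u (fib q P x) * g₀ (x - q * j ^ 2) * g₁ (x + j - q * j ^ 2) *
      ZMod.stdAddChar (χ (fib q P x) * x)‖ ≤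
      η * (q * P) * m +
        m * P * ∑ ρ, (if MajRes (η ^ 123)⁻¹ m (cofib q P (χ ρ)) then ‖u ρ‖ else 0) := by
  refine (norm_sum_phase_le_sum hη hη1 hm u hu g₀ g₁ h₀ h₁ χ).trans (add_le_add le_rfl ?_)
  calc _ ≤ ∑ x, (if MajRes (η ^ 123)⁻¹ m (cofib q P (χ (fib q P x))) then
          m * ‖u (fib q P x)‖ else 0) := by
        refine sum_le_sum fun x _ => ?_
        split_ifs
        · rw [mul_comm (m : ℝ)]
          refine mul_le_mul_of_nonneg_left ((norm_sum_le _ _).trans ?_) (norm_nonneg _)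
          calc _ ≤ ∑ j ∈ Icc 1 (m : ℤ), (1 : ℝ) :=
                sum_le_sum fun j _ => norm_mul_le_one (h₁ _) (norm_e _).le
            _ = m := by rw [sum_const, card_Icc_one, nsmul_eq_mul, mul_one]
        · exact le_rfl
    _ = ∑ ρ, ∑ x with fib q P x = ρ, (if MajRes (η ^ 123)⁻¹ m (cofib q P (χ (fib q P x))) then
          m * ‖u (fib q P x)‖ else 0) := by rw [sum_fiberwise]
    _ = ∑ ρ, P * (if MajRes (η ^ 123)⁻¹ m (cofib q P (χ ρ)) then m * ‖u ρ‖ else 0) := by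
        refine sum_congr rfl fun ρ _ => ?_
        rw [sum_congr rfl (g := fun _ =>
          (if MajRes (η ^ 123)⁻¹ m (cofib q P (χ ρ)) then m * ‖u ρ‖ else 0)) fun x hx => by
          rw [(mem_filter.1 hx).2], sum_const, card_fibre, nsmul_eq_mul]
    _ = _ := by
        rw [mul_sum]
        refine sum_congr rfl fun ρ _ => ?_
        split_ifs <;> ring

/-- The dual function `∑ j, f₀(x - q j²) f₁(x + j - q j²)`. -/
noncomputable def dualSum {R : Type*} [CommRing R] (q : R) (m : ℕ) (f₀ f₁ : R → ℂ) (x : R) : ℂ :=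
  ∑ j ∈ Icc 1 (m : ℤ), f₀ (x - q * j ^ 2) * f₁ (x + j - q * j ^ 2)

/-- The box norm inequality with the fourfold correlations made explicit. -/
theorem norm_sum_pow_four_le_corr {ι α β : Type*} (S : Finset ι) (T : Finset α) (T' : Finset β)
    (A : ι → α → ℂ) (B : ι → β → ℂ) (W : ι → α → β → ℂ)
    (hA : ∀ s ∈ S, ∀ p ∈ T, ‖A s p‖ ≤ 1) (hB : ∀ s ∈ S, ∀ p ∈ T', ‖B s p‖ ≤ 1) :
    ‖∑ s ∈ S, ∑ p ∈ T, ∑ p' ∈ T', A s p * B s p' * W s p p'‖ ^ 4 ≤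
      (S.card : ℝ) ^ 3 * T.card ^ 2 * T'.card ^ 2 *
        ∑ p₁ ∈ T, ∑ p₂ ∈ T, ∑ p₁' ∈ T', ∑ p₂' ∈ T', ‖∑ s ∈ S,
          W s p₁ p₁' * conj (W s p₂ p₁') * conj (W s p₁ p₂') * W s p₂ p₂'‖ := by
  refine (norm_sum_pow_four_le_box S T T' A B W hA hB).trans
    (mul_le_mul_of_nonneg_left ?_ (by positivity))
  rw [sum_comm]
  refine sum_le_sum fun p₁ _ => ?_
  rw [sum_comm]
  refine sum_le_sum fun p₂ _ => ?_
  rw [sum_norm_sum_sq]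
  refine (norm_sum_le _ _).trans (sum_le_sum fun p₁' _ => (norm_sum_le _ _).trans
    (sum_le_sum fun p₂' _ => le_of_eq ?_))
  congr 1
  refine sum_congr rfl fun s _ => ?_
  rw [map_mul, Complex.conj_conj]
  ring

open Classical in
-- For fixed j, a product of four summands of dual functions has again the shape of a single
-- summand: the factors multiply, and the frequencies combine with the signs +, -, -, +. So
-- `norm_sum_phase_le` applies to the combination.
theorem norm_fourfold_corr_le {q P m : ℕ} [NeZero q] [NeZero P] [NeZero (q * P)] {η : ℝ}
    (hη : 0 < η) (hη1 : η ≤ 1 / 1024) (hm : 1 ≤ η ^ 100 * m) (s : Fin 4 → ZMod (q * P))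
    (w : Fin 4 → ZMod q → ℂ) (χ : Fin 4 → ZMod q → ZMod (q * P))
    (f₀ f₁ : Fin 4 → ZMod (q * P) → ℂ) (h₀ : ∀ i x, ‖f₀ i x‖ ≤ 1) (h₁ : ∀ i x, ‖f₁ i x‖ ≤ 1)
    (hw : ∀ i ρ, ‖w i ρ‖ ≤ 1) (G : Fin 4 → ℤ → ZMod (q * P) → ℂ)
    (hG : ∀ i j x, G i j x = w i (fib q P x) * (f₀ i (x + s i - q * j ^ 2) *
        f₁ i (x + s i + j - q * j ^ 2)) * ZMod.stdAddChar (χ i (fib q P x) * x)) :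
    ‖∑ j ∈ Icc 1 (m : ℤ), ∑ x, G 0 j x * conj (G 1 j x) * conj (G 2 j x) * G 3 j x‖ ≤
      η * (q * P) * m + m * P * ∑ ρ, (if MajRes (η ^ 123)⁻¹ m
        (cofib q P (χ 0 ρ - χ 1 ρ - χ 2 ρ + χ 3 ρ)) then ‖w 0 ρ‖ else 0) := by
  set u : ZMod q → ℂ := fun ρ => w 0 ρ * conj (w 1 ρ) * conj (w 2 ρ) * w 3 ρ with hu
  have hu1 : ∀ ρ, ‖u ρ‖ ≤ ‖w 0 ρ‖ := by
    intro ρ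
    simp only [hu]
    rw [mul_assoc, mul_assoc, norm_mul]
    exact mul_le_of_le_one_right (norm_nonneg _) (norm_mul_le_one (norm_conj_le_one (hw _ _))
      (norm_mul_le_one (norm_conj_le_one (hw _ _)) (hw _ _)))
  set g : (Fin 4 → ZMod (q * P) → ℂ) → ZMod (q * P) → ℂ := fun f x => f 0 (x + s 0) *
    conj (f 1 (x + s 1)) * conj (f 2 (x + s 2)) * f 3 (x + s 3) with hg
  have hg1 : ∀ f : Fin 4 → ZMod (q * P) → ℂ, (∀ i x, ‖f i x‖ ≤ 1) → ∀ x, ‖g f x‖ ≤ 1 :=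
    fun f hf x => norm_mul_le_one (norm_mul_le_one (norm_mul_le_one (hf _ _)
      (norm_conj_le_one (hf _ _))) (norm_conj_le_one (hf _ _))) (hf _ _)
  have := norm_sum_phase_le hη hη1 hm u (fun ρ => (hu1 ρ).trans (hw _ _)) (g f₀) (g f₁)
    (hg1 _ h₀) (hg1 _ h₁) (fun ρ => χ 0 ρ - χ 1 ρ - χ 2 ρ + χ 3 ρ)
  refine le_trans (le_of_eq ?_) (this.trans ?_)
  · congr 1
    refine sum_congr rfl fun j _ => sum_congr rfl fun x _ => ?_
    have a1 : ∀ t : ZMod (q * P), x - q * (j : ZMod (q * P)) ^ 2 + t = x + t - q * j ^ 2 := by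
      intros; ring
    have a2 : ∀ t : ZMod (q * P), x + j - q * (j : ZMod (q * P)) ^ 2 + t =
      x + t + j - q * j ^ 2 := by intros; ring
    have a3 : (χ 0 (fib q P x) - χ 1 (fib q P x) - χ 2 (fib q P x) + χ 3 (fib q P x)) * x =
        χ 0 (fib q P x) * x + -(χ 1 (fib q P x) * x) + -(χ 2 (fib q P x) * x) +
          χ 3 (fib q P x) * x := by ring
    rw [a3, AddChar.map_add_eq_mul, AddChar.map_add_eq_mul, AddChar.map_add_eq_mul]
    simp only [hu, hg, hG, a1, a2, map_mul (starRingEnd ℂ), conj_stdAddChar]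
    ring
  · refine add_le_add le_rfl (mul_le_mul_of_nonneg_left (sum_le_sum fun ρ _ => ?_)
      (by positivity))
    split_ifs
    · exact hu1 ρ
    · exact le_rfl

theorem pos_of_one_le_mul {m : ℕ} {x : ℝ} (h : 1 ≤ x * m) : (0 : ℝ) < m := by
  by_contra hcon
  have : (m : ℝ) = 0 := le_antisymm (not_lt.1 hcon) (Nat.cast_nonneg _)
  rw [this] at h
  norm_num at h

/-- Since 2η ≤ ζ ^ 4, the minor arc term is at most half of the lower bound. -/
theorem lower_bound_of_pow_four {ζ η t t' q P m X Z : ℝ} (hq : 0 < q) (hP : 0 < P) (hm : 0 < m)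
    (ht : 0 ≤ t) (ht' : 0 ≤ t') (hζ0 : 0 < ζ) (hζ : 2 * η ≤ ζ ^ 4) (hZ : 0 ≤ Z)
    (h : ζ * (t * t' * (q * P) * m) ≤ X)
    (h4 : X ^ 4 ≤ (m * (q * P)) ^ 3 * t ^ 2 * t' ^ 2 *
      (t ^ 2 * t' ^ 2 * (η * (q * P) * m) + m * P * Z)) :
    η * (t ^ 2 * t' ^ 2 * q) ≤ Z := by
  rcases ht.eq_or_lt with rfl | ht
  · simpa using hZ
  rcases ht'.eq_or_lt with rfl | ht'
  · simpa using hZ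
  have h5 : ζ ^ 4 * (t ^ 2 * t' ^ 2 * q) ≤ η * (t ^ 2 * t' ^ 2 * q) + Z := by
    refine le_of_mul_le_mul_left (a := m ^ 4 * q ^ 3 * P ^ 4 * (t ^ 2 * t' ^ 2)) ?_ (by positivity)
    calc _ = (ζ * (t * t' * (q * P) * m)) ^ 4 := by ring
      _ ≤ _ := (pow_le_pow_left₀ (by positivity) h 4).trans h4
      _ = _ := by ring
  have h6 : 2 * η * (t ^ 2 * t' ^ 2 * q) ≤ ζ ^ 4 * (t ^ 2 * t' ^ 2 * q) := by gcongr
  linarith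

open Classical in
/-- If the phases `χ p p'` correlate with box differences of a dual function, then their mixed
second differences often lie on major arcs. -/
theorem majRes_of_box {q P m : ℕ} [NeZero q] [NeZero P] [NeZero (q * P)] {η ζ : ℝ} (hη : 0 < η)
    (hη1 : η ≤ 1 / 1024) (hm : 1 ≤ η ^ 100 * m) (hζ : 2 * η ≤ ζ ^ 4) (hζ0 : 0 < ζ)
    {α β : Type*} (T : Finset α)
    (T' : Finset β) (a : α → ZMod (q * P)) (b : β → ZMod (q * P)) (A : ZMod (q * P) → α → ℂ)
    (B : ZMod (q * P) → β → ℂ) (w : α → β → ZMod q → ℂ) (χ : α → β → ZMod q → ZMod (q * P))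
    (f₀ f₁ : ZMod (q * P) → ℂ) (h₀ : ∀ x, ‖f₀ x‖ ≤ 1) (h₁ : ∀ x, ‖f₁ x‖ ≤ 1)
    (hA : ∀ x p, ‖A x p‖ ≤ 1) (hB : ∀ x p, ‖B x p‖ ≤ 1) (hw : ∀ p p' ρ, ‖w p p' ρ‖ ≤ 1)
    (h : ζ * (T.card * T'.card * (q * P) * m) ≤ ‖∑ x, ∑ p ∈ T, ∑ p' ∈ T', A x p * B x p' *
      (w p p' (fib q P x) * dualSum (q : ZMod (q * P)) m f₀ f₁ (x + (a p + b p')) *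
        ZMod.stdAddChar (χ p p' (fib q P x) * x))‖) :
    η * (T.card ^ 2 * T'.card ^ 2 * q) ≤ ∑ p₁ ∈ T, ∑ p₂ ∈ T, ∑ p₁' ∈ T', ∑ p₂' ∈ T', ∑ ρ,
      (if MajRes (η ^ 123)⁻¹ m (cofib q P (χ p₁ p₁' ρ - χ p₂ p₁' ρ - χ p₁ p₂' ρ + χ p₂ p₂' ρ))
        then ‖w p₁ p₁' ρ‖ else 0) := by
  have hm0 := pos_of_one_le_mul hm
  have hq0 : (0 : ℝ) < q := by exact_mod_cast Nat.pos_of_ne_zero (NeZero.ne q)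
  have hP0 : (0 : ℝ) < P := by exact_mod_cast Nat.pos_of_ne_zero (NeZero.ne P)
  -- The variable j of the dual function is moved to the outer sum. The box inequality is applied
  -- over pairs (j, x), so all four vertices share the same j.
  set V : α → β → ℤ → ZMod (q * P) → ℂ := fun p p' j x => w p p' (fib q P x) *
      (f₀ (x + (a p + b p') - q * j ^ 2) * f₁ (x + (a p + b p') + j - q * j ^ 2)) *
        ZMod.stdAddChar (χ p p' (fib q P x) * x) with hV
  have hbox := norm_sum_pow_four_le_corr (Icc 1 (m : ℤ) ×ˢ (univ : Finset (ZMod (q * P)))) T T'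
    (fun s p => A s.2 p) (fun s p' => B s.2 p') (fun s p p' => V p p' s.1 s.2) (fun _ _ _ _ => hA _ _)
    (fun _ _ _ _ => hB _ _)
  have e1 : ∑ x, ∑ p ∈ T, ∑ p' ∈ T', A x p * B x p' *
      (w p p' (fib q P x) * dualSum (q : ZMod (q * P)) m f₀ f₁ (x + (a p + b p')) *
        ZMod.stdAddChar (χ p p' (fib q P x) * x)) =
      ∑ s ∈ Icc 1 (m : ℤ) ×ˢ (univ : Finset (ZMod (q * P))), ∑ p ∈ T, ∑ p' ∈ T',
        A s.2 p * B s.2 p' * V p p' s.1 s.2 := by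
    rw [sum_product, sum_comm (s := Icc 1 (m : ℤ))]
    refine sum_congr rfl fun x _ => ?_
    rw [sum_comm (s := Icc 1 (m : ℤ))]
    refine sum_congr rfl fun p _ => ?_
    rw [sum_comm]
    refine sum_congr rfl fun p' _ => ?_
    rw [dualSum, mul_sum, sum_mul, mul_sum]
  rw [← e1, card_product, card_Icc_one, card_univ, ZMod.card] at hbox
  have hin : ∀ p₁ p₂ p₁' p₂', ‖∑ s ∈ Icc 1 (m : ℤ) ×ˢ (univ : Finset (ZMod (q * P))),
      V p₁ p₁' s.1 s.2 * conj (V p₂ p₁' s.1 s.2) * conj (V p₁ p₂' s.1 s.2) * V p₂ p₂' s.1 s.2‖ ≤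
      η * (q * P) * m + m * P * ∑ ρ, (if MajRes (η ^ 123)⁻¹ m
        (cofib q P (χ p₁ p₁' ρ - χ p₂ p₁' ρ - χ p₁ p₂' ρ + χ p₂ p₂' ρ))
        then ‖w p₁ p₁' ρ‖ else 0) := by
    intro p₁ p₂ p₁' p₂'
    rw [sum_product]
    exact norm_fourfold_corr_le hη hη1 hm ![a p₁ + b p₁', a p₂ + b p₁', a p₁ + b p₂', a p₂ + b p₂']
      ![w p₁ p₁', w p₂ p₁', w p₁ p₂', w p₂ p₂'] ![χ p₁ p₁', χ p₂ p₁', χ p₁ p₂', χ p₂ p₂']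
      (fun _ => f₀) (fun _ => f₁) (fun _ => h₀) (fun _ => h₁)
      (by intro i ρ; fin_cases i <;> exact hw _ _ _) ![V p₁ p₁', V p₂ p₁', V p₁ p₂', V p₂ p₂']
      (by intro i j x; fin_cases i <;> rfl)
  have hsum : ∀ D : α → α → β → β → ℝ, ∑ p₁ ∈ T, ∑ p₂ ∈ T, ∑ p₁' ∈ T', ∑ p₂' ∈ T',
      (η * (q * P) * m + m * P * D p₁ p₂ p₁' p₂') = (T.card ^ 2 * T'.card ^ 2) *
        (η * (q * P) * m) + m * P * ∑ p₁ ∈ T, ∑ p₂ ∈ T, ∑ p₁' ∈ T', ∑ p₂' ∈ T',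
          D p₁ p₂ p₁' p₂' := by
    intro D
    simp_rw [sum_add_distrib, ← mul_sum, sum_const, nsmul_eq_mul]
    ring
  have hfin := hbox.trans (mul_le_mul_of_nonneg_left ((sum_le_sum fun p₁ _ => sum_le_sum fun p₂ _ =>
    sum_le_sum fun p₁' _ => sum_le_sum fun p₂' _ => hin p₁ p₂ p₁' p₂').trans
      (le_of_eq (hsum _))) (by positivity))
  push_cast at hfin
  refine lower_bound_of_pow_four hq0 hP0 hm0 (Nat.cast_nonneg _) (Nat.cast_nonneg _) hζ0 hζ ?_ h hfin
  refine sum_nonneg fun _ _ => sum_nonneg fun _ _ => sum_nonneg fun _ _ =>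
    sum_nonneg fun _ _ => sum_nonneg fun _ _ => ?_
  split_ifs
  · exact norm_nonneg _
  · exact le_rfl

open Classical in
/-- If the phases `χ p` correlate with differences of a dual function, then their differences often
lie on major arcs. -/
theorem majRes_of_line {q P m : ℕ} [NeZero q] [NeZero P] [NeZero (q * P)] {η ζ : ℝ} (hη : 0 < η)
    (hη1 : η ≤ 1 / 1024) (hm : 1 ≤ η ^ 100 * m) (hζ : 2 * η ≤ ζ ^ 2) (hζ0 : 0 < ζ)
    {α : Type*} (T : Finset α) (a : α → ZMod (q * P)) (A : ZMod (q * P) → ℂ)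
    (w : α → ZMod q → ℂ) (χ : α → ZMod q → ZMod (q * P))
    (f₀ f₁ : ZMod (q * P) → ℂ) (h₀ : ∀ x, ‖f₀ x‖ ≤ 1) (h₁ : ∀ x, ‖f₁ x‖ ≤ 1)
    (hA : ∀ x, ‖A x‖ ≤ 1) (hw : ∀ p ρ, ‖w p ρ‖ ≤ 1)
    (h : ζ * (T.card * (q * P) * m) ≤ ‖∑ x, ∑ p ∈ T, A x *
      (w p (fib q P x) * dualSum (q : ZMod (q * P)) m f₀ f₁ (x + a p) *
        ZMod.stdAddChar (χ p (fib q P x) * x))‖) :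
    η * (T.card ^ 2 * q) ≤ ∑ p₁ ∈ T, ∑ p₂ ∈ T, ∑ ρ,
      (if MajRes (η ^ 123)⁻¹ m (cofib q P (χ p₁ ρ - χ p₂ ρ)) then ‖w p₁ ρ‖ else 0) := by
  have hm0 := pos_of_one_le_mul hm
  have hq0 : (0 : ℝ) < q := by exact_mod_cast Nat.pos_of_ne_zero (NeZero.ne q)
  have hP0 : (0 : ℝ) < P := by exact_mod_cast Nat.pos_of_ne_zero (NeZero.ne P)
  set V : α → ℤ → ZMod (q * P) → ℂ := fun p j x => w p (fib q P x) *
      (f₀ (x + a p - q * j ^ 2) * f₁ (x + a p + j - q * j ^ 2)) *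
        ZMod.stdAddChar (χ p (fib q P x) * x) with hV
  have hCS := norm_sum_sq_le_doubled (Icc 1 (m : ℤ) ×ˢ (univ : Finset (ZMod (q * P)))) T
    (fun s => A s.2) (fun s p => V p s.1 s.2) (fun _ _ => hA _)
  have e1 : ∑ x, ∑ p ∈ T, A x *
      (w p (fib q P x) * dualSum (q : ZMod (q * P)) m f₀ f₁ (x + a p) *
        ZMod.stdAddChar (χ p (fib q P x) * x)) =
      ∑ s ∈ Icc 1 (m : ℤ) ×ˢ (univ : Finset (ZMod (q * P))), A s.2 * ∑ p ∈ T, V p s.1 s.2 := by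
    rw [sum_product, sum_comm (s := Icc 1 (m : ℤ))]
    refine sum_congr rfl fun x _ => ?_
    simp_rw [← mul_sum]
    rw [sum_comm]
    congr 1
    refine sum_congr rfl fun p _ => ?_
    rw [dualSum, mul_sum, sum_mul]
  rw [← e1, card_product, card_Icc_one, card_univ, ZMod.card] at hCS
  have hin : ∀ p₁ p₂, ‖∑ s ∈ Icc 1 (m : ℤ) ×ˢ (univ : Finset (ZMod (q * P))),
      V p₁ s.1 s.2 * conj (V p₂ s.1 s.2)‖ ≤
      η * (q * P) * m + m * P * ∑ ρ, (if MajRes (η ^ 123)⁻¹ m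
        (cofib q P (χ p₁ ρ - χ p₂ ρ)) then ‖w p₁ ρ‖ else 0) := by
    intro p₁ p₂
    rw [sum_product]
    -- The twofold product is padded with constant functions 1 and zero frequencies.
    have := norm_fourfold_corr_le hη hη1 hm ![a p₁, a p₂, 0, 0]
      ![w p₁, w p₂, fun _ => 1, fun _ => 1] ![χ p₁, χ p₂, fun _ => 0, fun _ => 0]
      ![f₀, f₀, fun _ => 1, fun _ => 1] ![f₁, f₁, fun _ => 1, fun _ => 1]
      (by intro i x; fin_cases i <;> simp [h₀]) (by intro i x; fin_cases i <;> simp [h₁])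
      (by intro i ρ; fin_cases i <;> simp [hw]) ![V p₁, V p₂, fun _ _ => 1, fun _ _ => 1]
      (by intro i j x; fin_cases i <;> simp [hV])
    simpa using this
  have hsum : ∀ D : α → α → ℝ, ∑ p₁ ∈ T, ∑ p₂ ∈ T, (η * (q * P) * m + m * P * D p₁ p₂) =
      T.card ^ 2 * (η * (q * P) * m) + m * P * ∑ p₁ ∈ T, ∑ p₂ ∈ T, D p₁ p₂ := by
    intro D
    simp_rw [sum_add_distrib, ← mul_sum, sum_const, nsmul_eq_mul]
    ring
  have hfin := hCS.trans (mul_le_mul_of_nonneg_left (((norm_sum_le _ _).trans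
    (sum_le_sum fun p₁ _ => (norm_sum_le _ _).trans (sum_le_sum fun p₂ _ => hin p₁ p₂))).trans
      (le_of_eq (hsum _))) (by positivity))
  push_cast at hfin
  set Z := ∑ p₁ ∈ T, ∑ p₂ ∈ T, ∑ ρ,
      (if MajRes (η ^ 123)⁻¹ m (cofib q P (χ p₁ ρ - χ p₂ ρ)) then ‖w p₁ ρ‖ else 0) with hZ
  set t : ℝ := (T.card : ℝ)
  have h5 : ζ ^ 2 * (t ^ 2 * q) ≤ η * (t ^ 2 * q) + Z := by
    refine le_of_mul_le_mul_left (a := m ^ 2 * q * (P : ℝ) ^ 2) ?_ (by positivity)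
    calc _ = (ζ * (t * (q * P) * m)) ^ 2 := by ring
      _ ≤ _ := (pow_le_pow_left₀ (by positivity) h 2).trans hfin
      _ = _ := by ring
  have h6 : 2 * η * (t ^ 2 * q) ≤ ζ ^ 2 * (t ^ 2 * q) := by gcongr
  linarith

/-! ### Degree lowering: splitting the frequencies -/

open Classical in
-- A major residue μ is determined by its denominator d, the nearest integer n to dμ/P, and r = dμ -
-- nP. Here d and n are O(Q), and |r| ≤ PQ/m² ≤ 80Q because P ≤ 80m².
theorem card_majRes_le {P m : ℕ} [NeZero P] (hm : 1 ≤ m) (hP' : P ≤ 80 * m ^ 2) {Q : ℝ}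
    (hQ : 1 ≤ Q) : (#{μ : ZMod P | MajRes Q m μ} : ℝ) ≤ 2 ^ 10 * Q ^ 3 := by
  set B := ⌊Q⌋₊ with hB
  have hBQ : (B : ℝ) ≤ Q := Nat.floor_le (by linarith)
  have hQB : Q < B + 1 := Nat.lt_floor_add_one Q
  have hP0 : (0 : ℝ) < P := by exact_mod_cast Nat.pos_of_ne_zero (NeZero.ne P)
  have hm0 : (0 : ℝ) < m := by exact_mod_cast hm
  have key : ∀ μ : ZMod P, ∃ x : ℕ × ℤ × ℤ, MajRes Q m μ →
      x ∈ Icc 1 B ×ˢ Icc 0 (B + 1 : ℤ) ×ˢ Icc (-(80 * B + 80) : ℤ) (80 * B + 80) ∧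
      (x.1 * μ.val : ℤ) = x.2.2 + x.2.1 * P := by
    intro μ
    by_cases h : MajRes Q m μ
    · obtain ⟨d, hd, hdQ, hdist⟩ := h
      set n := round (d * ((μ.val : ℝ) / P)) with hn
      refine ⟨(d, n, d * μ.val - n * P), fun _ => ⟨?_, by push_cast; ring⟩⟩
      have hdB : d ≤ B := Nat.le_floor hdQ
      have hθ0 : 0 ≤ (μ.val : ℝ) / P := by positivity
      have hθ1 : (μ.val : ℝ) / P ≤ 1 := by
        rw [div_le_one hP0]; exact_mod_cast (ZMod.val_lt μ).le
      have hr := abs_le.1 (abs_sub_round (d * ((μ.val : ℝ) / P)))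
      have hd0 : (0 : ℝ) ≤ d := Nat.cast_nonneg _
      have hdB' : (d : ℝ) ≤ B := by exact_mod_cast hdB
      rw [distInt] at hdist
      rw [← hn] at hr hdist
      simp only [mem_product, mem_Icc]
      refine ⟨⟨hd, hdB⟩, ⟨?_, ?_⟩, ?_⟩
      · have : (-1 : ℝ) < n := by nlinarith [mul_nonneg hd0 hθ0]
        have : (-1 : ℤ) < n := by exact_mod_cast this
        omega
      · have : (n : ℝ) ≤ B + 1 := by nlinarith
        exact_mod_cast this
      · rw [← abs_le]
        have h1 : |(d * μ.val - n * P : ℝ)| = P * |d * ((μ.val : ℝ) / P) - n| := by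
          rw [← abs_of_pos hP0, ← abs_mul, abs_of_pos hP0]
          congr 1
          field_simp
        have h2 : |(d * μ.val - n * P : ℝ)| ≤ 80 * B + 80 := by
          rw [h1]
          calc (P : ℝ) * |d * ((μ.val : ℝ) / P) - n| ≤ 80 * m ^ 2 * (Q / m ^ 2) := by
                refine mul_le_mul ?_ hdist (abs_nonneg _) (by positivity)
                exact_mod_cast hP'
            _ = 80 * Q := by field_simp
            _ ≤ _ := by linarith
        exact_mod_cast h2
    · exact ⟨(0, 0, 0), fun h' => absurd h' h⟩
  choose φ hφ using key
  have hcard := card_le_card_of_injOn (s := {μ : ZMod P | MajRes Q m μ}) φ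
    (t := Icc 1 B ×ˢ Icc 0 (B + 1 : ℤ) ×ˢ Icc (-(80 * B + 80) : ℤ) (80 * B + 80))
    (fun μ hμ => (hφ μ (mem_filter.1 hμ).2).1) (by
      intro μ hμ μ' hμ' heq
      obtain ⟨h1, h2⟩ := hφ μ (mem_filter.1 hμ).2
      obtain ⟨h1', h2'⟩ := hφ μ' (mem_filter.1 hμ').2
      have hd := (mem_Icc.1 (mem_product.1 h1').1).1
      rw [heq, ← h2'] at h2
      have hd' : ((φ μ').1 : ℤ) ≠ 0 := by omega
      have := mul_left_cancel₀ hd' h2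
      exact ZMod.val_injective P (by exact_mod_cast this))
  rw [card_product, card_product, Nat.card_Icc, Int.card_Icc, Int.card_Icc] at hcard
  have e1 : (B + 1 + 1 - 0 : ℤ).toNat = B + 2 := by omega
  have e2 : (80 * B + 80 + 1 - -(80 * B + 80) : ℤ).toNat = 160 * B + 161 := by omega
  rw [e1, e2, Nat.add_sub_cancel] at hcard
  have h1 : (#{μ : ZMod P | MajRes Q m μ} : ℝ) ≤ B * ((B + 2) * (160 * B + 161)) := by
    exact_mod_cast hcard
  refine h1.trans ?_
  calc (B : ℝ) * ((B + 2) * (160 * B + 161)) ≤ Q * ((3 * Q) * (321 * Q)) := by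
        gcongr <;> linarith
    _ ≤ _ := by nlinarith [pow_pos (by linarith : (0 : ℝ) < Q) 3]

open Classical in
/-- Pigeonholing: if the mixed second differences of `χ` often lie in a small set, then `χ` often
splits as a sum. -/
theorem exists_split_of_box {q P : ℕ} [NeZero q] [NeZero P] [NeZero (q * P)] {η κ : ℝ} (hη : 0 < η)
    (hκ : 0 < κ) {α β : Type*} (T : Finset α) (T' : Finset β) (w : α → β → ZMod q → ℝ)
    (hw : ∀ p p' ρ, 0 ≤ w p p' ρ) (χ : α → β → ZMod q → ZMod (q * P)) (M : ZMod P → Prop)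
    (hM : (#{μ | M μ} : ℝ) ≤ κ)
    (h : η * (T.card ^ 2 * T'.card ^ 2 * q) ≤ ∑ p₁ ∈ T, ∑ p₂ ∈ T, ∑ p₁' ∈ T', ∑ p₂' ∈ T', ∑ ρ,
      (if M (cofib q P (χ p₁ p₁' ρ - χ p₂ p₁' ρ - χ p₁ p₂' ρ + χ p₂ p₂' ρ))
        then w p₁ p₁' ρ else 0)) :
    ∃ (χ₁ : α → ZMod q → ZMod (q * P)) (χ₂ : β → ZMod q → ZMod (q * P)),
      η / (2 * κ) * (T.card * T'.card * q) ≤ ∑ p ∈ T, ∑ p' ∈ T', ∑ ρ,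
        (if cofib q P (χ p p' ρ) = cofib q P (χ₁ p ρ + χ₂ p' ρ) then w p p' ρ else 0) := by
  by_contra! hcon
  have hq0 : (0 : ℝ) < q := by exact_mod_cast Nat.pos_of_ne_zero (NeZero.ne q)
  have hpos : 0 < η / (2 * κ) * (T.card * T'.card * q) :=
    (sum_nonneg fun p _ => sum_nonneg fun p' _ => sum_nonneg fun ρ _ => by
      split_ifs
      · exact hw _ _ _
      · exact le_rfl).trans_lt (hcon 0 0)
  set t : ℝ := (T.card : ℝ)
  set t' : ℝ := (T'.card : ℝ)
  have ht : 0 < t * t' := by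
    by_contra hneg
    have : t * t' = 0 := le_antisymm (not_lt.1 hneg) (by positivity)
    rw [this] at hpos; simp at hpos
  have hbound : ∀ p₂ p₂' μ, ∑ p₁ ∈ T, ∑ p₁' ∈ T', ∑ ρ,
      (if cofib q P (χ p₁ p₁' ρ - χ p₂ p₁' ρ - χ p₁ p₂' ρ + χ p₂ p₂' ρ) = μ
        then w p₁ p₁' ρ else 0) ≤ η / (2 * κ) * (t * t' * q) := by
    intro p₂ p₂' μ
    -- For fixed p₂, p₂' and μ the splitting is χ₁(p) = χ(p, p₂') + μ and χ₂(p') = χ(p₂, p') - χ(p₂,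
    -- p₂'); if it failed for all choices, summing over the at most κ values of μ would contradict
    -- `h`.
    refine le_trans (le_of_eq ?_) (hcon (fun p ρ => χ p p₂' ρ + (μ.val : ZMod (q * P)))
      (fun p' ρ => χ p₂ p' ρ - χ p₂ p₂' ρ)).le
    refine sum_congr rfl fun p₁ _ => sum_congr rfl fun p₁' _ => sum_congr rfl fun ρ _ => ?_
    congr 1
    simp only [map_add, map_sub, map_natCast, ZMod.natCast_zmod_val, eq_iff_iff]
    constructor
    · rintro rfl; ring
    · intro h; rw [h]; ring
  have h2 : ∑ p₁ ∈ T, ∑ p₂ ∈ T, ∑ p₁' ∈ T', ∑ p₂' ∈ T', ∑ ρ,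
      (if M (cofib q P (χ p₁ p₁' ρ - χ p₂ p₁' ρ - χ p₁ p₂' ρ + χ p₂ p₂' ρ))
        then w p₁ p₁' ρ else 0) = ∑ p₂ ∈ T, ∑ p₂' ∈ T', ∑ μ with M μ, ∑ p₁ ∈ T, ∑ p₁' ∈ T', ∑ ρ,
      (if cofib q P (χ p₁ p₁' ρ - χ p₂ p₁' ρ - χ p₁ p₂' ρ + χ p₂ p₂' ρ) = μ
        then w p₁ p₁' ρ else 0) := by
    rw [sum_comm]
    refine sum_congr rfl fun p₂ _ => ?_
    have hx : ∀ p₁ p₁' p₂' ρ, (if M (cofib q P (χ p₁ p₁' ρ - χ p₂ p₁' ρ - χ p₁ p₂' ρ +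
        χ p₂ p₂' ρ)) then w p₁ p₁' ρ else 0) = ∑ μ with M μ, (if cofib q P (χ p₁ p₁' ρ -
          χ p₂ p₁' ρ - χ p₁ p₂' ρ + χ p₂ p₂' ρ) = μ then w p₁ p₁' ρ else 0) := by
      intros
      rw [sum_ite_eq]
      simp
    simp_rw [hx]
    rw [sum_congr rfl fun p₁ _ => sum_comm, sum_comm]
    refine sum_congr rfl fun p₂' _ => ?_
    rw [sum_comm (s := ({μ | M μ} : Finset (ZMod P)))]
    refine sum_congr rfl fun p₁ _ => ?_
    rw [sum_comm (s := ({μ | M μ} : Finset (ZMod P)))]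
    refine sum_congr rfl fun p₁' _ => ?_
    rw [sum_comm (s := ({μ | M μ} : Finset (ZMod P)))]
  rw [h2] at h
  have h3 := h.trans (sum_le_sum fun p₂ _ => sum_le_sum fun p₂' _ => sum_le_sum fun μ _ =>
    hbound p₂ p₂' μ)
  simp only [sum_const, nsmul_eq_mul] at h3
  have h4 : t * (t' * ((#{μ | M μ} : ℝ) * (η / (2 * κ) * (t * t' * q)))) ≤
      t * (t' * (κ * (η / (2 * κ) * (t * t' * q)))) := by gcongr
  have h5 : t * (t' * (κ * (η / (2 * κ) * (t * t' * q)))) = η / 2 * (t * t') ^ 2 * q := by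
    field_simp
  have h6 : 0 < η * (t * t') ^ 2 * q := by positivity
  have h7 : η * (t ^ 2 * t' ^ 2 * q) = η * (t * t') ^ 2 * q := by ring
  linarith

open Classical in
-- For some p₂ and μ, the frequency χ(p₂) + μ agrees modulo P with χ(p) for many p.
theorem exists_split_of_line {q P : ℕ} [NeZero q] [NeZero P] [NeZero (q * P)] {η κ : ℝ} (hη : 0 < η)
    (hκ : 0 < κ) {α : Type*} (T : Finset α) (w : α → ZMod q → ℝ)
    (hw : ∀ p ρ, 0 ≤ w p ρ) (χ : α → ZMod q → ZMod (q * P)) (M : ZMod P → Prop)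
    (hM : (#{μ | M μ} : ℝ) ≤ κ)
    (h : η * (T.card ^ 2 * q) ≤ ∑ p₁ ∈ T, ∑ p₂ ∈ T, ∑ ρ,
      (if M (cofib q P (χ p₁ ρ - χ p₂ ρ)) then w p₁ ρ else 0)) :
    ∃ χ₁ : ZMod q → ZMod (q * P), η / (2 * κ) * (T.card * q) ≤ ∑ p ∈ T, ∑ ρ,
        (if cofib q P (χ p ρ) = cofib q P (χ₁ ρ) then w p ρ else 0) := by
  by_contra! hcon
  have hq0 : (0 : ℝ) < q := by exact_mod_cast Nat.pos_of_ne_zero (NeZero.ne q)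
  have hpos : 0 < η / (2 * κ) * (T.card * q) :=
    (sum_nonneg fun p _ => sum_nonneg fun ρ _ => by
      split_ifs
      · exact hw _ _
      · exact le_rfl).trans_lt (hcon 0)
  set t : ℝ := (T.card : ℝ)
  have ht : 0 < t := by
    by_contra hneg
    have : t = 0 := le_antisymm (not_lt.1 hneg) (by positivity)
    rw [this] at hpos; simp at hpos
  have hbound : ∀ p₂ μ, ∑ p₁ ∈ T, ∑ ρ,
      (if cofib q P (χ p₁ ρ - χ p₂ ρ) = μ then w p₁ ρ else 0) ≤ η / (2 * κ) * (t * q) := by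
    intro p₂ μ
    refine le_trans (le_of_eq ?_) (hcon (fun ρ => χ p₂ ρ + (μ.val : ZMod (q * P)))).le
    refine sum_congr rfl fun p₁ _ => sum_congr rfl fun ρ _ => ?_
    congr 1
    simp only [map_add, map_sub, map_natCast, ZMod.natCast_zmod_val, eq_iff_iff]
    constructor
    · rintro rfl; ring
    · intro h; rw [h]; ring
  have h2 : ∑ p₁ ∈ T, ∑ p₂ ∈ T, ∑ ρ,
      (if M (cofib q P (χ p₁ ρ - χ p₂ ρ)) then w p₁ ρ else 0) =
      ∑ p₂ ∈ T, ∑ μ with M μ, ∑ p₁ ∈ T, ∑ ρ,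
      (if cofib q P (χ p₁ ρ - χ p₂ ρ) = μ then w p₁ ρ else 0) := by
    rw [sum_comm]
    refine sum_congr rfl fun p₂ _ => ?_
    have hx : ∀ p₁ ρ, (if M (cofib q P (χ p₁ ρ - χ p₂ ρ)) then w p₁ ρ else 0) =
        ∑ μ with M μ, (if cofib q P (χ p₁ ρ - χ p₂ ρ) = μ then w p₁ ρ else 0) := by
      intros
      rw [sum_ite_eq]
      simp
    simp_rw [hx]
    rw [sum_comm (s := ({μ | M μ} : Finset (ZMod P)))]
    refine sum_congr rfl fun p₁ _ => ?_
    rw [sum_comm (s := ({μ | M μ} : Finset (ZMod P)))]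
  rw [h2] at h
  have h3 := h.trans (sum_le_sum fun p₂ _ => sum_le_sum fun μ _ => hbound p₂ μ)
  simp only [sum_const, nsmul_eq_mul] at h3
  have h4 : t * ((#{μ | M μ} : ℝ) * (η / (2 * κ) * (t * q))) ≤
      t * (κ * (η / (2 * κ) * (t * q))) := by gcongr
  have h5 : t * (κ * (η / (2 * κ) * (t * q))) = η / 2 * t ^ 2 * q := by
    field_simp
  have h6 : 0 < η * t ^ 2 * q := by positivity
  linarith

/-! ### Degree lowering: removing split frequencies -/

/-- With y a fixed point of the fibre, (c - c')(x - y) = 0, so the two sums differ by the constant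
factor of modulus one attached to (c - c')y. -/
theorem norm_fibre_sum_congr {q P : ℕ} [NeZero (q * P)] (G : ZMod (q * P) → ℂ) (ρ : ZMod q)
    {c c' : ZMod (q * P)} (h : cofib q P c = cofib q P c') :
    ‖∑ x with fib q P x = ρ, G x * ZMod.stdAddChar (c * x)‖ =
      ‖∑ x with fib q P x = ρ, G x * ZMod.stdAddChar (c' * x)‖ := by
  obtain ⟨y, hy⟩ := ZMod.castHom_surjective (dvd_mul_right q P) ρ
  have hy : fib q P y = ρ := hy
  have h1 : ∑ x with fib q P x = ρ, G x * ZMod.stdAddChar (c * x) =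
      (∑ x with fib q P x = ρ, G x * ZMod.stdAddChar (c' * x)) *
        ZMod.stdAddChar ((c - c') * y) := by
    rw [sum_mul]
    refine sum_congr rfl fun x hx => ?_
    have h2 : (c - c') * (x - y) = 0 :=
      mul_eq_zero_of_cofib_of_fib (by rw [map_sub, h, sub_self])
        (by rw [map_sub, hy, (mem_filter.1 hx).2, sub_self])
    have h3 : c * x = c' * x + (c - c') * y := by linear_combination h2
    rw [h3, AddChar.map_add_eq_mul, mul_assoc]
  rw [h1, norm_mul, norm_stdAddChar, mul_one]

theorem sum_norm_fibre_sq_eq_energy {q P : ℕ} [NeZero q] [NeZero (q * P)] (G : ZMod (q * P) → ℂ)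
    (χ : ZMod q → ZMod (q * P)) :
    ∑ ρ, ‖∑ x with fib q P x = ρ, G x * ZMod.stdAddChar (χ ρ * x)‖ ^ 2 =
      energy q P (fun x => G x * ZMod.stdAddChar (χ (fib q P x) * x)) := by
  refine sum_congr rfl fun ρ _ => ?_
  congr 2
  exact sum_congr rfl fun x hx => by simp only [(mem_filter.1 hx).2]

theorem norm_sum_eq_energy {q P : ℕ} [NeZero q] [NeZero (q * P)] (C : ZMod (q * P) → ℂ) :
    ‖∑ n with fib q P n = 0, ∑ v, conj (C v) * C (v + n)‖ = energy q P C := by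
  rw [← energy_eq, Complex.norm_real, Real.norm_of_nonneg (energy_nonneg _)]

/-- In the expansion over pairs (v, v + l) of a fibre, the character leaves the phases χ₁(p)·l and
χ₂(p')·l, the frequencies being taken at the fibre of v. Each involves only one of p, p', so the box
inequality removes them with every vertex except a(p) + b(p'). What survives is an energy along
differences of directions, and averaging selects the base points. -/
theorem exists_energy_of_box {q P : ℕ} [NeZero q] [NeZero (q * P)] {ζ : ℝ} (hζ : 0 ≤ ζ)
    {α β : Type*} {T : Finset α} {T' : Finset β} (hT : T.Nonempty) (hT' : T'.Nonempty)
    (a : α → ZMod (q * P)) (b : β → ZMod (q * P)) (ha : ∀ p, fib q P (a p) = 0)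
    (hb : ∀ p, fib q P (b p) = 0) (F : ZMod (q * P) → ℂ) (hF : ∀ x, ‖F x‖ ≤ 1)
    (χ₁ : α → ZMod q → ZMod (q * P)) (χ₂ : β → ZMod q → ZMod (q * P))
    (h : ζ * (T.card * T'.card * (q * P ^ 2)) ≤ ∑ p ∈ T, ∑ p' ∈ T', ∑ ρ,
      ‖∑ x with fib q P x = ρ, dlt (a p) (dlt (b p') F) x *
        ZMod.stdAddChar ((χ₁ p ρ + χ₂ p' ρ) * x)‖ ^ 2) :
    ∃ p₀ p₀', ζ ^ 4 * (T.card * T'.card * (q * P ^ 2)) ≤ ∑ p ∈ T, ∑ p' ∈ T',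
      energy q P (dlt (a p - a p₀) (dlt (b p' - b p₀') F)) := by
  set X := ∑ p ∈ T, ∑ p' ∈ T', ∑ ρ,
      ‖∑ x with fib q P x = ρ, dlt (a p) (dlt (b p') F) x *
        ZMod.stdAddChar ((χ₁ p ρ + χ₂ p' ρ) * x)‖ ^ 2 with hX
  set Ker : Finset (ZMod (q * P)) := {n | fib q P n = 0} with hKer
  set H : ZMod (q * P) → ZMod (q * P) → ℂ := fun l v => conj (F v) * F (v + l) with hH
  have hH1 : ∀ l v, ‖H l v‖ ≤ 1 := fun l v => norm_mul_le_one (norm_conj_le_one (hF _)) (hF _)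
  have e1 : (X : ℂ) = ∑ s ∈ Ker ×ˢ (univ : Finset (ZMod (q * P))), ∑ p ∈ T, ∑ p' ∈ T',
      (H s.1 s.2 * conj (H s.1 (s.2 + a p)) * ZMod.stdAddChar (χ₁ p (fib q P s.2) * s.1)) *
      (conj (H s.1 (s.2 + b p')) * ZMod.stdAddChar (χ₂ p' (fib q P s.2) * s.1)) *
      H s.1 (s.2 + (a p + b p')) := by
    rw [hX]
    simp only [fun p p' => sum_norm_fibre_sq_eq_energy (dlt (a p) (dlt (b p') F))
      (fun ρ => χ₁ p ρ + χ₂ p' ρ)]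
    push_cast
    simp_rw [energy_eq]
    rw [sum_comm (s := Ker ×ˢ univ)]
    refine sum_congr rfl fun p _ => ?_
    rw [sum_comm (s := Ker ×ˢ univ)]
    refine sum_congr rfl fun p' _ => ?_
    rw [sum_product]
    refine sum_congr rfl fun l hl => sum_congr rfl fun v _ => ?_
    have hl : fib q P l = 0 := (mem_filter.1 hl).2
    have a1 : ∀ c c' : ZMod (q * P), (c + c') * (v + l) = (c + c') * v + (c * l + c' * l) := by
      intros; ring
    have a2 : ∀ c : ZMod (q * P), ZMod.stdAddChar (-(c * v)) * ZMod.stdAddChar (c * v) = (1 : ℂ) := by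
      intro c; rw [← AddChar.map_add_eq_mul, neg_add_cancel, AddChar.map_zero_eq_one]
    rw [map_add, hl, add_zero, a1, AddChar.map_add_eq_mul, AddChar.map_add_eq_mul,
      map_mul (starRingEnd ℂ), conj_stdAddChar]
    have a3 : ∀ u, v + l + u = v + u + l := fun u => add_right_comm v l u
    have a4 : v + a p + b p' = v + (a p + b p') := add_assoc _ _ _
    have a5 : v + a p + l + b p' = v + (a p + b p') + l := by ring
    simp only [dlt, hH, map_mul, Complex.conj_conj, a3, a4, a5]
    linear_combination (conj (F v) * F (v + b p') * (F (v + a p) * conj (F (v + (a p + b p')))) *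
      (F (v + l) * conj (F (v + b p' + l)) * (conj (F (v + a p + l)) *
      F (v + (a p + b p') + l)))) * (ZMod.stdAddChar (χ₁ p (fib q P v) * l) *
      ZMod.stdAddChar (χ₂ p' (fib q P v) * l)) * a2 (χ₁ p (fib q P v) + χ₂ p' (fib q P v))
  have hbox := norm_sum_pow_four_le_corr (Ker ×ˢ (univ : Finset (ZMod (q * P)))) T T'
    (fun s p => H s.1 s.2 * conj (H s.1 (s.2 + a p)) *
      ZMod.stdAddChar (χ₁ p (fib q P s.2) * s.1))
    (fun s p' => conj (H s.1 (s.2 + b p')) * ZMod.stdAddChar (χ₂ p' (fib q P s.2) * s.1))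
    (fun s p p' => H s.1 (s.2 + (a p + b p')))
    (fun s _ p _ => norm_mul_le_one (norm_mul_le_one (hH1 _ _) (norm_conj_le_one (hH1 _ _)))
      (norm_stdAddChar _).le)
    (fun s _ p _ => norm_mul_le_one (norm_conj_le_one (hH1 _ _)) (norm_stdAddChar _).le)
  have hX0 : 0 ≤ X := by positivity
  have hin : ∀ p₁ p₂ p₁' p₂', ‖∑ s ∈ Ker ×ˢ (univ : Finset (ZMod (q * P))),
      H s.1 (s.2 + (a p₁ + b p₁')) * conj (H s.1 (s.2 + (a p₂ + b p₁'))) *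
        conj (H s.1 (s.2 + (a p₁ + b p₂'))) * H s.1 (s.2 + (a p₂ + b p₂'))‖ =
      energy q P (dlt (a p₂ - a p₁) (dlt (b p₂' - b p₁') F)) := by
    intro p₁ p₂ p₁' p₂'
    rw [← energy_shift _ (c := a p₁ + b p₁') (by simp [ha, hb]), ← norm_sum_eq_energy, sum_product]
    congr 1
    refine sum_congr rfl fun l _ => sum_congr rfl fun v _ => ?_
    have a1 : ∀ u, v + (a p₁ + b p₁') + u + (b p₂' - b p₁') = v + (a p₁ + b p₂') + u := by
      intro u; ring
    have a2 : ∀ u, v + (a p₁ + b p₁') + u + (a p₂ - a p₁) = v + (a p₂ + b p₁') + u := by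
      intro u; ring
    have a3 : ∀ u, v + (a p₂ + b p₁') + u + (b p₂' - b p₁') = v + (a p₂ + b p₂') + u := by
      intro u; ring
    have b1 := a1 0
    have b2 := a2 0
    have b3 := a3 0
    simp only [add_zero] at b1 b2 b3
    have a4 : v + l + (a p₁ + b p₁') = v + (a p₁ + b p₁') + l := add_right_comm _ _ _
    simp only [dlt, hH, a4, a1, a2, a3, b1, b2, b3, map_mul, Complex.conj_conj]
    ring
  rw [← e1, Complex.norm_real, Real.norm_of_nonneg hX0] at hbox
  simp only [hin, card_product, card_univ, ZMod.card] at hbox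
  rw [hKer, card_fibre] at hbox
  push_cast at hbox
  have hT0 : (0 : ℝ) < T.card := by exact_mod_cast hT.card_pos
  have hT0' : (0 : ℝ) < T'.card := by exact_mod_cast hT'.card_pos
  have hqP : 0 < q * P := Nat.pos_of_ne_zero (NeZero.ne _)
  have hqP0 : (0 : ℝ) < q * P := by exact_mod_cast hqP
  have hP0 : (0 : ℝ) < P := by exact_mod_cast Nat.pos_of_mul_pos_left hqP
  rw [sum_congr rfl fun p _ => sum_comm, ← sum_product' (f := fun p₁ p₁' => ∑ p₂ ∈ T, ∑ p₂' ∈ T',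
    energy q P (dlt (a p₂ - a p₁) (dlt (b p₂' - b p₁') F)))] at hbox
  obtain ⟨⟨p₀, p₀'⟩, -, hp⟩ := exists_le_of_sum_le (s := T ×ˢ T') (hT.product hT')
    (f := fun _ => ζ ^ 4 * (T.card * T'.card * (q * P ^ 2)))
    (g := fun x => ∑ p₂ ∈ T, ∑ p₂' ∈ T',
      energy q P (dlt (a p₂ - a x.1) (dlt (b p₂' - b x.2) F))) (by
      rw [sum_const, nsmul_eq_mul, card_product]
      push_cast
      refine le_of_mul_le_mul_left (a := (P * (q * P) : ℝ) ^ 3 * T.card ^ 2 * T'.card ^ 2) ?_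
        (by positivity)
      calc _ = (ζ * (T.card * T'.card * (q * P ^ 2))) ^ 4 := by ring
        _ ≤ X ^ 4 := pow_le_pow_left₀ (by positivity) h 4
        _ ≤ _ := hbox)
  exact ⟨p₀, p₀', hp⟩

/-- As in the box case; the frequency no longer depends on p, so one Cauchy–Schwarz removes it. -/
theorem exists_energy_of_line {q P : ℕ} [NeZero q] [NeZero (q * P)] {ζ : ℝ} (hζ : 0 ≤ ζ)
    {α : Type*} {T : Finset α} (hT : T.Nonempty)
    (a : α → ZMod (q * P)) (ha : ∀ p, fib q P (a p) = 0)
    (F : ZMod (q * P) → ℂ) (hF : ∀ x, ‖F x‖ ≤ 1) (χ₁ : ZMod q → ZMod (q * P))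
    (h : ζ * (T.card * (q * P ^ 2)) ≤ ∑ p ∈ T, ∑ ρ,
      ‖∑ x with fib q P x = ρ, dlt (a p) F x * ZMod.stdAddChar (χ₁ ρ * x)‖ ^ 2) :
    ∃ p₀, ζ ^ 2 * (T.card * (q * P ^ 2)) ≤ ∑ p ∈ T, energy q P (dlt (a p - a p₀) F) := by
  set X := ∑ p ∈ T, ∑ ρ,
      ‖∑ x with fib q P x = ρ, dlt (a p) F x * ZMod.stdAddChar (χ₁ ρ * x)‖ ^ 2 with hX
  set Ker : Finset (ZMod (q * P)) := {n | fib q P n = 0} with hKer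
  set H : ZMod (q * P) → ZMod (q * P) → ℂ := fun l v => F v * conj (F (v + l)) with hH
  have hH1 : ∀ l v, ‖H l v‖ ≤ 1 := fun l v => norm_mul_le_one (hF _) (norm_conj_le_one (hF _))
  have e1 : (X : ℂ) = ∑ s ∈ Ker ×ˢ (univ : Finset (ZMod (q * P))),
      (conj (H s.1 s.2) * ZMod.stdAddChar (χ₁ (fib q P s.2) * s.1)) *
        ∑ p ∈ T, H s.1 (s.2 + a p) := by
    rw [hX]
    simp only [fun p => sum_norm_fibre_sq_eq_energy (dlt (a p) F) χ₁]
    push_cast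
    simp_rw [energy_eq, mul_sum]
    rw [sum_comm (s := Ker ×ˢ univ)]
    refine sum_congr rfl fun p _ => ?_
    rw [sum_product]
    refine sum_congr rfl fun l hl => sum_congr rfl fun v _ => ?_
    have hl : fib q P l = 0 := (mem_filter.1 hl).2
    have a2 : ∀ c : ZMod (q * P), ZMod.stdAddChar (-(c * v)) * ZMod.stdAddChar (c * v) = (1 : ℂ) := by
      intro c; rw [← AddChar.map_add_eq_mul, neg_add_cancel, AddChar.map_zero_eq_one]
    rw [map_add, hl, add_zero, mul_add, AddChar.map_add_eq_mul,
      map_mul (starRingEnd ℂ), conj_stdAddChar]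
    have a3 : v + l + a p = v + a p + l := add_right_comm v l _
    simp only [dlt, hH, map_mul, Complex.conj_conj, a3]
    linear_combination (conj (F v) * F (v + a p) * (F (v + l) * conj (F (v + a p + l)))) *
      ZMod.stdAddChar (χ₁ (fib q P v) * l) * a2 (χ₁ (fib q P v))
  have hCS := norm_sum_sq_le_doubled (Ker ×ˢ (univ : Finset (ZMod (q * P)))) T
    (fun s => conj (H s.1 s.2) * ZMod.stdAddChar (χ₁ (fib q P s.2) * s.1))
    (fun s p => H s.1 (s.2 + a p))
    (fun s _ => norm_mul_le_one (norm_conj_le_one (hH1 _ _)) (norm_stdAddChar _).le)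
  have hX0 : 0 ≤ X := by positivity
  have hin : ∀ p₁ p₂, ‖∑ s ∈ Ker ×ˢ (univ : Finset (ZMod (q * P))),
      H s.1 (s.2 + a p₁) * conj (H s.1 (s.2 + a p₂))‖ = energy q P (dlt (a p₂ - a p₁) F) := by
    intro p₁ p₂
    rw [← energy_shift _ (c := a p₁) (ha _), ← norm_sum_eq_energy, ← RCLike.norm_conj, sum_product,
      map_sum]
    congr 1
    refine sum_congr rfl fun l _ => ?_
    rw [map_sum]
    refine sum_congr rfl fun v _ => ?_
    have a2 : ∀ u, v + a p₁ + u + (a p₂ - a p₁) = v + a p₂ + u := by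
      intro u; ring
    have b2 := a2 0
    simp only [add_zero] at b2
    have a4 : v + l + a p₁ = v + a p₁ + l := add_right_comm _ _ _
    simp only [dlt, hH, a4, a2, b2, map_mul, Complex.conj_conj]
    ring
  rw [← e1, Complex.norm_real, Real.norm_of_nonneg hX0] at hCS
  have hCS2 := hCS.trans (mul_le_mul_of_nonneg_left ((norm_sum_le _ _).trans
    (sum_le_sum fun p₁ _ => norm_sum_le _ _)) (by positivity))
  simp only [hin, card_product, card_univ, ZMod.card] at hCS2
  rw [hKer, card_fibre] at hCS2
  push_cast at hCS2
  have hT0 : (0 : ℝ) < T.card := by exact_mod_cast hT.card_pos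
  have hqP : 0 < q * P := Nat.pos_of_ne_zero (NeZero.ne _)
  have hqP0 : (0 : ℝ) < q * P := by exact_mod_cast hqP
  have hP0 : (0 : ℝ) < P := by exact_mod_cast Nat.pos_of_mul_pos_left hqP
  obtain ⟨p₀, -, hp⟩ := exists_le_of_sum_le (s := T) hT
    (f := fun _ => ζ ^ 2 * (T.card * (q * P ^ 2)))
    (g := fun x => ∑ p₂ ∈ T, energy q P (dlt (a p₂ - a x) F)) (by
      rw [sum_const, nsmul_eq_mul]
      refine le_of_mul_le_mul_left (a := (P * (q * P) : ℝ)) ?_ (by positivity)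
      calc _ = (ζ * (T.card * (q * P ^ 2))) ^ 2 := by ring
        _ ≤ X ^ 2 := pow_le_pow_left₀ (by positivity) h 2
        _ ≤ _ := hCS2)
  exact ⟨p₀, hp⟩

/-! ### Degree lowering -/

/-- The dual function, normalised to be bounded by `1`. -/
noncomputable def dualAvg {R : Type*} [CommRing R] (q : R) (m : ℕ) (f₀ f₁ : R → ℂ) (x : R) : ℂ :=
  dualSum q m f₀ f₁ x / m

theorem norm_dualAvg_le {R : Type*} [CommRing R] (q : R) (m : ℕ) {f₀ f₁ : R → ℂ}
    (h₀ : ∀ x, ‖f₀ x‖ ≤ 1) (h₁ : ∀ x, ‖f₁ x‖ ≤ 1) (x : R) : ‖dualAvg q m f₀ f₁ x‖ ≤ 1 := by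
  rw [dualAvg, norm_div, Complex.norm_natCast]
  refine div_le_one_of_le₀ ?_ (Nat.cast_nonneg _)
  calc _ ≤ ∑ j ∈ Icc 1 (m : ℤ), (1 : ℝ) :=
        (norm_sum_le _ _).trans (sum_le_sum fun j _ => norm_mul_le_one (h₀ _) (h₁ _))
    _ = m := by rw [sum_const, card_Icc_one, nsmul_eq_mul, mul_one]

theorem mul_dualAvg {R : Type*} [CommRing R] (q : R) {m : ℕ} (hm : 1 ≤ m) (f₀ f₁ : R → ℂ) (x : R) :
    (m : ℂ) * dualAvg q m f₀ f₁ x = dualSum q m f₀ f₁ x := by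
  have : (m : ℂ) ≠ 0 := Nat.cast_ne_zero.2 (by omega)
  rw [dualAvg]
  field_simp

theorem norm_fibre_sum_le {q P : ℕ} [NeZero q] [NeZero (q * P)] {G : ZMod (q * P) → ℂ}
    (hG : ∀ x, ‖G x‖ ≤ 1) (ρ : ZMod q) (c : ZMod (q * P)) :
    ‖∑ x with fib q P x = ρ, G x * ZMod.stdAddChar (c * x)‖ ≤ P := by
  calc _ ≤ ∑ x : ZMod (q * P) with fib q P x = ρ, (1 : ℝ) :=
        (norm_sum_le _ _).trans (sum_le_sum fun x _ =>
          norm_mul_le_one (hG _) (norm_stdAddChar _).le)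
    _ = P := by rw [sum_const, card_fibre, nsmul_eq_mul, mul_one]

theorem sq_mul_le_of_mul_le_sum {ι : Type*} (s : Finset ι) (f : ι → ℝ) {η P : ℝ} (hη : 0 ≤ η)
    (hP : 0 ≤ P) (h : η * (s.card * P) ≤ ∑ i ∈ s, f i) :
    η ^ 2 * (s.card * P ^ 2) ≤ ∑ i ∈ s, f i ^ 2 := by
  rcases s.eq_empty_or_nonempty with rfl | hs
  · simp
  have hc : (0 : ℝ) < s.card := by exact_mod_cast hs.card_pos
  refine le_of_mul_le_mul_left (a := (s.card : ℝ)) ?_ hc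
  calc _ = (η * (s.card * P)) ^ 2 := by ring
    _ ≤ (∑ i ∈ s, f i) ^ 2 := pow_le_pow_left₀ (by positivity) h 2
    _ ≤ _ := sq_sum_le_card_mul_sum_sq

theorem inv_card_bound {η : ℝ} (hη : 0 < η) (hη1 : η ≤ 1 / 2 ^ 40) (a b : ℕ) :
    η ^ (a + 3 * b + 1) ≤ η ^ a / (2 * (2 ^ 10 * ((η ^ b)⁻¹) ^ 3)) := by
  have : η ^ a / (2 * (2 ^ 10 * ((η ^ b)⁻¹) ^ 3)) = η ^ (a + 3 * b) * (1 / 2 ^ 11) := by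
    field_simp
    ring
  rw [this, pow_succ]
  exact mul_le_mul_of_nonneg_left (by linarith) (by positivity)

/-- Degree lowering for second derivatives of a dual function. -/
theorem energy_of_char_box {q P m : ℕ} [NeZero q] [NeZero P] [NeZero (q * P)] (hm : 1 ≤ m)
    (hP' : P ≤ 80 * m ^ 2) {η : ℝ} (hη : 0 < η) (hη1 : η ≤ 1 / 2 ^ 40)
    (hηm : 1 ≤ η ^ 900 * m) {f₀ f₁ : ZMod (q * P) → ℂ} (h₀ : ∀ x, ‖f₀ x‖ ≤ 1)
    (h₁ : ∀ x, ‖f₁ x‖ ≤ 1) {α β : Type*} {T : Finset α} {T' : Finset β} (hT : T.Nonempty)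
    (hT' : T'.Nonempty)
    (a : α → ZMod (q * P)) (b : β → ZMod (q * P)) (ha : ∀ p, fib q P (a p) = 0)
    (hb : ∀ p, fib q P (b p) = 0) (F : ZMod (q * P) → ℂ)
    (hF : F = dualAvg (q : ZMod (q * P)) m f₀ f₁)
    (χ : α → β → ZMod q → ZMod (q * P))
    (h : η * (T.card * T'.card * q * P) ≤ ∑ p ∈ T, ∑ p' ∈ T', ∑ ρ,
      ‖∑ x with fib q P x = ρ, dlt (a p) (dlt (b p') F) x * ZMod.stdAddChar (χ p p' ρ * x)‖) :
    ∃ p₀ p₀', η ^ 26648 * (T.card * T'.card * (q * P ^ 2)) ≤ ∑ p ∈ T, ∑ p' ∈ T',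
      energy q P (dlt (a p - a p₀) (dlt (b p' - b p₀') F)) := by
  classical
  have hF1 : ∀ x, ‖F x‖ ≤ 1 := by rw [hF]; exact norm_dualAvg_le _ _ h₀ h₁
  have hη2 : η ≤ 1 := hη1.trans (by norm_num)
  have hP0 : (0 : ℝ) < P := by exact_mod_cast Nat.pos_of_ne_zero (NeZero.ne P)
  have hPC : (P : ℂ) ≠ 0 := Nat.cast_ne_zero.2 (NeZero.ne P)
  have hm0 : (0 : ℝ) < m := by exact_mod_cast hm
  set S : α → β → ZMod q → ℂ := fun p p' ρ => ∑ x with fib q P x = ρ,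
    dlt (a p) (dlt (b p') F) x * ZMod.stdAddChar (χ p p' ρ * x) with hS
  have hSP : ∀ p p' ρ, ‖S p p' ρ‖ ≤ P := fun p p' ρ =>
    norm_fibre_sum_le (norm_dlt_le (norm_dlt_le hF1 _) _) _ _
  have hnw : ∀ p p' ρ, ‖conj (S p p' ρ) / P‖ = ‖S p p' ρ‖ / P := by
    intro p p' ρ
    rw [norm_div, RCLike.norm_conj, Complex.norm_natCast]
  have hsq : η ^ 2 * (T.card * T'.card * q * P ^ 2) ≤ ∑ p ∈ T, ∑ p' ∈ T', ∑ ρ,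
      ‖S p p' ρ‖ ^ 2 := by
    have := sq_mul_le_of_mul_le_sum (T ×ˢ T' ×ˢ (univ : Finset (ZMod q)))
      (fun x => ‖S x.1 x.2.1 x.2.2‖) hη.le hP0.le (by
        simp only [sum_product, card_product, card_univ, ZMod.card]
        push_cast
        refine le_trans (le_of_eq ?_) h
        ring)
    simp only [sum_product, card_product, card_univ, ZMod.card] at this
    push_cast at this
    refine le_trans (le_of_eq ?_) this
    ring
  -- The weights conj(S)/P linearise the sum of squares. Of the four vertices of the derivative,
  -- only the far one, at a(p) + b(p'), is written as a dual sum; the others depend on one parameter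
  -- each and play the role of bounded functions.
  have heq : ∑ x, ∑ p ∈ T, ∑ p' ∈ T', (F x * conj (F (x + a p))) * conj (F (x + b p')) *
      (conj (S p p' (fib q P x)) / P * dualSum (q : ZMod (q * P)) m f₀ f₁ (x + (a p + b p')) *
        ZMod.stdAddChar (χ p p' (fib q P x) * x)) =
      ((m / P * ∑ p ∈ T, ∑ p' ∈ T', ∑ ρ, ‖S p p' ρ‖ ^ 2 : ℝ) : ℂ) := by
    push_cast
    rw [sum_comm, mul_sum]
    refine sum_congr rfl fun p _ => ?_
    rw [sum_comm, mul_sum]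
    refine sum_congr rfl fun p' _ => ?_
    rw [mul_sum, ← sum_fiberwise univ (fib q P)]
    refine sum_congr rfl fun ρ _ => ?_
    have hx : ∀ x ∈ ({x | fib q P x = ρ} : Finset (ZMod (q * P))),
        (F x * conj (F (x + a p))) * conj (F (x + b p')) * (conj (S p p' (fib q P x)) / P *
        dualSum (q : ZMod (q * P)) m f₀ f₁ (x + (a p + b p')) *
        ZMod.stdAddChar (χ p p' (fib q P x) * x)) = m / P * conj (S p p' ρ) *
        (dlt (a p) (dlt (b p') F) x * ZMod.stdAddChar (χ p p' ρ * x)) := by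
      intro x hx
      rw [(mem_filter.1 hx).2, ← mul_dualAvg _ hm, ← hF]
      generalize conj (S p p' ρ) = c
      simp only [dlt, map_mul, Complex.conj_conj, add_assoc]
      ring
    rw [sum_congr rfl hx, ← mul_sum]
    change _ * S p p' ρ = _
    rw [← Complex.ofReal_pow, ← Complex.normSq_eq_norm_sq, ← Complex.mul_conj]
    ring
  have hmaj := majRes_of_box (η := η ^ 9) (ζ := η ^ 2) (by positivity)
    ((pow_le_of_le_one hη.le hη2 (by norm_num)).trans (hη1.trans (by norm_num)))
    (by rw [← pow_mul]; exact hηm) (by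
      have : η ^ 8 * (2 * η) ≤ η ^ 8 * 1 := mul_le_mul_of_nonneg_left (by linarith) (by positivity)
      calc _ = η ^ 8 * (2 * η) := by ring
        _ ≤ _ := this
        _ = _ := by ring) (by positivity) T T' a b (fun x p => F x * conj (F (x + a p)))
    (fun x p' => conj (F (x + b p'))) (fun p p' ρ => conj (S p p' ρ) / P) χ f₀ f₁ h₀ h₁
    (fun _ _ => norm_mul_le_one (hF1 _) (norm_conj_le_one (hF1 _)))
    (fun _ _ => norm_conj_le_one (hF1 _))
    (fun p p' ρ => by rw [hnw]; exact div_le_one_of_le₀ (hSP _ _ _) hP0.le) (by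
      rw [heq, Complex.norm_real, Real.norm_of_nonneg (by positivity)]
      calc η ^ 2 * (T.card * T'.card * (q * P) * m) =
            m / P * (η ^ 2 * (T.card * T'.card * q * P ^ 2)) := by field_simp
        _ ≤ _ := mul_le_mul_of_nonneg_left hsq (by positivity))
  simp only [hnw] at hmaj
  rw [← pow_mul] at hmaj
  have hQ : 1 ≤ (η ^ (9 * 123))⁻¹ := (one_le_inv₀ (by positivity)).2 (pow_le_one₀ hη.le hη2)
  obtain ⟨χ₁, χ₂, hχ⟩ := exists_split_of_box (κ := 2 ^ 10 * ((η ^ (9 * 123))⁻¹) ^ 3)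
    (by positivity) (by positivity) T T' (fun p p' ρ => ‖S p p' ρ‖ / P) (fun _ _ _ => by positivity)
    χ _ (card_majRes_le hm hP' hQ) hmaj
  -- 3331 = 9 + 3 · 1107 + 1: the density η ^ 9, the cubic count of major residues with Q = η ^
  -- (-1107), and one η for constants. Squaring and the box inequality multiply this by 8, giving
  -- 26648.
  have hlow : η ^ 3331 * (T.card * T'.card * q) ≤ ∑ p ∈ T, ∑ p' ∈ T', ∑ ρ,
      ‖∑ x with fib q P x = ρ, dlt (a p) (dlt (b p') F) x *
        ZMod.stdAddChar ((χ₁ p ρ + χ₂ p' ρ) * x)‖ / P := by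
    refine (mul_le_mul_of_nonneg_right (inv_card_bound hη hη1 9 (9 * 123))
      (by positivity)).trans (hχ.trans ?_)
    refine sum_le_sum fun p _ => sum_le_sum fun p' _ => sum_le_sum fun ρ _ => ?_
    split_ifs with hc
    · rw [hS, norm_fibre_sum_congr _ _ hc]
    · positivity
  have hsq2 := sq_mul_le_of_mul_le_sum (T ×ˢ T' ×ˢ (univ : Finset (ZMod q)))
      (fun x => ‖∑ y with fib q P y = x.2.2, dlt (a x.1) (dlt (b x.2.1) F) y *
        ZMod.stdAddChar ((χ₁ x.1 x.2.2 + χ₂ x.2.1 x.2.2) * y)‖) (η := η ^ 3331) (by positivity) hP0.le (by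
        simp only [sum_product, card_product, card_univ, ZMod.card]
        simp_rw [← sum_div] at hlow
        rw [le_div_iff₀ hP0] at hlow
        push_cast
        refine le_trans (le_of_eq ?_) hlow
        ring)
  simp only [sum_product, card_product, card_univ, ZMod.card] at hsq2
  obtain ⟨p₀, p₀', hp⟩ := exists_energy_of_box (ζ := (η ^ 3331) ^ 2) (by positivity) hT hT' a b ha hb F
    hF1 χ₁ χ₂ (by
      push_cast at hsq2
      refine le_trans (le_of_eq ?_) hsq2
      ring)
  refine ⟨p₀, p₀', le_trans (le_of_eq ?_) hp⟩
  rw [← pow_mul, ← pow_mul]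

/-- Degree lowering for first derivatives of a dual function. -/
theorem energy_of_char_line {q P m : ℕ} [NeZero q] [NeZero P] [NeZero (q * P)] (hm : 1 ≤ m)
    (hP' : P ≤ 80 * m ^ 2) {η : ℝ} (hη : 0 < η) (hη1 : η ≤ 1 / 2 ^ 40)
    (hηm : 1 ≤ η ^ 500 * m) {f₀ f₁ : ZMod (q * P) → ℂ} (h₀ : ∀ x, ‖f₀ x‖ ≤ 1)
    (h₁ : ∀ x, ‖f₁ x‖ ≤ 1) {α : Type*} {T : Finset α} (hT : T.Nonempty)
    (a : α → ZMod (q * P)) (ha : ∀ p, fib q P (a p) = 0) (F : ZMod (q * P) → ℂ)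
    (hF : F = dualAvg (q : ZMod (q * P)) m f₀ f₁)
    (χ : α → ZMod q → ZMod (q * P))
    (h : η * (T.card * q * P) ≤ ∑ p ∈ T, ∑ ρ,
      ‖∑ x with fib q P x = ρ, dlt (a p) F x * ZMod.stdAddChar (χ p ρ * x)‖) :
    ∃ p₀, η ^ 7404 * (T.card * (q * P ^ 2)) ≤ ∑ p ∈ T, energy q P (dlt (a p - a p₀) F) := by
  classical
  have hF1 : ∀ x, ‖F x‖ ≤ 1 := by rw [hF]; exact norm_dualAvg_le _ _ h₀ h₁
  have hη2 : η ≤ 1 := hη1.trans (by norm_num)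
  have hP0 : (0 : ℝ) < P := by exact_mod_cast Nat.pos_of_ne_zero (NeZero.ne P)
  have hPC : (P : ℂ) ≠ 0 := Nat.cast_ne_zero.2 (NeZero.ne P)
  have hm0 : (0 : ℝ) < m := by exact_mod_cast hm
  set S : α → ZMod q → ℂ := fun p ρ => ∑ x with fib q P x = ρ,
    dlt (a p) F x * ZMod.stdAddChar (χ p ρ * x) with hS
  have hSP : ∀ p ρ, ‖S p ρ‖ ≤ P := fun p ρ => norm_fibre_sum_le (norm_dlt_le hF1 _) _ _
  have hsq : η ^ 2 * (T.card * q * P ^ 2) ≤ ∑ p ∈ T, ∑ ρ, ‖S p ρ‖ ^ 2 := by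
    have := sq_mul_le_of_mul_le_sum (T ×ˢ (univ : Finset (ZMod q)))
      (fun x => ‖S x.1 x.2‖) hη.le hP0.le (by
        simp only [sum_product, card_product, card_univ, ZMod.card]
        push_cast
        exact h)
    simp only [sum_product, card_product, card_univ, ZMod.card] at this
    push_cast at this
    exact this
  -- The conjugate of the derivative is used, so that F(x + a(p)) appears unconjugated and can be
  -- written as a dual sum; this flips the sign of the frequencies.
  have heq : ∑ x, ∑ p ∈ T, conj (F x) *
      (S p (fib q P x) / P * dualSum (q : ZMod (q * P)) m f₀ f₁ (x + a p) *
        ZMod.stdAddChar (-χ p (fib q P x) * x)) =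
      ((m / P * ∑ p ∈ T, ∑ ρ, ‖S p ρ‖ ^ 2 : ℝ) : ℂ) := by
    push_cast
    rw [sum_comm, mul_sum]
    refine sum_congr rfl fun p _ => ?_
    rw [mul_sum, ← sum_fiberwise univ (fib q P)]
    refine sum_congr rfl fun ρ _ => ?_
    rw [← Complex.ofReal_pow, ← Complex.normSq_eq_norm_sq, ← Complex.mul_conj, ← mul_assoc]
    have : conj (S p ρ) = ∑ x with fib q P x = ρ,
        conj (dlt (a p) F x * ZMod.stdAddChar (χ p ρ * x)) := by rw [hS, map_sum]
    rw [this, mul_sum]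
    refine sum_congr rfl fun x hx => ?_
    rw [(mem_filter.1 hx).2, ← mul_dualAvg _ hm, ← hF, map_mul (starRingEnd ℂ),
      conj_stdAddChar, neg_mul]
    simp only [dlt, map_mul, Complex.conj_conj]
    ring
  have hnw : ∀ p ρ, ‖S p ρ / P‖ = ‖S p ρ‖ / P := by
    intro p ρ
    rw [norm_div, Complex.norm_natCast]
  have hmaj := majRes_of_line (η := η ^ 5) (ζ := η ^ 2) (by positivity)
    ((pow_le_of_le_one hη.le hη2 (by norm_num)).trans (hη1.trans (by norm_num)))
    (by rw [← pow_mul]; exact hηm) (by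
      have : η ^ 4 * (2 * η) ≤ η ^ 4 * 1 := mul_le_mul_of_nonneg_left (by linarith) (by positivity)
      calc _ = η ^ 4 * (2 * η) := by ring
        _ ≤ _ := this
        _ = _ := by ring) (by positivity) T a (fun x => conj (F x))
    (fun p ρ => S p ρ / P) (fun p ρ => -χ p ρ) f₀ f₁ h₀ h₁
    (fun _ => norm_conj_le_one (hF1 _))
    (fun p ρ => by rw [hnw]; exact div_le_one_of_le₀ (hSP _ _) hP0.le) (by
      rw [heq, Complex.norm_real, Real.norm_of_nonneg (by positivity)]
      calc η ^ 2 * (T.card * (q * P) * m) =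
            m / P * (η ^ 2 * (T.card * q * P ^ 2)) := by field_simp
        _ ≤ _ := mul_le_mul_of_nonneg_left hsq (by positivity))
  simp only [hnw] at hmaj
  rw [← pow_mul] at hmaj
  have hQ : 1 ≤ (η ^ (5 * 123))⁻¹ := (one_le_inv₀ (by positivity)).2 (pow_le_one₀ hη.le hη2)
  obtain ⟨χ₁, hχ⟩ := exists_split_of_line (κ := 2 ^ 10 * ((η ^ (5 * 123))⁻¹) ^ 3)
    (by positivity) (by positivity) T (fun p ρ => ‖S p ρ‖ / P) (fun _ _ => by positivity)
    (fun p ρ => -χ p ρ) _ (card_majRes_le hm hP' hQ) hmaj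
  -- 1851 = 5 + 3 · 615 + 1, then multiplied by 4 to give 7404.
  have hlow : η ^ 1851 * (T.card * q) ≤ ∑ p ∈ T, ∑ ρ,
      ‖∑ x with fib q P x = ρ, dlt (a p) F x * ZMod.stdAddChar (-χ₁ ρ * x)‖ / P := by
    refine (mul_le_mul_of_nonneg_right (inv_card_bound hη hη1 5 (5 * 123))
      (by positivity)).trans (hχ.trans ?_)
    refine sum_le_sum fun p _ => sum_le_sum fun ρ _ => ?_
    split_ifs with hc
    · rw [hS, norm_fibre_sum_congr (c' := -χ₁ ρ) _ _ (by rw [map_neg, ← hc, map_neg, neg_neg])]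
    · positivity
  have hsq2 := sq_mul_le_of_mul_le_sum (T ×ˢ (univ : Finset (ZMod q)))
      (fun x => ‖∑ y with fib q P y = x.2, dlt (a x.1) F y *
        ZMod.stdAddChar (-χ₁ x.2 * y)‖) (η := η ^ 1851) (by positivity) hP0.le (by
        simp only [sum_product, card_product, card_univ, ZMod.card]
        simp_rw [← sum_div] at hlow
        rw [le_div_iff₀ hP0] at hlow
        push_cast
        refine le_trans (le_of_eq ?_) hlow
        ring)
  simp only [sum_product, card_product, card_univ, ZMod.card] at hsq2
  obtain ⟨p₀, hp⟩ := exists_energy_of_line (ζ := (η ^ 1851) ^ 2) (by positivity) hT a ha F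
    hF1 (fun ρ => -χ₁ ρ) (by
      push_cast at hsq2
      refine le_trans (le_of_eq ?_) hsq2
      ring)
  refine ⟨p₀, le_trans (le_of_eq ?_) hp⟩
  rw [← pow_mul, ← pow_mul]

/-! ### From a large count to a correlation of the dual function with characters on fibres -/

theorem energy_conj {q P : ℕ} [NeZero q] [NeZero (q * P)] (C : ZMod (q * P) → ℂ) :
    energy q P (fun x => conj (C x)) = energy q P C := by
  simp only [energy, ← map_sum, RCLike.norm_conj]

theorem dlt_conj {R : Type*} [Add R] (n : R) (F : R → ℂ) :
    dlt n (fun x => conj (F x)) = fun x => conj (dlt n F x) := by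
  funext x
  simp only [dlt, map_mul]

theorem sum_Icc_neg_comp_neg (m : ℕ) (f : ℤ → ℝ) :
    ∑ k ∈ Icc (-m : ℤ) m, f (-k) = ∑ k ∈ Icc (-m : ℤ) m, f k :=
  sum_bij' (fun k _ => -k) (fun k _ => -k) (by intro k hk; simp only [mem_Icc] at *; omega)
    (by intro k hk; simp only [mem_Icc] at *; omega) (by intros; ring) (by intros; ring)
    (by intros; rfl)

/-- Substituting x = z + q y² frees the argument of `g`; the remaining sum over y is the dual
function. -/
theorem sum_dual {R : Type*} [CommRing R] [Fintype R] (q : R) {m : ℕ} (hm : 1 ≤ m)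
    (f₀ f₁ g : R → ℂ) :
    ∑ z, ∑ y ∈ Icc 1 (m : ℤ), f₀ z * f₁ (z + y) * g (z + q * y ^ 2) =
      m * ∑ x, g x * dualAvg q m f₀ f₁ x := by
  rw [mul_sum, sum_comm]
  simp_rw [mul_left_comm, mul_dualAvg q hm, dualSum, mul_sum]
  rw [sum_comm (s := univ)]
  refine sum_congr rfl fun y _ => ?_
  rw [← sum_shift (-(q * (y : R) ^ 2))]
  refine sum_congr rfl fun x _ => ?_
  have a1 : x + -(q * (y : R) ^ 2) = x - q * y ^ 2 := by ring
  have a2 : x - q * (y : R) ^ 2 + y = x + y - q * y ^ 2 := by ring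
  rw [a1, a2, sub_add_cancel]
  ring

/-- A large count remains large when the last function is replaced by the dual function. -/
theorem count_dual_ge {R : Type*} [CommRing R] [Fintype R] (q : R) {m : ℕ} (hm : 1 ≤ m)
    (f₀ f₁ f₂ : R → ℂ) (h₂ : ∀ x, ‖f₂ x‖ ≤ 1) {δ : ℝ} (hδ : 0 ≤ δ)
    (h : δ * Fintype.card R * m ≤ ‖∑ z, ∑ y ∈ Icc 1 (m : ℤ), f₀ z * f₁ (z + y) *
      f₂ (z + q * y ^ 2)‖) :
    δ ^ 2 * Fintype.card R * m ≤ ‖∑ z, ∑ y ∈ Icc 1 (m : ℤ), f₀ z * f₁ (z + y) *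
      (fun x => conj (dualAvg q m f₀ f₁ x)) (z + q * y ^ 2)‖ := by
  have hm0 : (0 : ℝ) < m := by exact_mod_cast hm
  have hR : (0 : ℝ) < Fintype.card R := by exact_mod_cast Fintype.card_pos
  rw [sum_dual q hm, norm_mul, Complex.norm_natCast, mul_comm (m : ℝ)] at h
  rw [sum_dual q hm f₀ f₁ (fun x => conj (dualAvg q m f₀ f₁ x)), norm_mul, Complex.norm_natCast,
    mul_comm (m : ℝ)]
  have h' := le_of_mul_le_mul_right h hm0
  refine mul_le_mul_of_nonneg_right ?_ hm0.le
  have e1 : ∑ x, conj (dualAvg q m f₀ f₁ x) * dualAvg q m f₀ f₁ x =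
      ((∑ x, ‖dualAvg q m f₀ f₁ x‖ ^ 2 : ℝ) : ℂ) := by
    rw [Complex.ofReal_sum]
    refine sum_congr rfl fun x _ => ?_
    rw [← Complex.normSq_eq_norm_sq, Complex.normSq_eq_conj_mul_self]
  rw [e1, Complex.norm_real, Real.norm_of_nonneg (sum_nonneg fun _ _ => by positivity)]
  have h2 := norm_sum_mul_sq_le univ f₂ (dualAvg q m f₀ f₁) (fun x _ => h₂ x)
  rw [card_univ] at h2
  refine le_of_mul_le_mul_left (a := (Fintype.card R : ℝ)) ?_ hR
  calc _ = (δ * Fintype.card R) ^ 2 := by ring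
    _ ≤ _ := (pow_le_pow_left₀ (by positivity) h' 2).trans h2

theorem one_le_pow_mul {η x : ℝ} (hη : 0 < η) (hη1 : η ≤ 1) (hx : 0 ≤ x) {a b : ℕ}
    (h : 1 ≤ η ^ b * x) (hab : a ≤ b) : 1 ≤ η ^ a * x :=
  h.trans (mul_le_mul_of_nonneg_right (pow_le_pow_of_le_one hη.le hη1 hab) hx)

theorem pow_le_bound {η c : ℝ} (hη : 0 < η) (hη1 : η ≤ c) (hc : c ≤ 1) {a : ℕ} (ha : a ≠ 0) :
    η ^ a ≤ c := (pow_le_of_le_one hη.le (hη1.trans hc) ha).trans hη1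

theorem absorb_const {η : ℝ} {m : ℕ} (hm : 1 ≤ m) (hη : 0 ≤ η) (hη1 : η ≤ 1 / 2 ^ 40) (q P : ℕ) :
    η ^ 202 * ((2 * m + 1) ^ 2 * (2 * m + 1) ^ 2 * q * (2 * m + 1) ^ 2 * (P : ℝ) ^ 2) ≤
      η ^ 201 * (q * P * P) * m ^ 6 := by
  have hm1 : (2 * m + 1 : ℝ) ≤ 3 * m := by
    have : (1 : ℝ) ≤ m := by exact_mod_cast hm
    linarith
  calc η ^ 202 * ((2 * m + 1) ^ 2 * (2 * m + 1) ^ 2 * q * (2 * m + 1) ^ 2 * (P : ℝ) ^ 2)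
      = η ^ 201 * (q * P * P) * (2 * m + 1) ^ 6 * η := by ring
    _ ≤ η ^ 201 * (q * P * P) * (3 * m) ^ 6 * (1 / 2 ^ 40) := by gcongr
    _ = η ^ 201 * (q * P * P) * m ^ 6 * (729 / 2 ^ 40) := by ring
    _ ≤ η ^ 201 * (q * P * P) * m ^ 6 * 1 := by
      refine mul_le_mul_of_nonneg_left (by norm_num) (by positivity)
    _ = _ := by ring

/-- Passing to a power of a small parameter. -/
theorem exists_eq_pow {η : ℝ} (hη : 0 < η) (hη1 : η ≤ 1 / 2 ^ 40) {m k a b : ℕ} (hk : k ≠ 0)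
    (hb : b = k * a) (hm : 1 ≤ η ^ b * m) :
    ∃ x, η ^ k = x ∧ 0 < x ∧ x ≤ 1 / 2 ^ 40 ∧ 1 ≤ x ^ a * m :=
  ⟨_, rfl, pow_pos hη _, pow_le_bound hη hη1 (by norm_num) hk, by rw [← pow_mul, ← hb]; exact hm⟩

/-- The dual function of a pair with a large count correlates with characters on the fibres. -/
theorem exists_char_dual {q P m : ℕ} [NeZero q] [NeZero P] [NeZero (q * P)] (hm : 1 ≤ m)
    (hP : 16 * m ^ 2 < P) (hP' : P ≤ 80 * m ^ 2) {η : ℝ} (hη : 0 < η) (hη1 : η ≤ 1 / 2 ^ 40)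
    (hηm : 1 ≤ η ^ 29054267286336 * m) (f₀ f₁ : ZMod (q * P) → ℂ) (h₀ : ∀ x, ‖f₀ x‖ ≤ 1)
    (h₁ : ∀ x, ‖f₁ x‖ ≤ 1) (F : ZMod (q * P) → ℂ) (hF : F = dualAvg (q : ZMod (q * P)) m f₀ f₁)
    (h : η * (q * P) * m ≤ ‖∑ z : ZMod (q * P), ∑ y ∈ Icc 1 (m : ℤ),
      f₀ z * f₁ (z + y) * (fun x => conj (F x)) (z + q * y ^ 2)‖) :
    ∃ χ : ZMod q → ZMod (q * P), η ^ 29054267286336 * (q * P) ≤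
      ∑ ρ, ‖∑ x with fib q P x = ρ, F x * ZMod.stdAddChar (χ ρ * x)‖ := by
  have hF1 : ∀ x, ‖F x‖ ≤ 1 := by rw [hF]; exact norm_dualAvg_le _ _ h₀ h₁
  have hc1 : (1 / 2 ^ 40 : ℝ) ≤ 1 := by norm_num
  have hη2 : η ≤ 1 := hη1.trans hc1
  have hm0 : (0 : ℝ) ≤ m := Nat.cast_nonneg m
  have hmb : ∀ {a : ℕ}, a ≤ 29054267286336 → 1 ≤ η ^ a * m := fun ha =>
    one_le_pow_mul hη hη2 hm0 hηm ha
  have hKc : ((Icc (-m : ℤ) m).card : ℝ) = 2 * m + 1 := by rw [card_Icc_neg]; push_cast; ring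
  set K := Icc (-m : ℤ) m with hK
  have hKn : (K ×ˢ K).Nonempty := by
    have : K.Nonempty := ⟨0, by simp [hK]⟩
    exact this.product this
  have hKK : ((K ×ˢ K).card : ℝ) = (2 * m + 1) ^ 2 := by
    rw [card_product]; push_cast; rw [hKc]; ring
  set a : ℤ × ℤ → ZMod (q * P) := fun p => 2 * q * p.1 * p.2 with ha
  have ha0 : ∀ p, fib q P (a p) = 0 := fun p => by simp [ha]
  have s1 := energy_of_count hm hP hP' hη hη1 (hmb (by norm_num)) f₀ f₁ _ h₀ h₁
    (fun x => norm_conj_le_one (hF1 x)) h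
  simp only [dlt_conj, energy_conj] at s1
  have s2 : η ^ 202 * (((K ×ˢ K) ×ˢ (K ×ˢ K)).card * q * (2 * m + 1) ^ 2 * P ^ 2) ≤
      ∑ i ∈ (K ×ˢ K) ×ˢ (K ×ˢ K), ∑ h ∈ K, ∑ u ∈ K,
        energy q P (dlt (0 + 2 * q * h * u) (dlt (a i.1) (dlt (a i.2) F))) := by
    have e1 : ∑ i ∈ (K ×ˢ K) ×ˢ (K ×ˢ K), ∑ h ∈ K, ∑ u ∈ K,
        energy q P (dlt (0 + 2 * q * h * u) (dlt (a i.1) (dlt (a i.2) F))) =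
        ∑ k ∈ K, ∑ t ∈ K, ∑ h ∈ K, ∑ h' ∈ K, ∑ u ∈ K, ∑ u' ∈ K,
        energy q P (dlt (2 * q * h' * u') (dlt (2 * q * h * u) (dlt (-(2 * q * k * t)) F))) := by
      -- Replacing k by -k removes the sign of the direction -2qkt, so all three derivatives are in
      -- directions of the same form.
      rw [← sum_Icc_neg_comp_neg, sum_product_right, sum_product]
      refine sum_congr rfl fun k _ => sum_congr rfl fun t _ => ?_
      rw [sum_product]
      refine sum_congr rfl fun h _ => ?_
      rw [sum_comm]
      refine sum_congr rfl fun h' _ => sum_congr rfl fun u _ => sum_congr rfl fun u' _ => ?_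
      simp only [ha, zero_add, Int.cast_neg, mul_neg, neg_mul, neg_neg]
    rw [e1]
    refine le_trans ?_ s1
    rw [card_product]
    push_cast
    rw [hKK]
    exact absorb_const hm hη.le hη1 _ _
  have hle : ∀ {x : ℝ} {a b : ℕ}, 0 < x → x ≤ 1 / 2 ^ 40 → 1 ≤ x ^ b * m → a ≤ b →
      1 ≤ x ^ a * m := fun h0 h1 h2 h3 => one_le_pow_mul h0 (h1.trans hc1) hm0 h2 h3
  -- The successive losses are the powers 202, 9, 26648, 9, 7404, 9, with product 29054267286336.
  obtain ⟨η₁, e₁, p₁, b₁, m₁⟩ := exists_eq_pow (k := 202) (a := 143833006368) hη hη1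
    (by norm_num) (by norm_num) hηm
  rw [e₁] at s2
  obtain ⟨η₂, e₂, p₂, b₂, m₂⟩ := exists_eq_pow (k := 9) (a := 15981445152) p₁ b₁
    (by norm_num) (by norm_num) m₁
  obtain ⟨η₃, e₃, p₃, b₃, m₃⟩ := exists_eq_pow (k := 26648) (a := 599724) p₂ b₂
    (by norm_num) (by norm_num) m₂
  obtain ⟨η₄, e₄, p₄, b₄, m₄⟩ := exists_eq_pow (k := 9) (a := 66636) p₃ b₃
    (by norm_num) (by norm_num) m₃
  obtain ⟨η₅, e₅, p₅, b₅, m₅⟩ := exists_eq_pow (k := 7404) (a := 9) p₄ b₄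
    (by norm_num) (by norm_num) m₄
  have e₆ : η₅ ^ 9 = η ^ 29054267286336 := by
    rw [← e₅, ← e₄, ← e₃, ← e₂, ← e₁]
    simp only [← pow_mul, Nat.reduceMul]
  rw [← e₆]
  obtain ⟨χ₂, s3⟩ := exists_char_of_energy hm hP hP' p₁ b₁
    (hle p₁ b₁ m₁ (by norm_num)) _
    (fun i : (ℤ × ℤ) × (ℤ × ℤ) => dlt (a i.1) (dlt (a i.2) F))
    (fun i => norm_dlt_le (norm_dlt_le hF1 _) _) (map_zero _) s2
  rw [sum_product, card_product, e₂] at s3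
  push_cast at s3
  obtain ⟨i₀, i₀', s4⟩ := energy_of_char_box hm hP' p₂ b₂
    (hle p₂ b₂ m₂ (by norm_num)) h₀ h₁ hKn hKn a a ha0 ha0 F hF
    (fun p p' => χ₂ (p, p')) s3
  rw [e₃] at s4
  -- The pair p = (h, u) now plays the role of the averaged derivative, with base point entering as
  -- the constant c = -a(i₀), and only p' still indexes the characters.
  obtain ⟨χ₁, s5⟩ := exists_char_of_energy hm hP hP' p₃ b₃
    (hle p₃ b₃ m₃ (by norm_num)) (K ×ˢ K) (fun p' => dlt (a p' - a i₀') F)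
    (fun i => norm_dlt_le hF1 _) (c := -a i₀) (by rw [map_neg, ha0, neg_zero]) (by
      refine (le_of_eq ?_).trans (s4.trans (le_of_eq ?_))
      · rw [hKK]; ring
      · rw [sum_comm]
        refine sum_congr rfl fun p' _ => ?_
        rw [sum_product]
        refine sum_congr rfl fun h _ => sum_congr rfl fun u _ => ?_
        rw [neg_add_eq_sub])
  rw [e₄] at s5
  obtain ⟨j, s6⟩ := energy_of_char_line hm hP' p₄ b₄
    (hle p₄ b₄ m₄ (by norm_num)) h₀ h₁ hKn (fun p => a p - a i₀')
    (fun p => by rw [map_sub, ha0, ha0, sub_zero]) F hF χ₁ s5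
  rw [e₅] at s6
  -- Only the last derivative is left; trading it for a character, with a one-point index set,
  -- leaves F itself.
  obtain ⟨χ₀, s7⟩ := exists_char_of_energy hm hP hP' p₅ b₅
    (hle p₅ b₅ m₅ (by norm_num)) {()} (fun _ => F)
    (fun i => hF1) (c := -a j) (by rw [map_neg, ha0, neg_zero]) (by
      refine (le_of_eq ?_).trans (s6.trans (le_of_eq ?_))
      · rw [hKK, card_singleton]; push_cast; ring
      · rw [sum_singleton, sum_product]
        refine sum_congr rfl fun h _ => sum_congr rfl fun u _ => ?_
        rw [neg_add_eq_sub, sub_sub_sub_cancel_right])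
  refine ⟨χ₀ (), ?_⟩
  rw [sum_singleton, card_singleton] at s7
  refine le_trans (le_of_eq ?_) s7
  push_cast
  rw [one_mul]

/-! ### From correlation with major arc characters to local averages -/

/-- A quadratic exponential sum over a major arc is controlled by averages over short progressions. -/
theorem mul_norm_sum_phase_le {g : ℤ → ℂ} (hg : ∀ j, ‖g j‖ ≤ 1) {θ Q ζ : ℝ} {q d m N : ℕ}
    (hm : 1 ≤ m) (hζ : 0 ≤ ζ) (hQ : 0 ≤ Q) (hζQ : ζ * Q ≤ 1) (hd : (d : ℝ) ≤ Q)
    (hθ : distInt (d * θ) ≤ Q / m ^ 2) (hN : (q : ℝ) * N ≤ ζ * m) :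
    N * ‖∑ j ∈ Icc 1 (m : ℤ), g j * e (θ * j ^ 2)‖ ≤
      ∑ j ∈ Icc 1 (m : ℤ), ‖∑ y ∈ Icc 1 (N : ℤ), g (j + q * d * y)‖ + 23 * (ζ * Q) * m * N := by
  have hm0 : (0 : ℝ) < m := by exact_mod_cast hm
  set ε : ℝ := d * θ - round (d * θ) with hε
  have hε1 : |ε| ≤ Q / m ^ 2 := hθ
  have hphase : ∀ j ∈ Icc 1 (m : ℤ), ∀ y ∈ Icc 1 (N : ℤ),
      ‖e (θ * j ^ 2) - e (θ * ((j + q * d * y : ℤ) : ℝ) ^ 2)‖ ≤ 21 * (ζ * Q) := by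
    intro j hj y hy
    rw [mem_Icc] at hj hy
    have hj0 : (0 : ℝ) ≤ j := by exact_mod_cast (by omega : (0 : ℤ) ≤ j)
    have hjm : (j : ℝ) ≤ m := by exact_mod_cast hj.2
    have hy0 : (0 : ℝ) ≤ y := by exact_mod_cast (by omega : (0 : ℤ) ≤ y)
    have hyN : (y : ℝ) ≤ N := by exact_mod_cast hy.2
    have hqy : (q : ℝ) * y ≤ ζ * m := (mul_le_mul_of_nonneg_left hyN (Nat.cast_nonneg _)).trans hN
    have hqy0 : (0 : ℝ) ≤ q * y := by positivity
    -- With dθ an integer plus ε, moving j by qdy changes the phase, modulo integers, by a multiple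
    -- of ε that stays small as long as qy ≤ ζm.
    have e1 : θ * ((j + q * d * y : ℤ) : ℝ) ^ 2 = θ * j ^ 2 +
        (((2 * j * q * y + q ^ 2 * y ^ 2 * d) * round (d * θ) : ℤ) +
          (2 * j * (q * y) + (q * y) ^ 2 * d) * ε) := by
      rw [hε]; push_cast; ring
    rw [e1, e_add, e_add, e_int, one_mul, norm_sub_rev, ← mul_sub_one, norm_mul, norm_e, one_mul]
    refine (norm_e_sub_one_le _).trans ?_
    rw [abs_mul, abs_of_nonneg (by positivity)]
    have h1 : 2 * j * (q * y) + (q * y : ℝ) ^ 2 * d ≤ 3 * ζ * m ^ 2 := by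
      calc 2 * j * (q * y) + (q * y : ℝ) ^ 2 * d ≤ 2 * m * (ζ * m) + (ζ * m) ^ 2 * Q := by gcongr
        _ = 2 * ζ * m ^ 2 + ζ * m ^ 2 * (ζ * Q) := by ring
        _ ≤ 2 * ζ * m ^ 2 + ζ * m ^ 2 * 1 := by gcongr
        _ = _ := by ring
    calc _ ≤ 7 * (3 * ζ * m ^ 2 * (Q / m ^ 2)) := by gcongr
      _ = _ := by field_simp; ring
  -- Of the constant 23, the boundary terms of the shift account for 2 and the variation of the
  -- phase for 21.
  have hy : ∀ y ∈ Icc 1 (N : ℤ), ‖∑ j ∈ Icc 1 (m : ℤ), g j * e (θ * j ^ 2) -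
      ∑ j ∈ Icc 1 (m : ℤ), g (j + q * d * y) * e (θ * j ^ 2)‖ ≤ 23 * (ζ * Q) * m := by
    intro y hy
    have hy' := mem_Icc.1 hy
    have hyN : (y : ℝ) ≤ N := by exact_mod_cast hy'.2
    have hy0 : (0 : ℝ) ≤ y := by exact_mod_cast (by omega : (0 : ℤ) ≤ y)
    lift y to ℕ using by omega
    have h1 := norm_sum_Icc_shift_sub_le (fun j => g j * e (θ * j ^ 2))
      (fun j => norm_mul_le_one (hg j) (norm_e _).le) 1 m (q * d * y)
    rw [norm_sub_rev] at h1
    push_cast at h1 hyN hy0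
    have h2 : (2 * (q * d * y) : ℝ) ≤ 2 * (ζ * Q) * m := by
      calc (2 * (q * d * y) : ℝ) ≤ 2 * (q * d * N) := by gcongr
        _ = 2 * d * (q * N) := by ring
        _ ≤ 2 * Q * (ζ * m) := by gcongr
        _ = _ := by ring
    have h3 : ‖∑ j ∈ Icc 1 (m : ℤ), g (j + q * d * y) * e (θ * (j + q * d * y) ^ 2) -
        ∑ j ∈ Icc 1 (m : ℤ), g (j + q * d * y) * e (θ * j ^ 2)‖ ≤ 21 * (ζ * Q) * m := by
      rw [← sum_sub_distrib]
      calc _ ≤ ∑ j ∈ Icc 1 (m : ℤ), 21 * (ζ * Q) := by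
            refine (norm_sum_le _ _).trans (sum_le_sum fun j hj => ?_)
            rw [← mul_sub, norm_mul, norm_sub_rev]
            have := hphase j hj y hy
            push_cast at this
            calc _ ≤ 1 * (21 * (ζ * Q)) := by gcongr; exact hg _
              _ = _ := one_mul _
        _ = _ := by rw [sum_const, card_Icc_one, nsmul_eq_mul]; ring
    refine (norm_sub_le_norm_sub_add_norm_sub _ _ _).trans ((add_le_add (h1.trans h2) h3).trans ?_)
    exact le_of_eq (by ring)
  have hsum : ((N : ℂ) * ∑ j ∈ Icc 1 (m : ℤ), g j * e (θ * j ^ 2)) =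
      ∑ y ∈ Icc 1 (N : ℤ), (∑ j ∈ Icc 1 (m : ℤ), g j * e (θ * j ^ 2) -
        ∑ j ∈ Icc 1 (m : ℤ), g (j + q * d * y) * e (θ * j ^ 2)) +
      ∑ j ∈ Icc 1 (m : ℤ), (∑ y ∈ Icc 1 (N : ℤ), g (j + q * d * y)) * e (θ * j ^ 2) := by
    simp_rw [sum_mul]
    rw [sum_sub_distrib, sum_const, card_Icc_one, nsmul_eq_mul,
      sum_comm (s := Icc 1 (m : ℤ)) (t := Icc 1 (N : ℤ)), sub_add_cancel]
  rw [← Complex.norm_natCast N, ← norm_mul, hsum]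
  refine (norm_add_le _ _).trans ?_
  rw [add_comm]
  refine add_le_add ((norm_sum_le _ _).trans (sum_le_sum fun j _ => ?_)) ?_
  · rw [norm_mul, norm_e, mul_one]
  · refine (norm_sum_le _ _).trans ((sum_le_sum hy).trans (le_of_eq ?_))
    rw [sum_const, card_Icc_one, nsmul_eq_mul, Complex.norm_natCast]
    ring

/-- Pigeonhole over the at most Q denominators, at the cost of a factor Q. -/
theorem exists_denominator {ι : Type*} [Fintype ι] {Q : ℝ} (hQ : 0 < Q) {m : ℕ} (θ w : ι → ℝ)
    (hw : ∀ x, 0 ≤ w x) {A : ℝ} (hA : 0 < A)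
    (h : Q * A ≤ ∑ x, open Classical in if Maj Q m (θ x) then w x else 0) :
    ∃ d : ℕ, 0 < d ∧ (d : ℝ) ≤ Q ∧
      A ≤ ∑ x, if distInt (d * θ x) ≤ Q / m ^ 2 then w x else 0 := by
  classical
  by_contra! hcon
  have h1 : ∑ x, (if Maj Q m (θ x) then w x else 0) ≤
      ∑ d ∈ Icc 1 ⌊Q⌋₊, ∑ x, if distInt (d * θ x) ≤ Q / m ^ 2 then w x else 0 := by
    rw [sum_comm]
    refine sum_le_sum fun x _ => ?_
    have h0 : ∀ d ∈ Icc 1 ⌊Q⌋₊, 0 ≤ if distInt (d * θ x) ≤ Q / m ^ 2 then w x else 0 := by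
      intro d _
      split_ifs
      exacts [hw x, le_rfl]
    split_ifs with hx
    · obtain ⟨d, hd, hdQ, hdx⟩ := hx
      refine le_trans ?_ (single_le_sum h0 (mem_Icc.2 ⟨hd, Nat.le_floor hdQ⟩))
      rw [if_pos hdx]
    · exact sum_nonneg h0
  have hlt : ∀ d ∈ Icc 1 ⌊Q⌋₊, (∑ x, if distInt (d * θ x) ≤ Q / m ^ 2 then w x else 0) < A := by
    intro d hd
    rw [mem_Icc] at hd
    exact hcon d hd.1 ((Nat.le_floor_iff hQ.le).1 hd.2)
  have hne : (Icc 1 ⌊Q⌋₊).Nonempty := by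
    by_contra hne
    rw [not_nonempty_iff_eq_empty] at hne
    rw [hne, sum_empty] at h1
    have := mul_pos hQ hA
    linarith
  have h2 := sum_lt_sum_of_nonempty hne hlt
  rw [sum_const, Nat.card_Icc, Nat.add_sub_cancel, nsmul_eq_mul] at h2
  have h3 := mul_le_mul_of_nonneg_right (Nat.floor_le hQ.le) hA.le
  linarith

/-- If the dual function correlates with characters on the fibres, then the major arc phases carry a
large correlation of `f₁` with quadratic phases. -/
theorem major_arc_correlation {q P m : ℕ} [NeZero q] [NeZero P] [NeZero (q * P)] (hm : 1 ≤ m)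
    {η : ℝ} (hη : 0 < η) (hη1 : η ≤ 1 / 2 ^ 40) (hηm : 1 ≤ η ^ 300 * m) {f₀ f₁ : ZMod (q * P) → ℂ}
    (h₀ : ∀ x, ‖f₀ x‖ ≤ 1) (h₁ : ∀ x, ‖f₁ x‖ ≤ 1) (χ : ZMod q → ZMod (q * P))
    (h : η * (q * P) ≤ ∑ ρ, ‖∑ x with fib q P x = ρ,
      dualAvg (q : ZMod (q * P)) m f₀ f₁ x * ZMod.stdAddChar (χ ρ * x)‖) :
    η ^ 3 * (q * P) * m ≤
      ∑ x, open Classical in if MajRes (η ^ 369)⁻¹ m (cofib q P (χ (fib q P x))) then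
          ‖∑ j ∈ Icc 1 (m : ℤ), f₁ (x + (j : ZMod (q * P))) *
            e (((cofib q P (χ (fib q P x))).val : ℝ) / P * j ^ 2)‖ else 0 := by
  classical
  set F := dualAvg (q : ZMod (q * P)) m f₀ f₁ with hF
  have hF1 : ∀ x, ‖F x‖ ≤ 1 := by rw [hF]; exact norm_dualAvg_le _ _ h₀ h₁
  have hη2 : η ≤ 1 := hη1.trans (by norm_num)
  have hP0 : (0 : ℝ) < P := by exact_mod_cast Nat.pos_of_ne_zero (NeZero.ne P)
  have hPC : (P : ℂ) ≠ 0 := Nat.cast_ne_zero.2 (NeZero.ne P)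
  have hm0 : (0 : ℝ) < m := by exact_mod_cast hm
  set S : ZMod q → ℂ := fun ρ => ∑ x with fib q P x = ρ,
    F x * ZMod.stdAddChar (χ ρ * x) with hS
  have hSP : ∀ ρ, ‖S ρ‖ ≤ P := fun ρ => norm_fibre_sum_le hF1 _ _
  have hu : ∀ ρ, ‖conj (S ρ) / P‖ ≤ 1 := by
    intro ρ
    rw [norm_div, RCLike.norm_conj, Complex.norm_natCast]
    exact div_le_one_of_le₀ (hSP ρ) hP0.le
  have hsq : η ^ 2 * (q * P ^ 2) ≤ ∑ ρ, ‖S ρ‖ ^ 2 := by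
    have := sq_mul_le_of_mul_le_sum univ (fun ρ => ‖S ρ‖) hη.le hP0.le
      (by rw [card_univ, ZMod.card]; exact h)
    rwa [card_univ, ZMod.card] at this
  have heq : ∑ j ∈ Icc 1 (m : ℤ), ∑ x, conj (S (fib q P x)) / P * f₀ (x - q * j ^ 2) *
      f₁ (x + j - q * j ^ 2) * ZMod.stdAddChar (χ (fib q P x) * x) =
      ((m / P * ∑ ρ, ‖S ρ‖ ^ 2 : ℝ) : ℂ) := by
    push_cast
    rw [sum_comm, mul_sum, ← sum_fiberwise univ (fib q P)]
    refine sum_congr rfl fun ρ _ => ?_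
    have hx : ∀ x ∈ ({x | fib q P x = ρ} : Finset (ZMod (q * P))),
        ∑ j ∈ Icc 1 (m : ℤ), conj (S (fib q P x)) / P * f₀ (x - q * j ^ 2) *
        f₁ (x + j - q * j ^ 2) * ZMod.stdAddChar (χ (fib q P x) * x) =
        m / P * conj (S ρ) * (F x * ZMod.stdAddChar (χ ρ * x)) := by
      intro x hx
      rw [(mem_filter.1 hx).2]
      have := mul_dualAvg (q : ZMod (q * P)) hm f₀ f₁ x
      rw [← hF] at this
      calc _ = conj (S ρ) / P * ZMod.stdAddChar (χ ρ * x) * dualSum (q : ZMod (q * P)) m f₀ f₁ x := by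
            rw [dualSum, mul_sum]
            refine sum_congr rfl fun j _ => ?_
            ring
        _ = _ := by rw [← this]; ring
    rw [sum_congr rfl hx, ← mul_sum]
    change _ * S ρ = _
    rw [← Complex.ofReal_pow, ← Complex.normSq_eq_norm_sq, ← Complex.mul_conj]
    ring
  have hη3 : (η ^ 3) ≤ 1 / 1024 := (pow_le_of_le_one hη.le hη2 (by norm_num)).trans
    (hη1.trans (by norm_num))
  have hmain := norm_sum_phase_le_sum (pow_pos hη 3) hη3 (by rw [← pow_mul]; exact hηm)
    (fun ρ => conj (S ρ) / P) hu f₀ f₁ h₀ h₁ χ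
  rw [heq, Complex.norm_real, Real.norm_of_nonneg (by positivity), ← pow_mul] at hmain
  have hlow : η ^ 2 * (q * P) * m ≤ m / P * ∑ ρ, ‖S ρ‖ ^ 2 := by
    calc _ = m / P * (η ^ 2 * (q * P ^ 2)) := by field_simp
      _ ≤ _ := by gcongr
  have hle : ∑ x, (if MajRes (η ^ (3 * 123))⁻¹ m (cofib q P (χ (fib q P x))) then
      ‖conj (S (fib q P x)) / P‖ * ‖∑ j ∈ Icc 1 (m : ℤ), f₁ (x + (j : ZMod (q * P))) *
        e (((cofib q P (χ (fib q P x))).val : ℝ) / P * j ^ 2)‖ else 0) ≤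
      ∑ x, if MajRes (η ^ 369)⁻¹ m (cofib q P (χ (fib q P x))) then
        ‖∑ j ∈ Icc 1 (m : ℤ), f₁ (x + (j : ZMod (q * P))) *
          e (((cofib q P (χ (fib q P x))).val : ℝ) / P * j ^ 2)‖ else 0 := by
    refine sum_le_sum fun x _ => ?_
    norm_num only
    split_ifs
    · exact mul_le_of_le_one_left (norm_nonneg _) (hu _)
    · exact le_rfl
  have h2 : 2 * (η ^ 3 * (q * P) * m) ≤ η ^ 2 * (q * P) * m := by
    calc _ = η ^ 2 * (q * P) * m * (2 * η) := by ring
      _ ≤ η ^ 2 * (q * P) * m * 1 :=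
        mul_le_mul_of_nonneg_left (by linarith) (by positivity)
      _ = _ := mul_one _
  linarith

/-- If the dual function correlates with characters on the fibres, then `f₁` has large averages on
progressions. -/
theorem exists_local_of_char {q P m : ℕ} [NeZero q] [NeZero P] [NeZero (q * P)] (hm : 1 ≤ m)
    {η : ℝ} (hη : 0 < η) (hη1 : η ≤ 1 / 2 ^ 40) (hηm : 1 ≤ η ^ 300 * m) {f₀ f₁ : ZMod (q * P) → ℂ}
    (h₀ : ∀ x, ‖f₀ x‖ ≤ 1) (h₁ : ∀ x, ‖f₁ x‖ ≤ 1) (χ : ZMod q → ZMod (q * P))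
    (h : η * (q * P) ≤ ∑ ρ, ‖∑ x with fib q P x = ρ,
      dualAvg (q : ZMod (q * P)) m f₀ f₁ x * ZMod.stdAddChar (χ ρ * x)‖) :
    ∃ d : ℕ, 0 < d ∧ (d : ℝ) ≤ (η ^ 369)⁻¹ ∧ ∀ N : ℕ, (q : ℝ) * N ≤ η ^ 742 * m →
      η ^ 373 * (q * P) * N ≤ ∑ x : ZMod (q * P), ‖∑ y ∈ Icc 1 (N : ℤ), f₁ (x + q * d * y)‖ := by
  have hη2 : η ≤ 1 := hη1.trans (by norm_num)
  have hm0 : (0 : ℝ) < m := by exact_mod_cast hm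
  have hP0 : (0 : ℝ) < P := by exact_mod_cast Nat.pos_of_ne_zero (NeZero.ne P)
  have hq0 : (0 : ℝ) < q := by exact_mod_cast Nat.pos_of_ne_zero (NeZero.ne q)
  have h1 := major_arc_correlation hm hη hη1 hηm h₀ h₁ χ h
  have hQA : (η ^ 369)⁻¹ * (η ^ 372 * (q * P) * m) = η ^ 3 * (q * P) * m := by
    rw [show 372 = 369 + 3 from rfl, pow_add, mul_assoc (η ^ 369), mul_assoc (η ^ 369),
      inv_mul_cancel_left₀ (by positivity)]
  obtain ⟨d, hd0, hdQ, hd⟩ := exists_denominator (Q := (η ^ 369)⁻¹) (m := m) (by positivity)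
    (fun x => ((cofib q P (χ (fib q P x))).val : ℝ) / P)
    (fun x => ‖∑ j ∈ Icc 1 (m : ℤ), f₁ (x + (j : ZMod (q * P))) *
            e (((cofib q P (χ (fib q P x))).val : ℝ) / P * j ^ 2)‖)
    (fun x => norm_nonneg _) (A := η ^ 372 * (q * P) * m) (by positivity)
    ((le_of_eq hQA).trans h1)
  refine ⟨d, hd0, hdQ, fun N hN => ?_⟩
  -- The exponent 742 makes the error 23η ^ 373 smaller than the main term η ^ 372 left after
  -- pigeonholing the denominator.
  have hζQ : η ^ 742 * (η ^ 369)⁻¹ = η ^ 373 := by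
    rw [show 742 = 373 + 369 from rfl, pow_add, mul_assoc, mul_inv_cancel₀ (by positivity), mul_one]
  have hx : ∀ x : ZMod (q * P), N * (if distInt (d * (((cofib q P (χ (fib q P x))).val : ℝ) / P)) ≤
      (η ^ 369)⁻¹ / m ^ 2 then ‖∑ j ∈ Icc 1 (m : ℤ), f₁ (x + (j : ZMod (q * P))) *
            e (((cofib q P (χ (fib q P x))).val : ℝ) / P * j ^ 2)‖ else 0) ≤
      ∑ j ∈ Icc 1 (m : ℤ), ‖∑ y ∈ Icc 1 (N : ℤ), f₁ (x + q * d * y + j)‖ + 23 * η ^ 373 * m * N := by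
    intro x
    split_ifs with hθ
    · have := mul_norm_sum_phase_le (g := fun j => f₁ (x + (j : ZMod (q * P)))) (fun j => h₁ _) hm
        (by positivity : 0 ≤ η ^ 742) (by positivity) (by rw [hζQ]; exact pow_le_one₀ hη.le hη2)
        hdQ hθ hN
      rw [hζQ] at this
      refine this.trans (le_of_eq ?_)
      congr 1
      refine sum_congr rfl fun j _ => ?_
      congr 1
      refine sum_congr rfl fun y _ => ?_
      push_cast
      ring_nf
    · rw [mul_zero]
      positivity
  have hsum := sum_le_sum (s := univ) fun x _ => hx x
  rw [← mul_sum, sum_add_distrib, sum_comm, sum_const, card_univ, ZMod.card, nsmul_eq_mul] at hsum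
  have hsh : ∀ j : ℤ, ∑ x : ZMod (q * P), ‖∑ y ∈ Icc 1 (N : ℤ), f₁ (x + q * d * y + j)‖ =
      ∑ x : ZMod (q * P), ‖∑ y ∈ Icc 1 (N : ℤ), f₁ (x + q * d * y)‖ := by
    intro j
    rw [← sum_shift (j : ZMod (q * P)) (fun x => ‖∑ y ∈ Icc 1 (N : ℤ), f₁ (x + q * d * y)‖)]
    refine sum_congr rfl fun x _ => ?_
    simp_rw [add_right_comm]
  simp_rw [hsh] at hsum
  rw [sum_const, card_Icc_one, nsmul_eq_mul] at hsum
  push_cast at hsum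
  have hlow := (mul_le_mul_of_nonneg_left hd (Nat.cast_nonneg N)).trans hsum
  refine le_of_mul_le_mul_left (a := (m : ℝ)) ?_ hm0
  have h24 : 24 * (η ^ 373 * (q * P) * m * N) ≤ η ^ 372 * (q * P) * m * N := by
    have h0 : 0 ≤ (q * P : ℝ) * m * N := by positivity
    calc _ = η ^ 372 * ((q * P) * m * N) * (24 * η) := by ring
      _ ≤ η ^ 372 * ((q * P) * m * N) * 1 :=
        mul_le_mul_of_nonneg_left (by linarith only [hη1]) (mul_nonneg (pow_nonneg hη.le _) h0)
      _ = _ := by rw [mul_one, mul_assoc (η ^ 372), mul_assoc (η ^ 372), mul_assoc _ (m : ℝ)]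
  linarith

/-! ### Transfer to the integers -/

/-- In a cyclic group, a large count forces large averages of `f₁` on progressions. -/
theorem exists_local_of_count {q P m : ℕ} [NeZero q] [NeZero P] [NeZero (q * P)] (hm : 1 ≤ m)
    (hP : 16 * m ^ 2 < P) (hP' : P ≤ 80 * m ^ 2) {η κ δ : ℝ} (hη : 0 < η) (hη1 : η ≤ 1 / 2 ^ 40)
    {c : ℕ} (hc : c = 29054267286336) (hκ : η ^ c = κ) (hκm : 1 ≤ κ ^ 300 * m) (hδ : 0 ≤ δ) (hηδ : η ≤ δ ^ 2)
    {f₀ f₁ f₂ : ZMod (q * P) → ℂ} (h₀ : ∀ x, ‖f₀ x‖ ≤ 1) (h₁ : ∀ x, ‖f₁ x‖ ≤ 1)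
    (h₂ : ∀ x, ‖f₂ x‖ ≤ 1)
    (h : δ * (q * P : ℕ) * m ≤ ‖∑ z : ZMod (q * P), ∑ y ∈ Icc 1 (m : ℤ),
      f₀ z * f₁ (z + y) * f₂ (z + q * y ^ 2)‖) :
    ∃ d : ℕ, 0 < d ∧ (d : ℝ) ≤ (κ ^ 369)⁻¹ ∧ ∀ N : ℕ, (q : ℝ) * N ≤ κ ^ 742 * m →
      κ ^ 373 * (q * P) * N ≤ ∑ x : ZMod (q * P), ‖∑ y ∈ Icc 1 (N : ℤ), f₁ (x + q * d * y)‖ := by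
  have hκ0 : 0 < κ := hκ ▸ pow_pos hη _
  have hκ1 : κ ≤ 1 / 2 ^ 40 := hκ ▸ pow_le_bound hη hη1 (by norm_num) (by omega)
  have hκm1 : 1 ≤ κ * m := by
    have := one_le_pow_mul (a := 1) hκ0 (hκ1.trans (by norm_num)) (Nat.cast_nonneg m) hκm
      (by norm_num)
    rwa [pow_one] at this
  have hd := count_dual_ge (q : ZMod (q * P)) hm f₀ f₁ f₂ h₂ hδ (by rwa [ZMod.card])
  rw [ZMod.card] at hd
  obtain ⟨χ, hχ⟩ := exists_char_dual hm hP hP' hη hη1 (by rwa [← hc, hκ]) f₀ f₁ h₀ h₁ _ rfl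
    (le_trans (by
      push_cast
      have : (0 : ℝ) ≤ (q * P) * m := by positivity
      rw [mul_assoc, mul_assoc (δ ^ 2)]
      exact mul_le_mul_of_nonneg_right hηδ this) hd)
  rw [← hc, hκ] at hχ
  exact exists_local_of_char hm hκ0 hκ1 hκm h₀ h₁ χ hχ

theorem sum_zmod_eq_sum_Ico {n : ℕ} [NeZero n] {E : Type*} [AddCommMonoid E] (c : ℤ)
    (g : ZMod n → E) : ∑ x, g x = ∑ a ∈ Ico c (c + n), g (a : ZMod n) := by
  have hn : (0 : ℤ) < n := by exact_mod_cast Nat.pos_of_ne_zero (NeZero.ne n)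
  symm
  refine sum_bij (fun a _ => (a : ZMod n)) (fun _ _ => mem_univ _) ?_ ?_ (fun _ _ => rfl)
  · intro a ha b hb hab
    rw [mem_Ico] at ha hb
    rw [ZMod.intCast_eq_intCast_iff_dvd_sub] at hab
    have := Int.eq_zero_of_abs_lt_dvd hab (by rw [abs_lt]; omega)
    omega
  · intro x _
    refine ⟨c + ((x.val : ℤ) - c) % n, ?_, ?_⟩
    · rw [mem_Ico]
      have h1 := Int.emod_nonneg ((x.val : ℤ) - c) hn.ne'
      have h2 := Int.emod_lt_of_pos ((x.val : ℤ) - c) hn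
      omega
    · have : ((((x.val : ℤ) - c) % n : ℤ) : ZMod n) = ((x.val : ℤ) - c : ℤ) := by
        rw [ZMod.intCast_mod]
      push_cast at this ⊢
      rw [this, add_sub_cancel, ZMod.natCast_zmod_val]

theorem sum_Icc_natCast {E : Type*} [AddCommMonoid E] (m : ℕ) (g : ℤ → E) :
    ∑ y ∈ Icc 1 m, g y = ∑ y ∈ Icc 1 (m : ℤ), g y :=
  sum_bij (fun y _ => (y : ℤ)) (by intro y hy; rw [mem_Icc] at *; omega)
    (by intro a _ b _ h; exact_mod_cast h)
    (by
      intro b hb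
      rw [mem_Icc] at hb
      exact ⟨b.toNat, by rw [mem_Icc]; omega, by omega⟩) (fun _ _ => rfl)

/-- The function on `ZMod n` induced by a function on the integers. -/
def periodise (n : ℕ) (f : ℤ → ℂ) (x : ZMod n) : ℂ := f x.val

/-- A negative argument is represented by a + n, which exceeds N, so both sides vanish there. -/
theorem periodise_intCast {n N m : ℕ} [NeZero n] {f : ℤ → ℂ} (hf : SupportedIn N f)
    (hn : N + m < n) {a : ℤ} (ha : -m ≤ a) (ha' : a < n) : periodise n f (a : ZMod n) = f a := by
  have hv : (((a : ZMod n).val : ℕ) : ℤ) = a % n := ZMod.val_intCast a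
  rw [periodise, hv]
  rcases le_or_gt 0 a with h | h
  · rw [Int.emod_eq_of_lt h ha']
  · have : a % n = a + n := by
      rw [← Int.add_emod_right, Int.emod_eq_of_lt (by omega) (by omega)]
    rw [this, hf _ (by rw [Set.mem_Icc]; omega), hf _ (by rw [Set.mem_Icc]; omega)]

theorem countOp_eq_sum {N q : ℕ} {f₀ f₁ f₂ : ℤ → ℂ} (h₀ : SupportedIn N f₀) {s : Finset ℤ}
    (hs : Icc 1 (N : ℤ) ⊆ s) :
    countOp N q f₀ f₁ f₂ = ∑ x ∈ s, ∑ y ∈ Icc 1 (⌊scale N q⌋₊ : ℤ),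
      f₀ x * f₁ (x + y) * f₂ (x + q * y ^ 2) := by
  rw [countOp, tsum_eq_sum (s := s)]
  · refine sum_congr rfl fun x _ => ?_
    rw [seg, sum_Icc_natCast _ (fun y => f₀ x * f₁ (x + y) * f₂ (x + q * y ^ 2))]
  · intro x hx
    have : f₀ x = 0 := h₀ x fun h => hx (hs (by rw [mem_Icc]; exact h))
    simp [this]

theorem norm_countOp_le {N q : ℕ} {f₀ f₁ f₂ : ℤ → ℂ} (b₀ : OneBounded f₀) (b₂ : OneBounded f₂)
    (h₀ : SupportedIn N f₀) (h₁ : SupportedIn N f₁) :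
    ‖countOp N q f₀ f₁ f₂‖ ≤ ⌊scale N q⌋₊ * ∑ x ∈ Icc 1 (N : ℤ), ‖f₁ x‖ := by
  rw [countOp_eq_sum h₀ Subset.rfl, sum_comm]
  refine (norm_sum_le _ _).trans ?_
  have : ∀ y ∈ Icc 1 (⌊scale N q⌋₊ : ℤ), ‖∑ x ∈ Icc 1 (N : ℤ),
      f₀ x * f₁ (x + y) * f₂ (x + q * y ^ 2)‖ ≤ ∑ x ∈ Icc 1 (N : ℤ), ‖f₁ x‖ := by
    intro y _
    calc _ ≤ ∑ x ∈ Icc 1 (N : ℤ), ‖f₁ (x + y)‖ := by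
          refine (norm_sum_le _ _).trans (sum_le_sum fun x _ => ?_)
          rw [norm_mul, norm_mul]
          calc _ ≤ 1 * ‖f₁ (x + y)‖ * 1 := by
                gcongr
                exacts [b₀ _, b₂ _]
            _ = _ := by ring
      _ = ∑ x ∈ (Icc 1 (N : ℤ)).map (addRightEmbedding y), ‖f₁ x‖ := by
          rw [sum_map]; rfl
      _ ≤ ∑ x ∈ (Icc 1 (N : ℤ)).map (addRightEmbedding y) ∪ Icc 1 (N : ℤ), ‖f₁ x‖ :=
          sum_le_sum_of_subset_of_nonneg subset_union_left fun _ _ _ => norm_nonneg _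
      _ = _ := by
          symm
          refine sum_subset subset_union_right fun x _ hx => ?_
          rw [h₁ x (by rwa [mem_Icc] at hx), norm_zero]
  refine (sum_le_sum this).trans (le_of_eq ?_)
  rw [sum_const, card_Icc_one, nsmul_eq_mul]

theorem sum_le_localSum {N : ℕ} {f : ℤ → ℂ} (hf : SupportedIn N f) (D K : ℕ) (s : Finset ℤ) :
    ∑ x ∈ s, ‖∑ y ∈ Icc 1 (K : ℤ), f (x + D * y)‖ ≤ localSum D K f := by
  have e1 : localSum D K f = ∑' x : ℤ, ‖∑ y ∈ Icc 1 (K : ℤ), f (x + D * y)‖ := by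
    rw [localSum]
    refine tsum_congr fun x => ?_
    rw [seg, Nat.floor_natCast, sum_Icc_natCast _ (fun y => f (x + D * y))]
  have hz : ∀ x ∉ Icc (-(D * K) : ℤ) N, ‖∑ y ∈ Icc 1 (K : ℤ), f (x + D * y)‖ = 0 := by
    intro x hx
    rw [norm_eq_zero]
    refine sum_eq_zero fun y hy => hf _ fun h => hx ?_
    rw [mem_Icc] at hy ⊢
    rw [Set.mem_Icc] at h
    have h1 : (D : ℤ) * y ≤ D * K := mul_le_mul_of_nonneg_left hy.2 (Int.natCast_nonneg _)
    have h2 : 0 ≤ (D : ℤ) * y := mul_nonneg (Int.natCast_nonneg _) (by omega)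
    omega
  rw [e1]
  exact Summable.sum_le_tsum s (fun _ _ => norm_nonneg _) (summable_of_ne_finset_zero hz)

/-- The count in the integers agrees with the count of the induced functions on a cyclic group. -/
theorem sum_periodise_eq_countOp {n N q m : ℕ} [NeZero n] {f₀ f₁ f₂ : ℤ → ℂ}
    (h₀ : SupportedIn N f₀) (h₁ : SupportedIn N f₁) (h₂ : SupportedIn N f₂)
    (hm : ⌊scale N q⌋₊ = m) (hq : 0 < q) (hmN : q * m ^ 2 ≤ N) (hn : 2 * N < n) :
    ∑ z : ZMod n, ∑ y ∈ Icc 1 (m : ℤ), periodise n f₀ z * periodise n f₁ (z + y) *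
      periodise n f₂ (z + q * y ^ 2) = countOp N q f₀ f₁ f₂ := by
  have hsub : Icc 1 (N : ℤ) ⊆ Ico 0 (0 + n : ℤ) := by
    intro x hx
    rw [mem_Icc] at hx
    rw [mem_Ico]
    omega
  have hin : ∀ y ∈ Icc 1 (m : ℤ), (y ≤ N ∧ 0 ≤ q * y ^ 2) ∧ q * y ^ 2 ≤ N := by
    intro y hy
    rw [mem_Icc] at hy
    have h2 : y ^ 2 ≤ (m : ℤ) ^ 2 := pow_le_pow_left₀ (by omega) hy.2 2
    have h3 : (q : ℤ) * y ^ 2 ≤ N := (mul_le_mul_of_nonneg_left h2 (Int.natCast_nonneg q)).trans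
      (by exact_mod_cast hmN)
    refine ⟨⟨?_, by positivity⟩, h3⟩
    have hq1 : (1 : ℤ) ≤ q := by exact_mod_cast hq
    nlinarith
  rw [countOp_eq_sum h₀ hsub, sum_zmod_eq_sum_Ico 0, hm]
  refine sum_congr rfl fun x hx => sum_congr rfl fun y hy => ?_
  rw [mem_Ico] at hx
  obtain ⟨⟨g1, g2⟩, g3⟩ := hin y hy
  rw [mem_Icc] at hy
  have p₀ := periodise_intCast (n := n) (m := 0) h₀ (by omega) (a := x) (by omega) (by omega)
  rw [p₀]
  by_cases hxN : x ∈ Set.Icc (1 : ℤ) N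
  · rw [Set.mem_Icc] at hxN
    have p₁ := periodise_intCast (n := n) (m := 0) h₁ (by omega) (a := x + y) (by omega) (by omega)
    have p₂ := periodise_intCast (n := n) (m := 0) h₂ (by omega) (a := x + q * y ^ 2) (by omega)
      (by omega)
    push_cast at p₁ p₂
    rw [p₁, p₂]
  · simp [h₀ x hxN]

/-- The window of representatives starts at -m, so that a shift by at most DK ≤ m stays below n. -/
theorem sum_periodise_le_localSum {n N m : ℕ} [NeZero n] {f : ℤ → ℂ} (hf : SupportedIn N f)
    (hn : N + m < n) (D K : ℕ) (hDK : D * K ≤ m) :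
    ∑ x : ZMod n, ‖∑ y ∈ Icc 1 (K : ℤ), periodise n f (x + D * y)‖ ≤ localSum D K f := by
  rw [sum_zmod_eq_sum_Ico (-m : ℤ)]
  refine le_trans (le_of_eq ?_) (sum_le_localSum hf D K (Ico (-m : ℤ) (-m + n)))
  refine sum_congr rfl fun x hx => ?_
  congr 1
  refine sum_congr rfl fun y hy => ?_
  rw [mem_Ico] at hx
  rw [mem_Icc] at hy
  have h1 : (D : ℤ) * y ≤ D * K := mul_le_mul_of_nonneg_left hy.2 (Int.natCast_nonneg _)
  have h2 : 0 ≤ (D : ℤ) * y := mul_nonneg (Int.natCast_nonneg _) (by omega)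
  have h3 : (D : ℤ) * K ≤ m := by exact_mod_cast hDK
  have := periodise_intCast hf hn (a := x + D * y) (by omega) (by omega)
  push_cast at this
  exact this

/-! ### Choice of parameters and conclusion. -/

theorem pow_pow_pow_eq {x : ℝ} {a b c t : ℕ} (h : a * b * c = t) : ((x ^ a) ^ b) ^ c = x ^ t := by
  rw [← pow_mul, ← pow_mul, ← mul_assoc, h]

theorem sum_norm_le_of_supportedIn {N : ℕ} {f : ℤ → ℂ} (b : OneBounded f) :
    ∑ x ∈ Icc 1 (N : ℤ), ‖f x‖ ≤ N := by
  calc _ ≤ ∑ x ∈ Icc 1 (N : ℤ), (1 : ℝ) := sum_le_sum fun x _ => b x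
    _ = N := by rw [sum_const, card_Icc_one, nsmul_eq_mul, mul_one]

theorem le_sum_norm_of_le_countOp {N q : ℕ} {f₀ f₁ f₂ : ℤ → ℂ} (b₀ : OneBounded f₀)
    (b₂ : OneBounded f₂) (h₀ : SupportedIn N f₀) (h₁ : SupportedIn N f₁) (hM : 0 < scale N q)
    {δ : ℝ} (h : δ * N * scale N q ≤ ‖countOp N q f₀ f₁ f₂‖) :
    δ * N ≤ ∑ x ∈ Icc 1 (N : ℤ), ‖f₁ x‖ := by
  refine le_of_mul_le_mul_right ?_ hM
  refine h.trans ((norm_countOp_le b₀ b₂ h₀ h₁).trans ?_)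
  rw [mul_comm]
  exact mul_le_mul_of_nonneg_left (Nat.floor_le hM.le) (sum_nonneg fun _ _ => norm_nonneg _)

/-- The cyclic statement is applied with modulus q·20(m + 1)², which lies between 20N and 80N. Here
b collects all numerical constants, so that κ ^ 742 = δ ^ t / b. -/
theorem exists_local_of_countOp {N q : ℕ} {f₀ f₁ f₂ : ℤ → ℂ} {δ : ℝ} (hq : 0 < q) (hδ : 0 < δ)
    (b₀ : OneBounded f₀) (b₁ : OneBounded f₁) (b₂ : OneBounded f₂) (h₀ : SupportedIn N f₀)
    (h₁ : SupportedIn N f₁) (h₂ : SupportedIn N f₂) (hqN : q ≤ N) (hδ1 : δ ≤ 1)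
    (h : δ * N * scale N q ≤ ‖countOp N q f₀ f₁ f₂‖) {t : ℕ} {b : ℝ} (hb : 1 ≤ b)
    {c : ℕ} (hc : c = 29054267286336) (ht : 2 * c * 742 = t) (hbt : (2 ^ 20) ^ t = b) :
    ∃ q' N' : ℕ, 0 < q' ∧ 0 < N' ∧ (q' : ℝ) ≤ b * (δ ^ t)⁻¹ ∧
      δ ^ t * scale N q / q ≤ 4 * b * N' ∧ (N' : ℝ) ≤ scale N q ∧
      δ ^ t * N * N' ≤ b * localSum (q * q') N' f₁ := by
  have hq0 : (0 : ℝ) < q := by exact_mod_cast hq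
  have hb0 : 0 < b := one_pos.trans_le hb
  have hN0 : (0 : ℝ) < N := by exact_mod_cast hq.trans_le hqN
  have hM1 : 1 ≤ scale N q := by
    rw [scale, Real.one_le_sqrt, one_le_div hq0]
    exact_mod_cast hqN
  have hMsq : q * scale N q ^ 2 = N := by
    rw [scale, Real.sq_sqrt (by positivity)]
    field_simp
  obtain ⟨m, hm⟩ : ∃ m, ⌊scale N q⌋₊ = m := ⟨_, rfl⟩
  have hm1 : 1 ≤ m := hm ▸ Nat.le_floor (by exact_mod_cast hM1)
  have hm1R : (1 : ℝ) ≤ m := by exact_mod_cast hm1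
  have hmM : (m : ℝ) ≤ scale N q := hm ▸ Nat.floor_le (by positivity)
  have hMm : scale N q < m + 1 := hm ▸ Nat.lt_floor_add_one _
  have hmN : q * m ^ 2 ≤ N := by
    have : (q : ℝ) * m ^ 2 ≤ N := by rw [← hMsq]; gcongr
    exact_mod_cast this
  have hNm : N ≤ q * (m + 1) ^ 2 := by
    have : (N : ℝ) ≤ q * (m + 1) ^ 2 := by rw [← hMsq]; gcongr
    exact_mod_cast this
  have hf₁ := le_sum_norm_of_le_countOp b₀ b₂ h₀ h₁ (one_pos.trans_le hM1) h
  have ht0 : t ≠ 0 := by omega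
  have hδt : δ ^ t ≤ δ := pow_le_of_le_one hδ.le hδ1 ht0
  have hδt0 : 0 < δ ^ t := pow_pos hδ _
  set δt := δ ^ t with hδt_def
  -- If m is this small, the required lower bound for N' is at most 1, and q' = N' = 1 works: the
  -- local sum is then at least the ℓ¹ norm of f₁, which the trivial bound on the count makes at
  -- least δN.
  by_cases hcase : δt * m < b * q
  · refine ⟨1, 1, one_pos, one_pos, ?_, ?_, by exact_mod_cast hM1, ?_⟩
    · rw [← div_eq_mul_inv, Nat.cast_one, one_le_div hδt0]
      exact (hδt.trans hδ1).trans hb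
    · rw [div_le_iff₀ hq0, Nat.cast_one, mul_one]
      have : δt * scale N q ≤ δt * (2 * m) := by gcongr; linarith
      have hbq : 0 < b * q := by positivity
      linarith
    · have := sum_le_localSum h₁ (q * 1) 1 ((Icc 1 (N : ℤ)).map (addRightEmbedding (-q : ℤ)))
      rw [sum_map] at this
      simp only [addRightEmbedding_apply, mul_one, Nat.cast_one, Icc_self, sum_singleton,
        neg_add_cancel_right] at this
      rw [Nat.cast_one, mul_one, mul_one]
      have hs : 0 ≤ localSum q 1 f₁ := le_trans (sum_nonneg fun _ _ => norm_nonneg _) this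
      calc δt * N ≤ δ * N := by gcongr
        _ ≤ 1 * localSum q 1 f₁ := by rw [one_mul]; exact hf₁.trans this
        _ ≤ _ := by gcongr
  rw [not_lt] at hcase
  -- The value η = (δ / 2 ^ 20) ^ 2 is below both 2 ^ (-40) and (δ / 80) ^ 2; the 80 comes from qP ≤
  -- 80N and the square from passing to the dual function.
  have hη1 : (δ / 2 ^ 20) ^ 2 ≤ 1 / 2 ^ 40 := by
    rw [div_pow, ← pow_mul]
    exact div_le_div_of_nonneg_right (pow_le_one₀ hδ.le hδ1) (by positivity)
  have hη : 0 < (δ / 2 ^ 20) ^ 2 := by positivity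
  obtain ⟨κ, hκ⟩ : ∃ κ, ((δ / 2 ^ 20) ^ 2) ^ c = κ := ⟨_, rfl⟩
  have hκ0 : 0 < κ := hκ ▸ pow_pos hη _
  have hκ1 : κ ≤ 1 := hκ ▸ pow_le_one₀ hη.le (hη1.trans (by norm_num))
  have hκt : κ ^ 742 = δt / b := by
    rw [← hκ, pow_pow_pow_eq ht, div_pow, hbt]
  clear_value δt
  have hκm : 1 ≤ κ ^ 742 * m := by
    rw [hκt, div_mul_eq_mul_div, one_le_div hb0]
    refine le_trans ?_ hcase
    have : (1 : ℝ) ≤ q := by exact_mod_cast hq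
    exact le_mul_of_one_le_right hb0.le this
  obtain ⟨P, hP⟩ : ∃ P, P = 20 * (m + 1) ^ 2 := ⟨_, rfl⟩
  have hP1 : 16 * m ^ 2 < P := by rw [hP]; nlinarith
  have hP2 : P ≤ 80 * m ^ 2 := by rw [hP]; nlinarith
  have hPpos : 0 < P := by omega
  have : NeZero q := ⟨hq.ne'⟩
  have : NeZero P := ⟨hPpos.ne'⟩
  have hn20 : 20 * N ≤ q * P := by
    calc 20 * N ≤ 20 * (q * (m + 1) ^ 2) := by gcongr
      _ = q * P := by rw [hP]; ring
  have hn80 : q * P ≤ 80 * N := by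
    calc q * P ≤ q * (80 * m ^ 2) := by gcongr
      _ = 80 * (q * m ^ 2) := by ring
      _ ≤ 80 * N := by gcongr
  have hNpos : 0 < N := hq.trans_le hqN
  have : NeZero (q * P) := ⟨by positivity⟩
  have hmleN : m ≤ N := by nlinarith
  obtain ⟨d, hd0, hdQ, hloc⟩ := exists_local_of_count hm1 hP1 hP2 hη hη1 hc hκ
    (one_le_pow_mul hκ0 hκ1 (Nat.cast_nonneg m) hκm (by norm_num)) (δ := δ / 80) (by positivity)
    (by rw [div_pow, div_pow]; gcongr; norm_num)
    (f₀ := periodise (q * P) f₀) (f₁ := periodise (q * P) f₁) (f₂ := periodise (q * P) f₂)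
    (fun x => b₀ _) (fun x => b₁ _) (fun x => b₂ _) (by
      rw [sum_periodise_eq_countOp h₀ h₁ h₂ hm hq hmN (by omega)]
      refine le_trans ?_ h
      have : ((q * P : ℕ) : ℝ) ≤ 80 * N := by exact_mod_cast hn80
      calc δ / 80 * (q * P : ℕ) * m ≤ δ / 80 * (80 * N) * scale N q := by gcongr
        _ = _ := by ring)
  -- The longest admissible progression; K ≥ 1 because the complementary case gives q ≤ κ ^ 742 m.
  obtain ⟨K, hK⟩ : ∃ K, ⌊κ ^ 742 * m / q⌋₊ = K := ⟨_, rfl⟩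
  have hKm : (K : ℝ) ≤ κ ^ 742 * m / q := hK ▸ Nat.floor_le (by positivity)
  have hmK : κ ^ 742 * m / q < K + 1 := hK ▸ Nat.lt_floor_add_one _
  have hloc := hloc K (by rwa [le_div_iff₀ hq0, mul_comm] at hKm)
  have hl₁ : κ ^ 742 ≤ κ ^ 373 := pow_le_pow_of_le_one hκ0.le hκ1 (by norm_num)
  have hl₂ : κ ^ 742 ≤ κ ^ 369 := pow_le_pow_of_le_one hκ0.le hκ1 (by norm_num)
  have hl₃ : κ ^ 742 ≤ 1 := pow_le_one₀ hκ0.le hκ1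
  have hl₀ : 0 < κ ^ 742 := pow_pos hκ0 _
  replace hdQ : (d : ℝ) ≤ (κ ^ 742)⁻¹ := hdQ.trans (inv_anti₀ hl₀ hl₂)
  replace hloc : κ ^ 742 * (q * P) * K ≤ _ := le_trans (by gcongr) hloc
  clear hl₁ hl₂ hK hκ
  generalize κ ^ 742 = l at *
  have hδl : δt = b * l := by rw [hκt]; field_simp
  have hlq : q ≤ l * m := by
    rw [hδl, mul_assoc] at hcase
    exact le_of_mul_le_mul_left hcase hb0
  have hK1 : 1 ≤ K := by
    have : 1 ≤ l * m / q := (one_le_div hq0).2 hlq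
    have : (0 : ℝ) < K := by linarith
    exact_mod_cast this
  have hK1R : (1 : ℝ) ≤ K := by exact_mod_cast hK1
  have hq1 : (1 : ℝ) ≤ q := by exact_mod_cast hq
  have hqK : q * K ≤ l * m := by rwa [le_div_iff₀ hq0, mul_comm] at hKm
  have hdl : d * l ≤ 1 := by
    calc d * l ≤ l⁻¹ * l := by gcongr
      _ = 1 := inv_mul_cancel₀ hl₀.ne'
  refine ⟨d, K, hd0, hK1, ?_, ?_, ?_, ?_⟩
  · refine hdQ.trans (le_of_eq ?_)
    rw [hδl]
    field_simp
  · calc δt * scale N q / q ≤ δt * (2 * m) / q := by gcongr; linarith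
      _ = 2 * b * (l * m / q) := by rw [hδl]; ring
      _ ≤ 2 * b * (2 * K) := by gcongr; linarith
      _ = _ := by ring
  · refine le_trans ?_ hmM
    calc (K : ℝ) ≤ l * m / q := hKm
      _ ≤ 1 * m / 1 := by gcongr
      _ = m := by ring
  · have hDK : q * d * K ≤ m := by
      have : (q * d * K : ℝ) ≤ m := by
        calc (q * d * K : ℝ) = d * (q * K) := by ring
          _ ≤ d * (l * m) := by gcongr
          _ = d * l * m := by ring
          _ ≤ 1 * m := by gcongr
          _ = m := one_mul _
      exact_mod_cast this
    have hfin := sum_periodise_le_localSum (n := q * P) (m := m) h₁ (by omega) (q * d) K hDK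
    push_cast at hfin
    have hNP : (N : ℝ) ≤ q * P := by exact_mod_cast (by omega : N ≤ q * P)
    calc δt * N * K = b * (l * N * K) := by rw [hδl]; ring
      _ ≤ b * (l * (q * P) * K) := by gcongr
      _ ≤ _ := mul_le_mul_of_nonneg_left (hloc.trans hfin) hb0.le

theorem le_one_of_le_countOp {N q : ℕ} {f₀ f₁ f₂ : ℤ → ℂ} (b₀ : OneBounded f₀)
    (b₁ : OneBounded f₁) (b₂ : OneBounded f₂) (h₀ : SupportedIn N f₀) (h₁ : SupportedIn N f₁)
    (hq : 0 < q) (hN : 0 < N) {δ : ℝ} (h : δ * N * scale N q ≤ ‖countOp N q f₀ f₁ f₂‖) :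
    δ ≤ 1 := by
  have hN0 : (0 : ℝ) < N := by exact_mod_cast hN
  have hM : 0 < scale N q := Real.sqrt_pos.2 (div_pos hN0 (by exact_mod_cast hq))
  have := (le_sum_norm_of_le_countOp b₀ b₂ h₀ h₁ hM h).trans (sum_norm_le_of_supportedIn b₁)
  exact le_of_mul_le_mul_right (by rwa [one_mul]) hN0

/-- Since δ ≤ 1, raising the exponents from t to larger ones weakens every conclusion. The lower
bound on N serves only to give q ≤ N. -/
theorem exists_uniform_constant {t u v w : ℕ} (htu : t ≤ u) (htv : t ≤ v) (htw : t ≤ w) {c : ℕ}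
    (hc : c = 29054267286336) (ht : 2 * c * 742 = t) :
    ∃ C : ℝ, 0 < C ∧
      ∀ (N q : ℕ) (f₀ f₁ f₂ : ℤ → ℂ) (δ : ℝ), 0 < q → 0 < δ →
        OneBounded f₀ → OneBounded f₁ → OneBounded f₂ →
        SupportedIn N f₀ → SupportedIn N f₁ → SupportedIn N f₂ →
        C * (q : ℝ) * (δ ^ 72)⁻¹ ≤ (N : ℝ) →
        δ * (N : ℝ) * scale N q ≤ ‖countOp N q f₀ f₁ f₂‖ →
        ∃ q' N' : ℕ, 0 < q' ∧ 0 < N' ∧ (q' : ℝ) ≤ C * (δ ^ u)⁻¹ ∧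
          δ ^ v * scale N q / (q : ℝ) ≤ C * (N' : ℝ) ∧ (N' : ℝ) ≤ scale N q ∧
          δ ^ w * (N : ℝ) * (N' : ℝ) ≤ C * localSum (q * q') N' f₁ := by
  obtain ⟨b, hbt⟩ : ∃ b : ℝ, (2 ^ 20) ^ t = b := ⟨_, rfl⟩
  have hb : 1 ≤ b := hbt ▸ one_le_pow₀ (by norm_num)
  refine ⟨4 * b, by linarith, ?_⟩
  intro N q f₀ f₁ f₂ δ hq hδ b₀ b₁ b₂ h₀ h₁ h₂ hN h
  have hq0 : (0 : ℝ) < q := by exact_mod_cast hq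
  have hC : 1 ≤ 4 * b := by linarith
  have hN0 : 0 < N := by
    have : (0 : ℝ) < N := lt_of_lt_of_le (by positivity) hN
    exact_mod_cast this
  have hδ1 : δ ≤ 1 := le_one_of_le_countOp b₀ b₁ b₂ h₀ h₁ hq hN0 h
  have hqN : q ≤ N := by
    have h72 : 1 ≤ (δ ^ 72)⁻¹ := (one_le_inv₀ (by positivity)).2 (pow_le_one₀ hδ.le hδ1)
    have : (q : ℝ) ≤ N := by
      calc (q : ℝ) = 1 * q * 1 := by ring
        _ ≤ 4 * b * q * (δ ^ 72)⁻¹ := by gcongr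
        _ ≤ N := hN
    exact_mod_cast this
  obtain ⟨q', N', hq', hN', g1, g2, g3, g4⟩ :=
    exists_local_of_countOp hq hδ b₀ b₁ b₂ h₀ h₁ h₂ hqN hδ1 h hb hc ht hbt
  have hmono : ∀ {s : ℕ}, t ≤ s → δ ^ s ≤ δ ^ t := fun hs => pow_le_pow_of_le_one hδ.le hδ1 hs
  have hM : 0 ≤ scale N q := Real.sqrt_nonneg _
  have hloc : 0 ≤ localSum (q * q') N' f₁ := tsum_nonneg fun _ => norm_nonneg _
  refine ⟨q', N', hq', hN', g1.trans ?_, le_trans ?_ g2, g3, ?_⟩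
  · exact mul_le_mul (by linarith) (inv_anti₀ (pow_pos hδ _) (hmono htu)) (by positivity)
      (by linarith)
  · have := hmono htv
    gcongr
  · have := hmono htw
    calc δ ^ w * N * N' ≤ δ ^ t * N * N' := by gcongr
      _ ≤ b * localSum (q * q') N' f₁ := g4
      _ ≤ _ := mul_le_mul_of_nonneg_right (by linarith) hloc

end NonlinearRoth

theorem theorem7p1 :
    ∃ C : ℝ, 0 < C ∧
      ∀ (N q : ℕ) (f₀ f₁ f₂ : ℤ → ℂ) (δ : ℝ),
        0 < q → 0 < δ →
        NonlinearRoth.OneBounded f₀ → NonlinearRoth.OneBounded f₁ →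
        NonlinearRoth.OneBounded f₂ →
        NonlinearRoth.SupportedIn N f₀ → NonlinearRoth.SupportedIn N f₁ →
        NonlinearRoth.SupportedIn N f₂ →
        C * (q : ℝ) * (δ ^ 72)⁻¹ ≤ (N : ℝ) →
        δ * (N : ℝ) * NonlinearRoth.scale N q ≤ ‖NonlinearRoth.countOp N q f₀ f₁ f₂‖ →
        ∃ q' N' : ℕ, 0 < q' ∧ 0 < N' ∧
          (q' : ℝ) ≤ C * (δ ^ (2 ^ 151))⁻¹ ∧
          δ ^ (2 ^ 153) * NonlinearRoth.scale N q / (q : ℝ) ≤ C * (N' : ℝ) ∧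
          (N' : ℝ) ≤ NonlinearRoth.scale N q ∧
          δ ^ (2 ^ 155) * (N : ℝ) * (N' : ℝ) ≤ C * NonlinearRoth.localSum (q * q') N' f₁ :=
  -- The exponent t = 2 · 29054267286336 · 742 is below 2 ^ 56, far less than the three exponents
  -- required.
  NonlinearRoth.exists_uniform_constant (by norm_num) (by norm_num) (by norm_num) rfl rfl
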